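/- **Proposition (Fefferman approximate solution).** Let $n\ge 2$, let $N$ be an oriented smooth manifold of dimension $n+1$ with a projective structure $[\nabla]$ (a class of torsion-free affine connections, where $\nabla'\sim\nabla$ if $\nabla'_XY=\nabla_XY+p(X)Y+p(Y)X$ for a 1-form $p$). Let $\Omega\subset N$ be a relatively compact domain with smooth boundary $M=\partial\Omega$ which is strictly convex: for some $\nabla\in[\nabla]$ and some defining function $r$ of $\Omega$ the Hessian $\nabla_i\nabla_j r$ is positive definite on $TM$. Defining functions and densities are smooth, are negative exactly on $\Omega$, vanish exactly on $M$, and have non-vanishing differential along $M$. For $w\in\mathbb R$ let $\mathcal E(w)$ denote the smooth sections of the density bundle $(\wedge^{n+1}T^*N)^{-w/(n+2)}$. For $\boldsymbol\rho\in\mathcal E(2)$ let $$\mathcal J[\boldsymbol\rho]=\det(D_ID_J\boldsymbol\rho)=\det\begin{pmatrix}2\boldsymbol\rho&\nabla_j\boldsymbol\rho\\ \nabla_i\boldsymbol\rho&\nabla_i\nabla_j\boldsymbol\rho+2\boldsymbol\rho P_{ij}\end{pmatrix}\in\mathcal E(0),$$ where $D_I$ is the projective tractor $D$-operator; here $\nabla\in[\nabla]$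 is the representative with $\nabla\tau=0$ for a projective scale (positive section) $\tau\in\mathcal E(1)$, $P_{ij}=\frac1n\mathrm{Ric}_{ij}$, $\boldsymbol\rho$ is trivialized by $\tau^2$, the determinant is taken in a frame unimodular for the volume $\tau^{-(n+2)}$, and the result does not depend on $\tau$. For $k\ge0$ and densities $f,g\in\mathcal E(w)$ write $f=g+O(\boldsymbol\rho^k)$ if $f=g+\phi\boldsymbol\rho^k$ with $\phi\in\mathcal E(w-2k)$, and $f=g+O(\boldsymbol\rho^\infty)$ if this holds for all $k$. Then there is a defining density $\boldsymbol\rho\in\mathcal E(2)$ of $\Omega$ with $$\mathcal J[\boldsymbol\rho]=\begin{cases}-1+O(\boldsymbol\rho^\infty)&\text{if } n\text{ is odd},\\ -1+\mathcal O\,\boldsymbol\rho^{n/2+1}\ \text{ for some }\mathcal O\in\mathcal E(-n-2)&\text{if } n\text{ is even}.\end{cases}$$ Moreover, any two such defining densities $\boldsymbol\rho,\boldsymbol\rho'$ satisfy $\boldsymbol\rho'=\boldsymbol\rho+O(\boldsymbol\rho^\infty)$ if $n$ is odd and $\boldsymbol\rho'=\boldsymbol\rho+O(\boldsymbol\rho^{n/2+2})$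 if $n$ is even. -/

import Mathlib

open Set Module
open scoped Manifold ContDiff Topology

noncomputable section

namespace ProjGeom

/-! Throughout, `N` is a smooth manifold of dimension `n + 1`. -/

/-- The tangent space of the `(n+1)`-manifold `N` at `x`. -/
abbrev Tan (n : ℕ) {N : Type*} [TopologicalSpace N]
    [ChartedSpace (EuclideanSpace ℝ (Fin (n + 1))) N] (x : N) : Type :=
  TangentSpace (𝓡 (n + 1)) x

/-- A frame of `N` at `x`: an ordered basis of the tangent space. -/
abbrev Frame (n : ℕ) {N : Type*} [TopologicalSpace N]
    [ChartedSpace (EuclideanSpace ℝ (Fin (n + 1))) N] (x : N) : Type :=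
  Basis (Fin (n + 1)) ℝ (Tan n x)

/-- The coordinate frame at `x` of the preferred chart at `x`. -/
def stdFrame (n : ℕ) {N : Type*} [TopologicalSpace N]
    [ChartedSpace (EuclideanSpace ℝ (Fin (n + 1))) N] (x : N) : Frame n x :=
  (EuclideanSpace.basisFun (Fin (n + 1)) ℝ).toBasis

section

variable {n : ℕ} {N : Type*} [TopologicalSpace N]
  [ChartedSpace (EuclideanSpace ℝ (Fin (n + 1))) N] [IsManifold (𝓡 (n + 1)) ∞ N]

/-- A tangent vector `v` at `x`, extended to a vector field which near `x` is smooth and has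
constant components in the preferred chart at `x`. -/
def ext {x : N} (v : Tan n x) (y : N) : Tan n y :=
  FiberBundle.extend (EuclideanSpace ℝ (Fin (n + 1)))
    (E := fun z : N => TangentSpace (𝓡 (n + 1)) z) v y

/-- The differential of a real function. -/
abbrev diff (f : N → ℝ) (x : N) : Tan n x →L[ℝ] ℝ :=
  mvfderiv (𝓡 (n + 1)) f x

end

/-! ### Affine connections and projective structures -/

/-- A smooth torsion-free affine connection on `N`. In Mathlib's convention `conn.cov Y x u` is
the covariant derivative at `x` of the vector field `Y` in the direction of the vector `u`. -/
structure AffineConnection (n : ℕ) (N : Type*) [TopologicalSpace N]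
    [ChartedSpace (EuclideanSpace ℝ (Fin (n + 1))) N] [IsManifold (𝓡 (n + 1)) ∞ N] where
  cov : CovariantDerivative (𝓡 (n + 1)) (EuclideanSpace ℝ (Fin (n + 1)))
    (fun x : N => TangentSpace (𝓡 (n + 1)) x)
  smooth : CovariantDerivative.ContMDiffCovariantDerivative cov ∞
  torsion_free : cov.torsion = 0

section

variable {n : ℕ} {N : Type*} [TopologicalSpace N]
  [ChartedSpace (EuclideanSpace ℝ (Fin (n + 1))) N] [IsManifold (𝓡 (n + 1)) ∞ N]

/-- Projective equivalence: `∇'_u Y = ∇_u Y + p(u) Y + p(Y) u` for some 1-form `p`.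
(`p` is automatically smooth, as both connections are.) -/
def ProjEquiv (c c' : AffineConnection n N) : Prop :=
  ∃ p : ∀ x : N, Tan n x →L[ℝ] ℝ, ∀ (Y : ∀ x : N, Tan n x) (x : N),
    MDifferentiableAt (𝓡 (n + 1)) ((𝓡 (n + 1)).prod 𝓘(ℝ, EuclideanSpace ℝ (Fin (n + 1))))
      (fun y => Bundle.TotalSpace.mk' (EuclideanSpace ℝ (Fin (n + 1))) y (Y y)) x →
    ∀ u : Tan n x, c'.cov Y x u = c.cov Y x u + p x u • Y x + p x (Y x) • u

theorem ProjEquiv.equivalence : Equivalence (ProjEquiv (n := n) (N := N)) where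
  refl c := ⟨fun _ => 0, fun Y x _ u => by simp⟩
  symm := by
    rintro c c' ⟨p, hp⟩
    refine ⟨fun x => -p x, fun Y x hY u => ?_⟩
    rw [hp Y x hY u]
    simp only [neg_apply]
    module
  trans := by
    rintro c c' c'' ⟨p, hp⟩ ⟨q, hq⟩
    refine ⟨fun x => p x + q x, fun Y x hY u => ?_⟩
    rw [hq Y x hY u, hp Y x hY u]
    simp only [add_apply]
    module

end

/-- Projective equivalence as an equivalence relation. -/
instance projSetoid (n : ℕ) (N : Type*) [TopologicalSpace N]
    [ChartedSpace (EuclideanSpace ℝ (Fin (n + 1))) N] [IsManifold (𝓡 (n + 1)) ∞ N] :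
    Setoid (AffineConnection n N) :=
  ⟨ProjEquiv, ProjEquiv.equivalence⟩

/-- A projective structure: a projective equivalence class of torsion-free affine connections. -/
abbrev ProjectiveStructure (n : ℕ) (N : Type*) [TopologicalSpace N]
    [ChartedSpace (EuclideanSpace ℝ (Fin (n + 1))) N] [IsManifold (𝓡 (n + 1)) ∞ N] : Type _ :=
  Quotient (projSetoid n N)

/-- `c` is a representative connection of the projective structure `P`. -/
def IsRep {n : ℕ} {N : Type*} [TopologicalSpace N]
    [ChartedSpace (EuclideanSpace ℝ (Fin (n + 1))) N] [IsManifold (𝓡 (n + 1)) ∞ N]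
    (P : ProjectiveStructure n N) (c : AffineConnection n N) : Prop :=
  Quotient.mk (projSetoid n N) c = P

/-! ### Projective densities -/

/-- A smooth section of the projective density bundle `𝓔(w) = (⋀ⁿ⁺¹ T*N)^(-w/(n+2))`.
A volume form is the same thing as a function `ω` on frames with
`ω (A e₁, …, A eₙ₊₁) = det A * ω (e₁, …, eₙ₊₁)`; accordingly a density of weight `w` is a function
on frames which is multiplied by `|det A| ^ (-w/(n+2))`. By the absolute value it is defined on
all frames and not only on the positive ones of an orientation; on an oriented manifold
restriction to the positive frames loses nothing. (Values on tuples of vectors that are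
not frames are irrelevant and never used.) -/
structure Density (n : ℕ) (N : Type*) [TopologicalSpace N]
    [ChartedSpace (EuclideanSpace ℝ (Fin (n + 1))) N] [IsManifold (𝓡 (n + 1)) ∞ N] (w : ℝ) where
  val : ∀ x : N, (Fin (n + 1) → Tan n x) → ℝ
  equivariant : ∀ (x : N) (e : Frame n x) (A : Tan n x ≃ₗ[ℝ] Tan n x),
    val x (fun i => A (e i)) =
      |LinearMap.det (A : Tan n x →ₗ[ℝ] Tan n x)| ^ (-w / ((n : ℝ) + 2)) * val x e
  smooth : ∀ (x : N) (e : Frame n x),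
    ContMDiffAt (𝓡 (n + 1)) 𝓘(ℝ, ℝ) ∞ (fun y => val y (fun i => ext (e i) y)) x

section

variable {n : ℕ} {N : Type*} [TopologicalSpace N]
  [ChartedSpace (EuclideanSpace ℝ (Fin (n + 1))) N] [IsManifold (𝓡 (n + 1)) ∞ N]

/-- The value, as a component with respect to the frame `e`, of `∇_u σ` at `x`, for a density `σ`
of weight `w`: it is `u(σ(e)) + w/(n+2) * tr(ω(u)) * σ(e)`, where `ω` is the matrix of connection
forms, `∇ e_j = ω_j^k e_k`, of a local frame extending `e`. -/
def Density.covDeriv {w : ℝ} (σ : Density n N w) (c : AffineConnection n N) (x : N)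
    (e : Frame n x) (u : Tan n x) : ℝ :=
  diff (n := n) (fun y => σ.val y (fun i => ext (e i) y)) x u
    + w / ((n : ℝ) + 2) * (∑ j, e.repr (c.cov (ext (e j)) x u) j) * σ.val x e

/-- A projective scale: a positive section of `𝓔(1)`. -/
def Density.IsScale (τ : Density n N 1) : Prop :=
  ∀ (x : N) (e : Frame n x), 0 < τ.val x e

/-- `∇τ = 0`. -/
def Density.IsParallel (τ : Density n N 1) (c : AffineConnection n N) : Prop :=
  ∀ (x : N) (e : Frame n x) (u : Tan n x), τ.covDeriv c x e u = 0

/-- The function `τ⁻² ρ` for a density `ρ` of weight 2 and a scale `τ`. -/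
def Density.inScale (ρ : Density n N 2) (τ : Density n N 1) (x : N) : ℝ :=
  ρ.val x (stdFrame n x) / (τ.val x (stdFrame n x)) ^ 2

/-! ### Curvature -/

/-- `R(X, Y) Z = ∇_X ∇_Y Z - ∇_Y ∇_X Z - ∇_[X,Y] Z` at `x`, for vector fields smooth near `x`. -/
def AffineConnection.curvature (c : AffineConnection n N) (X Y Z : ∀ x : N, Tan n x) (x : N) :
    Tan n x :=
  c.cov (fun y => c.cov Z y (Y y)) x (X x) - c.cov (fun y => c.cov Z y (X y)) x (Y x)
    - c.cov Z x (VectorField.mlieBracket (𝓡 (n + 1)) X Y x)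

/-- `Ric(v, w) = tr (u ↦ R(u, v) w)`. -/
def AffineConnection.ricci (c : AffineConnection n N) (x : N) (v w : Tan n x) : ℝ :=
  ∑ i, (stdFrame n x).repr
    (c.curvature (ext (stdFrame n x i)) (ext v) (ext w) x) i

/-- The projective Schouten tensor `P = Ric / n`. -/
def AffineConnection.schouten (c : AffineConnection n N) (x : N) (v w : Tan n x) : ℝ :=
  c.ricci x v w / n

/-- `(∇_u μ)(v)` for a 1-form `μ`. -/
def AffineConnection.covOneForm (c : AffineConnection n N) (μ : ∀ x : N, Tan n x →L[ℝ] ℝ) (x : N)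
    (u v : Tan n x) : ℝ :=
  diff (n := n) (fun y => μ y (ext v y)) x u - μ x (c.cov (ext v) x u)

/-! ### Tractor calculus in a projective scale

Once a scale `τ` is chosen, and `∇` is the representative connection with `∇τ = 0`, a
density of weight `w` is `τ^w f` for a function `f`, with `∇ (τ^w f) = τ^w df`, and the dual
tractor bundle is `𝓔(1) ⊕ 𝓔_i(1)`. -/

/-- A (weighted) section `(σ, μ_i)` of the dual tractor bundle, in a scale. -/
structure Cotractor (n : ℕ) (N : Type*) [TopologicalSpace N]
    [ChartedSpace (EuclideanSpace ℝ (Fin (n + 1))) N] where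
  top : N → ℝ
  bot : ∀ x : N, Tan n x →L[ℝ] ℝ

/-- The tractor D-operator `D_J f = (w f, ∇_j f)` on densities of weight `w`, in a scale. -/
def tractorD (w : ℝ) (f : N → ℝ) : Cotractor n N where
  top x := w * f x
  bot x := diff (n := n) f x

/-- The tractor D-operator `D_I t_J = (w t_J, ∇_i t_J)` on dual tractors of weight `w`, in a scale,
as a matrix of components with respect to a frame `e` at `x`. Here `∇_i` is the
tractor connection `∇_i (σ, μ_j) = (∇_i σ - μ_i, ∇_i μ_j + P_ij σ)`; the index `I` labels the rows,
the index `J` the columns, and `Sum.inl ()` is the index `0`. -/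
def tractorDD (c : AffineConnection n N) (w : ℝ) (t : Cotractor n N) (x : N) (e : Frame n x) :
    Matrix (Unit ⊕ Fin (n + 1)) (Unit ⊕ Fin (n + 1)) ℝ :=
  Matrix.fromBlocks
    (Matrix.of fun _ _ => w * t.top x)
    (Matrix.of fun _ j => w * t.bot x (e j))
    (Matrix.of fun i _ => diff (n := n) t.top x (e i) - t.bot x (e i))
    (Matrix.of fun i j => c.covOneForm t.bot x (e i) (e j) + c.schouten x (e i) (e j) * t.top x)

/-- The matrix of `D_I D_J ρ` for `ρ ∈ 𝓔(2)`, computed in the scale `τ` (with `c` the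
representative connection for which `τ` is parallel), with respect to a frame `e`. -/
def tractorHessian (c : AffineConnection n N) (τ : Density n N 1) (ρ : Density n N 2) (x : N)
    (e : Frame n x) : Matrix (Unit ⊕ Fin (n + 1)) (Unit ⊕ Fin (n + 1)) ℝ :=
  tractorDD c 1 (tractorD 2 (ρ.inScale τ)) x e

/-! ### Domains, defining functions and defining densities -/

/-- `r` is a smooth defining function of `Ω`, negative inside. -/
structure IsDefiningFunction (Ω : Set N) (r : N → ℝ) : Prop where
  smooth : ContMDiff (𝓡 (n + 1)) 𝓘(ℝ, ℝ) ∞ r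
  neg : ∀ x, r x < 0 ↔ x ∈ Ω
  zero : ∀ x, r x = 0 ↔ x ∈ frontier Ω
  diff_ne_zero : ∀ x ∈ frontier Ω, diff (n := n) r x ≠ 0

/-- `ρ` is a defining density of `Ω`, negative inside. -/
structure IsDefiningDensity (Ω : Set N) (ρ : Density n N 2) : Prop where
  neg : ∀ (x : N) (e : Frame n x), ρ.val x e < 0 ↔ x ∈ Ω
  zero : ∀ (x : N) (e : Frame n x), ρ.val x e = 0 ↔ x ∈ frontier Ω
  diff_ne_zero : ∀ x ∈ frontier Ω, ∀ e : Frame n x,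
    diff (n := n) (fun y => ρ.val y (fun i => ext (e i) y)) x ≠ 0

/-- `Ω` has smooth boundary `M` (it has a smooth defining function) and `M` is strictly convex for
the projective structure `P`: the restriction of the Hessian `∇_i ∇_j r` to `TM = ker dr` is
positive definite for some `∇` in the class and some defining function `r`. -/
def HasStrictlyConvexBoundary (P : ProjectiveStructure n N) (Ω : Set N) : Prop :=
  ∃ (c : AffineConnection n N) (r : N → ℝ), IsRep P c ∧ IsDefiningFunction (n := n) Ω r ∧
    ∀ x ∈ frontier Ω, ∀ u : Tan n x, diff (n := n) r x u = 0 → u ≠ 0 →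
      0 < c.covOneForm (diff (n := n) r) x u u

/-! ### The approximate Monge–Ampère equation -/

/-- `det (D_I D_J ρ) = -1 + φ ρ^k` for some smooth density `φ ∈ 𝓔(-2k)`. The left side is the
density of weight 0 obtained, in any projective scale `τ`, as the determinant in a frame `e` which
is unimodular for the volume `τ^(-(n+2))`, i.e. `τ(e) = 1`. -/
def SolvesMongeAmpereMod (P : ProjectiveStructure n N) (ρ : Density n N 2) (k : ℕ) : Prop :=
  ∃ φ : Density n N (-2 * (k : ℝ)),
    ∀ (τ : Density n N 1) (c : AffineConnection n N),
      τ.IsScale → IsRep P c → τ.IsParallel c →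
        ∀ (x : N) (e : Frame n x), τ.val x e = 1 →
          (tractorHessian c τ ρ x e).det = -1 + φ.val x e * ρ.val x e ^ k

/-- `ρ` is a Fefferman defining density: `det (D_I D_J ρ)` is `-1 + O(ρ^∞)` for `n` odd and
`-1 + 𝒪 ρ^(n/2+1)` with a density `𝒪 ∈ 𝓔(-n-2)` for `n` even. -/
structure IsFeffermanDensity (P : ProjectiveStructure n N) (Ω : Set N) (ρ : Density n N 2) :
    Prop where
  defining : IsDefiningDensity Ω ρ
  odd : Odd n → ∀ k : ℕ, SolvesMongeAmpereMod P ρ k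
  even : Even n → SolvesMongeAmpereMod P ρ (n / 2 + 1)

/-- `ρ' = ρ + O(ρ^k)`: the difference is `φ ρ^k` for some smooth density `φ ∈ 𝓔(2-2k)`. -/
def EqMod (ρ ρ' : Density n N 2) (k : ℕ) : Prop :=
  ∃ φ : Density n N (2 - 2 * (k : ℝ)), ∀ (x : N) (e : Frame n x),
    ρ'.val x e - ρ.val x e = φ.val x e * ρ.val x e ^ k

end

end ProjGeom

end

set_option linter.unusedSectionVars false

/-! Fix a scale `τ` and the representative connection preserving it. A defining density is then `τ ^
2 * f` with `f` a defining function, and the operator becomes the bordered Hessian determinant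
`mongeAmpere c τ f`. A change of scale rescales this matrix and composes it with a unipotent
congruence, and the powers of `τ` compensate (`ExactProjChange.mongeAmpere_eq`). Hence one scale
suffices (`solvesMongeAmpereMod_iff`), and the problem concerns one function `f` along its regular
zero set `M`.

On `M`, replacing `f` by `u * f` multiplies the operator by `u ^ (n + 2)`
(`mongeAmpere_mul_of_zero`), and strict convexity makes it negative there (`mongeAmpere_neg`). So a
positive `u` normalising it to `-1` on `M` exists and is unique on `M`.

For higher orders the key formula is `mongeAmpere_add_mul_pow`: `J[f + φ f^(m+2)] = J[f] (1 +
(m+2)(n-2m) φ f^(m+1)) + O(f^(m+2))`. Its algebraic core is `det_rank_two_perturbation`. An error `ψ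
f^(m+1)` is therefore removed by `φ = ψ / ((m+2)(n-2m))` on `M`, and by no other boundary value,
unless `n = 2m`. For even `n` the induction stops at `m = n/2`, leaving an error of order `n/2+1`
and uniqueness to order `n/2+2`. For odd `n` nothing obstructs it, and Borel's lemma sums the
corrections (`exists_solvesMod_all`). The same formula read as a comparison of two solutions gives
uniqueness (`FunEqMod.succ`).

Two technical themes recur. The remainders have to be smooth across `M`: the determinant identities
are proved over an arbitrary commutative ring, applied to the ring of functions smooth on a
coordinate domain, and the local quotients are glued by partitions of unity, the admissible values
at each point being convex. And each correction must multiply `f` by a positive function, so that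
the zero set and the sign are kept globally. -/

namespace ProjGeom

/-! ### Vector fields acting on functions; the Lie bracket in a chart. -/

section

variable {n : ℕ} {N : Type*} [TopologicalSpace N]
  [ChartedSpace (EuclideanSpace ℝ (Fin (n + 1))) N] [IsManifold (𝓡 (n + 1)) ∞ N]

/-- Smoothness at a point of a vector field. -/
def SmoothAt (V : ∀ y : N, Tan n y) (x : N) : Prop :=
  ContMDiffAt (𝓡 (n + 1)) ((𝓡 (n + 1)).prod 𝓘(ℝ, EuclideanSpace ℝ (Fin (n + 1)))) ∞
    (fun y => Bundle.TotalSpace.mk' (EuclideanSpace ℝ (Fin (n + 1))) y (V y)) x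

theorem SmoothAt.mdiff {V : ∀ y : N, Tan n y} {x : N} (h : SmoothAt V x) :
    MDifferentiableAt (𝓡 (n + 1)) ((𝓡 (n + 1)).prod 𝓘(ℝ, EuclideanSpace ℝ (Fin (n + 1))))
      (fun y => Bundle.TotalSpace.mk' (EuclideanSpace ℝ (Fin (n + 1))) y (V y)) x :=
  ContMDiffAt.mdifferentiableAt h (by simp)

theorem contMDiffAt_diff {f : N → ℝ} {V : ∀ y : N, Tan n y} {x : N}
    (hf : ContMDiffAt (𝓡 (n + 1)) 𝓘(ℝ, ℝ) ∞ f x) (hV : SmoothAt V x) :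
    ContMDiffAt (𝓡 (n + 1)) 𝓘(ℝ, ℝ) ∞ (fun y => diff (n := n) f y (V y)) x := by
  have h1 := hf.mfderiv_const (m := ∞) le_rfl
  have h2 := ContMDiffAt.clm_apply_of_inCoordinates (n := ∞) (b₁ := id) (b₂ := f) (m₀ := x)
    (E₁ := fun z : N => TangentSpace (𝓡 (n + 1)) z)
    (E₂ := fun z : ℝ => TangentSpace 𝓘(ℝ, ℝ) z)
    (ϕ := fun y => mfderiv (𝓡 (n + 1)) 𝓘(ℝ, ℝ) f y) (v := V) h1 hV hf
  exact (contMDiff_snd_tangentBundle_modelSpace ℝ 𝓘(ℝ, ℝ) (n := ∞)).contMDiffAt.comp x h2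

/-- Chain rule for `f ∘ φ.symm`. The point `y` ranges over the whole domain of the chart at `x`, so
the formula can be differentiated once more at `x`. -/
theorem diff_eq_fderiv {f : N → ℝ} {x y : N}
    (hy : y ∈ (chartAt (EuclideanSpace ℝ (Fin (n + 1))) x).source)
    (hf : MDifferentiableAt (𝓡 (n + 1)) 𝓘(ℝ, ℝ) f y) (V : ∀ y : N, Tan n y) :
    diff (n := n) f y (V y) = fderiv ℝ (f ∘ (extChartAt (𝓡 (n + 1)) x).symm)
      (extChartAt (𝓡 (n + 1)) x y)
      (VectorField.mpullbackWithin 𝓘(ℝ, EuclideanSpace ℝ (Fin (n + 1))) (𝓡 (n + 1))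
        (extChartAt (𝓡 (n + 1)) x).symm V (range (𝓡 (n + 1))) (extChartAt (𝓡 (n + 1)) x y)) := by
  have hy' : y ∈ (extChartAt (𝓡 (n + 1)) x).source := by simpa using hy
  have ht : extChartAt (𝓡 (n + 1)) x y ∈ (extChartAt (𝓡 (n + 1)) x).target :=
    (extChartAt (𝓡 (n + 1)) x).map_source hy'
  have hl : (extChartAt (𝓡 (n + 1)) x).symm (extChartAt (𝓡 (n + 1)) x y) = y :=
    (extChartAt (𝓡 (n + 1)) x).left_inv hy'
  set φ := extChartAt (𝓡 (n + 1)) x with hφ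
  have hs : MDifferentiableAt 𝓘(ℝ, EuclideanSpace ℝ (Fin (n + 1))) (𝓡 (n + 1)) φ.symm (φ y) := by
    have := mdifferentiableWithinAt_extChartAt_symm (I := 𝓡 (n + 1)) ht
    rwa [← hφ, ModelWithCorners.range_eq_univ, mdifferentiableWithinAt_univ] at this
  have hc := mfderiv_comp_of_eq (I' := 𝓡 (n + 1)) (I'' := 𝓘(ℝ, ℝ)) hf hs hl
  rw [mfderiv_eq_fderiv] at hc
  rw [hc]
  have hinv := isInvertible_mfderivWithin_extChartAt_symm (I := 𝓡 (n + 1)) ht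
  have hu : range (𝓡 (n + 1)) = univ := by simp
  rw [← hφ, hu, mfderivWithin_univ] at hinv
  rw [VectorField.mpullbackWithin_apply, hu, mfderivWithin_univ]
  have hL : ∀ v, mfderiv 𝓘(ℝ, EuclideanSpace ℝ (Fin (n + 1))) (𝓡 (n + 1)) φ.symm (φ y)
      ((mfderiv 𝓘(ℝ, EuclideanSpace ℝ (Fin (n + 1))) (𝓡 (n + 1)) φ.symm (φ y)).inverse v) = v :=
    fun v => by
      obtain ⟨e, he⟩ := hinv
      rw [← he, ContinuousLinearMap.inverse_equiv]
      exact e.apply_symm_apply v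
  change _ = (mfderiv (𝓡 (n + 1)) 𝓘(ℝ, ℝ) f _) (mfderiv 𝓘(ℝ, EuclideanSpace ℝ (Fin (n + 1)))
    (𝓡 (n + 1)) φ.symm (φ y) _)
  rw [hL, hl]
  rfl

/-- The derivative of the preferred chart at its own base point is the identity, so no push-forward
remains. -/
theorem mlieBracket_eq_lieBracket (U V : ∀ y : N, Tan n y) (x : N) :
    VectorField.mlieBracket (𝓡 (n + 1)) U V x = VectorField.lieBracket ℝ
      (VectorField.mpullbackWithin 𝓘(ℝ, EuclideanSpace ℝ (Fin (n + 1))) (𝓡 (n + 1))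
        (extChartAt (𝓡 (n + 1)) x).symm U (range (𝓡 (n + 1))))
      (VectorField.mpullbackWithin 𝓘(ℝ, EuclideanSpace ℝ (Fin (n + 1))) (𝓡 (n + 1))
        (extChartAt (𝓡 (n + 1)) x).symm V (range (𝓡 (n + 1)))) (extChartAt (𝓡 (n + 1)) x x) := by
  have hid (v : EuclideanSpace ℝ (Fin (n + 1))) :
      (ContinuousLinearMap.id ℝ (EuclideanSpace ℝ (Fin (n + 1)))).inverse v = v := by
    rw [ContinuousLinearMap.inverse_id]; rfl
  have hlb (A B : EuclideanSpace ℝ (Fin (n + 1)) → EuclideanSpace ℝ (Fin (n + 1)))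
      (z : EuclideanSpace ℝ (Fin (n + 1))) :
      VectorField.lieBracketWithin ℝ A B (range (𝓡 (n + 1))) z =
        VectorField.lieBracket ℝ A B z := by
    rw [ModelWithCorners.range_eq_univ, VectorField.lieBracketWithin_univ]
  rw [← VectorField.mlieBracketWithin_univ, VectorField.mlieBracketWithin_apply,
    mfderiv_extChartAt_self, preimage_univ, univ_inter]
  refine (hid _).trans ?_
  exact hlb _ _ _

theorem mpullback_mlieBracket_eq (U V : ∀ y : N, Tan n y) (x : N) :
    VectorField.mpullbackWithin 𝓘(ℝ, EuclideanSpace ℝ (Fin (n + 1))) (𝓡 (n + 1))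
        (extChartAt (𝓡 (n + 1)) x).symm (VectorField.mlieBracket (𝓡 (n + 1)) U V)
        (range (𝓡 (n + 1))) (extChartAt (𝓡 (n + 1)) x x) =
      VectorField.mlieBracket (𝓡 (n + 1)) U V x := by
  rw [VectorField.mpullbackWithin_apply, extChartAt_to_inv]
  exact mfderivWithin_extChartAt_symm_inverse_apply (I := 𝓡 (n + 1)) _

/-- In the chart this is the symmetry of the second derivative. It accounts for every cancellation
of second derivatives in the curvature identities below. -/
theorem diff_mlieBracket {f : N → ℝ} {U V : ∀ y : N, Tan n y} {x : N}
    (hf : ContMDiffAt (𝓡 (n + 1)) 𝓘(ℝ, ℝ) ∞ f x) (hU : SmoothAt U x) (hV : SmoothAt V x) :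
    diff (n := n) f x (VectorField.mlieBracket (𝓡 (n + 1)) U V x) =
      diff (n := n) (fun y => diff (n := n) f y (V y)) x (U x) -
      diff (n := n) (fun y => diff (n := n) f y (U y)) x (V x) := by
  have hx := mem_chart_source (EuclideanSpace ℝ (Fin (n + 1))) x
  have hx' := mem_extChartAt_source (I := 𝓡 (n + 1)) x
  have hfd : ∀ᶠ y in 𝓝 x, MDifferentiableAt (𝓡 (n + 1)) 𝓘(ℝ, ℝ) f y := by
    have : ContMDiffAt (𝓡 (n + 1)) 𝓘(ℝ, ℝ) 1 f x := hf.of_le (by simp)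
    filter_upwards [(contMDiffAt_iff_contMDiffAt_nhds (by simp)).1 this] with y hy
    exact hy.mdifferentiableAt (by simp)
  set φ := extChartAt (𝓡 (n + 1)) x with hφ
  have hu : range (𝓡 (n + 1)) = univ := by simp
  have hfc : ContDiffAt ℝ ∞ (f ∘ φ.symm) (φ x) := by
    have := contMDiffAt_iff_source.1 hf
    rwa [hu, contMDiffWithinAt_univ, contMDiffAt_iff_contDiffAt] at this
  have hW : ∀ W : ∀ y : N, Tan n y, SmoothAt W x → DifferentiableAt ℝ
      (VectorField.mpullbackWithin 𝓘(ℝ, EuclideanSpace ℝ (Fin (n + 1))) (𝓡 (n + 1))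
        φ.symm W (range (𝓡 (n + 1)))) (φ x) := by
    intro W hW
    have := VectorField.contMDiffWithinAt_mpullbackWithin_extChartAt_symm (I := 𝓡 (n + 1)) (n := ∞) (m := 1)
      (s := univ) (V := W) (x := x) (contMDiffWithinAt_univ.2 (hW.of_le (by simp))) uniqueMDiffOn_univ (mem_univ _)
      (by rw [one_add_one_eq_two]; exact WithTop.coe_le_coe.2 (le_top : (2 : ℕ∞) ≤ ⊤))
    rw [contMDiffWithinAt_vectorSpace_iff_contDiffWithinAt] at this
    have h2 := this.contDiffAt (by
      rw [preimage_univ, inter_univ]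
      exact extChartAt_target_mem_nhds (I := 𝓡 (n + 1)) x)
    exact h2.differentiableAt (by simp)
  have key : ∀ W : ∀ y : N, Tan n y, SmoothAt W x →
      (fun y => diff (n := n) f y (W y)) ∘ φ.symm =ᶠ[𝓝 (φ x)] fun z => fderiv ℝ (f ∘ φ.symm) z
        (VectorField.mpullbackWithin 𝓘(ℝ, EuclideanSpace ℝ (Fin (n + 1))) (𝓡 (n + 1))
        φ.symm W (range (𝓡 (n + 1))) z) := by
    intro W hW
    have hc : Filter.Tendsto φ.symm (𝓝 (φ x)) (𝓝 x) := by
      have := continuousAt_extChartAt_symm (I := 𝓡 (n + 1)) x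
      rwa [ContinuousAt, extChartAt_to_inv] at this
    filter_upwards [hc.eventually hfd, extChartAt_target_mem_nhds (I := 𝓡 (n + 1)) x] with z hz hzt
    have hzs := φ.map_target hzt
    rw [Function.comp_apply, diff_eq_fderiv (x := x) (by simpa [hφ] using hzs) hz W, ← hφ,
      φ.right_inv hzt]
  have hd : ∀ W : ∀ y : N, Tan n y, SmoothAt W x → MDifferentiableAt (𝓡 (n + 1)) 𝓘(ℝ, ℝ)
      (fun y => diff (n := n) f y (W y)) x := fun W hW =>
    (contMDiffAt_diff hf hW).mdifferentiableAt (by simp)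
  have two_le : minSmoothness ℝ 2 ≤ (∞ : ℕ∞ω) := by
    rw [minSmoothness_of_isRCLikeNormedField]
    exact WithTop.coe_le_coe.2 (le_top : (2 : ℕ∞) ≤ ⊤)
  rw [diff_eq_fderiv hx (hd V hV) U, diff_eq_fderiv hx (hd U hU) V,
    (key U hU).fderiv_eq, (key V hV).fderiv_eq, ← VectorField.fderiv_apply_lieBracket hfc two_le (hW V hV) (hW U hU),
    diff_eq_fderiv hx hfd.self_of_nhds]
  rw [mpullback_mlieBracket_eq, mlieBracket_eq_lieBracket]

end

/-! ### Fields smooth near a point; local linearity of `ext`. -/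

section
variable {n : ℕ} {N : Type*} [TopologicalSpace N]
  [ChartedSpace (EuclideanSpace ℝ (Fin (n + 1))) N] [IsManifold (𝓡 (n + 1)) ∞ N]

/-- Smoothness of a vector field on a neighbourhood of a point. -/
def SmoothNear (V : ∀ y : N, Tan n y) (x : N) : Prop := ∀ᶠ y in 𝓝 x, SmoothAt V y

theorem SmoothNear.smoothAt {V : ∀ y : N, Tan n y} {x : N} (h : SmoothNear V x) : SmoothAt V x :=
  h.self_of_nhds

theorem SmoothNear.mdiff {V : ∀ y : N, Tan n y} {x : N} (h : SmoothNear V x) :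
    MDifferentiableAt (𝓡 (n + 1)) ((𝓡 (n + 1)).prod 𝓘(ℝ, EuclideanSpace ℝ (Fin (n + 1))))
      (fun y => Bundle.TotalSpace.mk' (EuclideanSpace ℝ (Fin (n + 1))) y (V y)) x :=
  h.smoothAt.mdiff

theorem SmoothNear.eventually {V : ∀ y : N, Tan n y} {x : N} (h : SmoothNear V x) :
    ∀ᶠ y in 𝓝 x, SmoothNear V y := eventually_eventually_nhds.2 h

theorem SmoothAt.add {V W : ∀ y : N, Tan n y} {x : N} (hV : SmoothAt V x) (hW : SmoothAt W x) :
    SmoothAt (V + W) x := ContMDiffAt.add_section hV hW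

theorem SmoothAt.sub {V W : ∀ y : N, Tan n y} {x : N} (hV : SmoothAt V x) (hW : SmoothAt W x) :
    SmoothAt (V - W) x := ContMDiffAt.sub_section hV hW

theorem SmoothAt.smul {g : N → ℝ} {V : ∀ y : N, Tan n y} {x : N}
    (hg : ContMDiffAt (𝓡 (n + 1)) 𝓘(ℝ, ℝ) ∞ g x) (hV : SmoothAt V x) :
    SmoothAt (g • V) x := ContMDiffAt.smul_section hg hV

theorem SmoothAt.congr {V W : ∀ y : N, Tan n y} {x : N} (hV : SmoothAt V x)
    (h : ∀ᶠ y in 𝓝 x, W y = V y) : SmoothAt W x :=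
  ContMDiffAt.congr_of_eventuallyEq hV (h.mono fun y hy => by simp only [hy])

theorem ext_self {x : N} (v : Tan n x) : ext v x = v := by simp [ext]

theorem ext_eq {x : N} (v : Tan n x) (y : N) :
    ext v y = (trivializationAt (EuclideanSpace ℝ (Fin (n + 1)))
      (fun z : N => TangentSpace (𝓡 (n + 1)) z) x).symm y
      ((trivializationAt (EuclideanSpace ℝ (Fin (n + 1)))
      (fun z : N => TangentSpace (𝓡 (n + 1)) z) x).continuousLinearMapAt ℝ x v) := by
  rw [ext, FiberBundle.extend, Bundle.Trivialization.continuousLinearMapAt_apply,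
    Bundle.Trivialization.linearMapAt_apply, if_pos (FiberBundle.mem_baseSet_trivializationAt' x)]

/-- A linear map which near `x` is `v ↦ ext v y`. -/
noncomputable def extL (x y : N) : Tan n x →ₗ[ℝ] Tan n y :=
  ((trivializationAt (EuclideanSpace ℝ (Fin (n + 1)))
      (fun z : N => TangentSpace (𝓡 (n + 1)) z) x).symmₗ ℝ y).comp
   ((trivializationAt (EuclideanSpace ℝ (Fin (n + 1)))
      (fun z : N => TangentSpace (𝓡 (n + 1)) z) x).continuousLinearMapAt ℝ x).toLinearMap

theorem ext_eq_extL (x : N) : ∀ᶠ y : N in 𝓝 x, ∀ v : Tan n x, ext v y = extL x y v := by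
  filter_upwards [(trivializationAt (EuclideanSpace ℝ (Fin (n + 1)))
    (fun z : N => TangentSpace (𝓡 (n + 1)) z) x).open_baseSet.mem_nhds
    (FiberBundle.mem_baseSet_trivializationAt' x)] with y hy v
  rw [ext_eq, extL, LinearMap.comp_apply, Bundle.Trivialization.symmₗ_apply _ hy]
  rfl

theorem ext_add {x : N} (v w : Tan n x) :
    ∀ᶠ y : N in 𝓝 x, ext (n := n) (v + w) y = ext v y + ext w y := by
  filter_upwards [ext_eq_extL (n := n) x] with y hy
  simp only [hy, map_add]

theorem ext_smul {x : N} (a : ℝ) (v : Tan n x) : ∀ᶠ y : N in 𝓝 x, ext (n := n) (a • v) y = a • ext v y := by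
  filter_upwards [ext_eq_extL (n := n) x] with y hy
  simp only [hy, map_smul]

theorem ext_smoothNear {x : N} (v : Tan n x) : SmoothNear (ext v) x := by
  obtain ⟨s, hs, h⟩ := FiberBundle.exists_contMDiffOn_extend (k := ∞) (𝓡 (n + 1))
    (EuclideanSpace ℝ (Fin (n + 1))) (V := fun z : N => TangentSpace (𝓡 (n + 1)) z) v
  filter_upwards [eventually_mem_nhds_iff.2 hs] with y hy using h.contMDiffAt hy

/-- Near `x`, extending a frame at `x` gives a frame. -/
theorem exists_basis_ext (x : N) : ∀ᶠ y in 𝓝 x, ∀ e : Frame n x, ∃ b : Frame n y,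
    ∀ i, b i = ext (e i) y := by
  set t := trivializationAt (EuclideanSpace ℝ (Fin (n + 1)))
      (fun z : N => TangentSpace (𝓡 (n + 1)) z) x with ht
  have hx : x ∈ t.baseSet := FiberBundle.mem_baseSet_trivializationAt' x
  filter_upwards [t.open_baseSet.mem_nhds hx] with y hy e
  refine ⟨e.map ((t.linearEquivAt (R := ℝ) x hx).trans (t.linearEquivAt (R := ℝ) y hy).symm),
    fun i => ?_⟩
  rw [ext_eq]
  change _ = t.symm y (t.continuousLinearMapAt ℝ x (e i))
  simp [Bundle.Trivialization.linearMapAt_apply, hx]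

end

/-! ### Locality and differentiation rules of a connection. -/

section
variable {n : ℕ} {N : Type*} [TopologicalSpace N] [T2Space N]
  [ChartedSpace (EuclideanSpace ℝ (Fin (n + 1))) N] [IsManifold (𝓡 (n + 1)) ∞ N]

/-- Multiplication by a bump function. The smoothness of a connection is formulated for globally
smooth fields, and this reduces local statements such as `AffineConnection.smoothAt_cov` to it. -/
theorem SmoothNear.exists_global {V : ∀ y : N, Tan n y} {x : N} (hV : SmoothNear V x) :
    ∃ W : ∀ y : N, Tan n y, (∀ y, SmoothAt W y) ∧ ∀ᶠ y in 𝓝 x, V y = W y := by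
  obtain ⟨u, hu, hxu⟩ := eventually_nhds_iff.1 hV
  obtain ⟨f, -, hf⟩ := (SmoothBumpFunction.nhds_basis_tsupport (I := 𝓡 (n + 1)) x).mem_iff.1
    (hxu.1.mem_nhds hxu.2)
  refine ⟨fun y => f y • V y, ?_, ?_⟩
  · have := ContMDiffOn.smul_section_of_tsupport (ψ := f) (s := V) (n := ∞) (F := EuclideanSpace ℝ (Fin (n + 1)))
      (f.contMDiff.contMDiffOn) hxu.1 hf (fun y hy => (hu y hy).contMDiffWithinAt)
    exact fun y => this y
  · filter_upwards [f.eventuallyEq_one] with y hy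
    simp [hy]

omit [T2Space N] in
theorem AffineConnection.cov_congr (c : AffineConnection n N) {V W : ∀ y : N, Tan n y} {x : N}
    (hV : SmoothAt V x) (h : ∀ᶠ y in 𝓝 x, V y = W y) : c.cov V x = c.cov W x :=
  c.cov.isCovariantDerivativeOn.congr_of_eventuallyEq (s := univ) hV.mdiff
    (hV.congr (h.mono fun _ hy => hy.symm)).mdiff Filter.univ_mem h

theorem AffineConnection.smoothAt_cov (c : AffineConnection n N) {U V : ∀ y : N, Tan n y} {x : N}
    (hU : SmoothAt U x) (hV : SmoothNear V x) : SmoothAt (fun y => c.cov V y (U y)) x := by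
  obtain ⟨W, hW, hVW⟩ := hV.exists_global
  have h1 := c.smooth.contMDiff.contMDiff (σ := W) (fun y _ => (hW y).contMDiffWithinAt)
  have h2 := h1.contMDiffAt (Filter.univ_mem (f := 𝓝 x))
  have h3 : SmoothAt (fun y => c.cov W y (U y)) x :=
    ContMDiffAt.clm_bundle_apply (F₁ := EuclideanSpace ℝ (Fin (n + 1)))
      (F₂ := EuclideanSpace ℝ (Fin (n + 1))) (b := fun y => y) h2 hU
  refine h3.congr ?_
  filter_upwards [hV, eventually_eventually_nhds.2 hVW] with y hy hy'
  rw [c.cov_congr hy hy']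

theorem AffineConnection.smoothNear_cov (c : AffineConnection n N) {U V : ∀ y : N, Tan n y} {x : N}
    (hU : SmoothNear U x) (hV : SmoothNear V x) : SmoothNear (fun y => c.cov V y (U y)) x := by
  filter_upwards [hU, hV.eventually] with y h1 h2 using c.smoothAt_cov h1 h2

omit [T2Space N] in
theorem AffineConnection.cov_add (c : AffineConnection n N) {V W : ∀ y : N, Tan n y} {x : N}
    (hV : SmoothAt V x) (hW : SmoothAt W x) : c.cov (V + W) x = c.cov V x + c.cov W x :=
  c.cov.isCovariantDerivativeOn.add hV.mdiff hW.mdiff (mem_univ x)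

omit [T2Space N] in
theorem AffineConnection.cov_smul (c : AffineConnection n N) {g : N → ℝ} {V : ∀ y : N, Tan n y}
    {x : N} (hg : MDifferentiableAt (𝓡 (n + 1)) 𝓘(ℝ, ℝ) g x) (hV : SmoothAt V x) (u : Tan n x) :
    c.cov (g • V) x u = g x • c.cov V x u + diff (n := n) g x u • V x := by
  have := c.cov.isCovariantDerivativeOn.leibniz hV.mdiff hg (mem_univ x)
  rw [this]
  rfl

omit [T2Space N] in
theorem AffineConnection.cov_sub_cov (c : AffineConnection n N) {U V : ∀ y : N, Tan n y}
    {x : N} (hU : SmoothAt U x) (hV : SmoothAt V x) :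
    c.cov V x (U x) - c.cov U x (V x) = VectorField.mlieBracket (𝓡 (n + 1)) U V x :=
  c.cov.torsion_eq_zero_iff.1 c.torsion_free hU.mdiff hV.mdiff

end

/-! ### Coordinate frames and the tensoriality principle. -/

section
variable {n : ℕ} {N : Type*} [TopologicalSpace N]
  [ChartedSpace (EuclideanSpace ℝ (Fin (n + 1))) N] [IsManifold (𝓡 (n + 1)) ∞ N]

/-- The domain of the preferred chart at `x₀`, on which the coordinate frame is defined. -/
def frameDomain (n : ℕ) {N : Type*} [TopologicalSpace N]
    [ChartedSpace (EuclideanSpace ℝ (Fin (n + 1))) N] [IsManifold (𝓡 (n + 1)) ∞ N]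
    (x₀ : N) : Set N :=
  (trivializationAt (EuclideanSpace ℝ (Fin (n + 1)))
    (fun z : N => TangentSpace (𝓡 (n + 1)) z) x₀).baseSet

/-- The coordinate vector fields of the preferred chart at `x₀`. -/
noncomputable def locFrame (x₀ : N) (i : Fin (n + 1)) (y : N) : Tan n y :=
  (trivializationAt (EuclideanSpace ℝ (Fin (n + 1)))
    (fun z : N => TangentSpace (𝓡 (n + 1)) z) x₀).localFrame
    (EuclideanSpace.basisFun (Fin (n + 1)) ℝ).toBasis i y

/-- The coordinate frame of the preferred chart at `x₀`. -/
noncomputable def locBasis (x₀ : N) {y : N} (hy : y ∈ frameDomain n x₀) : Frame n y :=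
  (trivializationAt (EuclideanSpace ℝ (Fin (n + 1)))
    (fun z : N => TangentSpace (𝓡 (n + 1)) z) x₀).basisAt
    (EuclideanSpace.basisFun (Fin (n + 1)) ℝ).toBasis hy

theorem isOpen_frameDomain (x₀ : N) : IsOpen (frameDomain n x₀) := Bundle.Trivialization.open_baseSet _

theorem mem_frameDomain (x₀ : N) : x₀ ∈ frameDomain n x₀ :=
  FiberBundle.mem_baseSet_trivializationAt' x₀

theorem locBasis_apply {x₀ y : N} (hy : y ∈ frameDomain n x₀) (i : Fin (n + 1)) :
    locBasis x₀ hy i = locFrame x₀ i y :=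
  (Bundle.Trivialization.localFrame_apply_of_mem_baseSet _ _ hy).symm

theorem smoothAt_locFrame {x₀ y : N} (hy : y ∈ frameDomain n x₀) (i : Fin (n + 1)) :
    SmoothAt (locFrame x₀ i) y :=
  contMDiffAt_localFrame_of_mem ∞ _ _ i hy

theorem smoothNear_locFrame {x₀ y : N} (hy : y ∈ frameDomain n x₀) (i : Fin (n + 1)) :
    SmoothNear (locFrame x₀ i) y := by
  filter_upwards [(isOpen_frameDomain x₀).mem_nhds hy] with z hz using smoothAt_locFrame hz i

/-- The components of a smooth vector field with respect to a coordinate frame are smooth. -/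
theorem exists_coeff {x₀ y : N} (hy : y ∈ frameDomain n x₀) {V : ∀ y : N, Tan n y}
    (hV : SmoothAt V y) (i : Fin (n + 1)) : ∃ a : N → ℝ,
    ContMDiffAt (𝓡 (n + 1)) 𝓘(ℝ, ℝ) ∞ a y ∧
      ∀ z, ∀ hz : z ∈ frameDomain n x₀, a z = (locBasis x₀ hz).repr (V z) i := by
  set t := trivializationAt (EuclideanSpace ℝ (Fin (n + 1)))
    (fun z : N => TangentSpace (𝓡 (n + 1)) z) x₀
  refine ⟨fun z => t.localFrameCoeff (𝓡 (n + 1))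
    (EuclideanSpace.basisFun (Fin (n + 1)) ℝ).toBasis i z (V z), ?_, fun z hz => ?_⟩
  · exact contMDiffAt_localFrameCoeff
      (EuclideanSpace.basisFun (Fin (n + 1)) ℝ).toBasis hy hV i
  · exact Bundle.Trivialization.localFrameCoeff_apply_of_mem_baseSet t _ hz V i

theorem smoothNear_sum {x : N} {ι : Type*} (s : Finset ι) {V : ι → ∀ y : N, Tan n y}
    (hV : ∀ i ∈ s, SmoothNear (V i) x) : SmoothNear (∑ i ∈ s, V i) x := by
  have : ∀ᶠ y in 𝓝 x, ∀ i ∈ s, SmoothAt (V i) y := by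
    rw [Filter.eventually_all_finset]
    exact hV
  filter_upwards [this] with y hy
  have := ContMDiffAt.sum_section (n := ∞) (F := EuclideanSpace ℝ (Fin (n + 1))) hy
  refine SmoothAt.congr this (Filter.Eventually.of_forall fun z => by simp)

/-- An operation on vector fields smooth near `x` which is linear over smooth functions depends
only on the value at `x`. -/
theorem pointwise_of_smooth_linear {A : Type*} [AddCommGroup A] [Module ℝ A] {x : N}
    (Φ : (∀ y : N, Tan n y) → A)
    (hadd : ∀ V W, SmoothNear V x → SmoothNear W x → Φ (V + W) = Φ V + Φ W)
    (hsmul : ∀ (g : N → ℝ) V, (∀ᶠ y in 𝓝 x, ContMDiffAt (𝓡 (n + 1)) 𝓘(ℝ, ℝ) ∞ g y) →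
      SmoothNear V x → Φ (g • V) = g x • Φ V)
    {V W : ∀ y : N, Tan n y} (hV : SmoothNear V x) (hW : SmoothNear W x) (h : V x = W x) :
    Φ V = Φ W := by
  classical
  have hloc : ∀ V W : ∀ y : N, Tan n y, SmoothNear V x → SmoothNear W x →
      (∀ᶠ y in 𝓝 x, V y = W y) → Φ V = Φ W := by
    intro V W hV hW hVW
    let ψ (y : N) : ℝ := if V y = W y then 1 else 0
    have hψx : ψ x = 1 := by simp [ψ, hVW.self_of_nhds]
    have he : ψ • V = ψ • W := by
      funext y
      by_cases hy : V y = W y <;> simp [ψ, hy]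
    have hψ : ∀ᶠ y in 𝓝 x, ContMDiffAt (𝓡 (n + 1)) 𝓘(ℝ, ℝ) ∞ ψ y := by
      filter_upwards [eventually_eventually_nhds.2 hVW] with y hy
      refine (contMDiffAt_const (c := (1 : ℝ))).congr_of_eventuallyEq ?_
      filter_upwards [hy] with z hz
      simp [ψ, hz]
    calc Φ V = Φ (ψ • V) := by rw [hsmul ψ V hψ hV, hψx, one_smul]
      _ = Φ (ψ • W) := by rw [he]
      _ = Φ W := by rw [hsmul ψ W hψ hW, hψx, one_smul]
  have hzero : Φ 0 = 0 := by
    have h0 : SmoothNear (0 : ∀ y : N, Tan n y) x := by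
      have := smoothNear_sum (n := n) (x := x) (∅ : Finset ℕ) (V := fun _ _ => 0) (by simp)
      simpa using this
    have := hadd 0 0 h0 h0
    simpa using this
  have hsum : ∀ (s : Finset (Fin (n + 1))) (V : Fin (n + 1) → ∀ y : N, Tan n y),
      (∀ i, SmoothNear (V i) x) → Φ (∑ i ∈ s, V i) = ∑ i ∈ s, Φ (V i) := by
    intro s V hV
    induction s using Finset.induction_on with
    | empty => simpa using hzero
    | insert a s ha ih =>
      rw [Finset.sum_insert ha, Finset.sum_insert ha, ← ih,
        hadd _ _ (hV a) (smoothNear_sum s fun i _ => hV i)]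
  have hx := mem_frameDomain (n := n) x
  set t := trivializationAt (EuclideanSpace ℝ (Fin (n + 1)))
    (fun z : N => TangentSpace (𝓡 (n + 1)) z) x
  set a : (∀ y : N, Tan n y) → Fin (n + 1) → N → ℝ := fun V i z => t.localFrameCoeff (𝓡 (n + 1))
    (EuclideanSpace.basisFun (Fin (n + 1)) ℝ).toBasis i z (V z) with ha
  have key : ∀ V : ∀ y : N, Tan n y, SmoothNear V x →
      Φ V = ∑ i, a V i x • Φ (locFrame x i) := by
    intro V hV
    have hs : ∀ i, ∀ᶠ y in 𝓝 x, ContMDiffAt (𝓡 (n + 1)) 𝓘(ℝ, ℝ) ∞ (a V i) y := by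
      intro i
      filter_upwards [hV, (isOpen_frameDomain x).mem_nhds hx] with y hy hy'
      exact contMDiffAt_localFrameCoeff
        (EuclideanSpace.basisFun (Fin (n + 1)) ℝ).toBasis hy' hy i
    have hsm : ∀ i, SmoothNear (a V i • locFrame x i) x := by
      intro i
      filter_upwards [hs i, smoothNear_locFrame hx i] with y hy hy' using hy'.smul hy
    rw [hloc V (∑ i, a V i • locFrame x i) hV (smoothNear_sum _ fun i _ => hsm i),
      hsum _ _ hsm]
    · exact Finset.sum_congr rfl fun i _ => hsmul _ _ (hs i) (smoothNear_locFrame hx i)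
    · filter_upwards [(isOpen_frameDomain x).mem_nhds hx] with y hy
      have := Bundle.Trivialization.eq_sum_localFrameCoeff_smul (I := 𝓡 (n + 1))
        (b := (EuclideanSpace.basisFun (Fin (n + 1)) ℝ).toBasis) (s := V) hy
      rw [Finset.sum_apply]
      exact this
  rw [key V hV, key W hW]
  simp only [ha, h]

end

/-! ### Differential and Hessian of functions; tensoriality of the curvature. -/

section
variable {n : ℕ} {N : Type*} [TopologicalSpace N]
  [ChartedSpace (EuclideanSpace ℝ (Fin (n + 1))) N] [IsManifold (𝓡 (n + 1)) ∞ N]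

theorem diff_add {f g : N → ℝ} {x : N} (hf : MDifferentiableAt (𝓡 (n + 1)) 𝓘(ℝ, ℝ) f x)
    (hg : MDifferentiableAt (𝓡 (n + 1)) 𝓘(ℝ, ℝ) g x) (u : Tan n x) :
    diff (n := n) (fun y => f y + g y) x u = diff (n := n) f x u + diff (n := n) g x u := by
  have := mvfderiv_add hf hg
  exact congrArg (fun L => L u) this

theorem diff_sub {f g : N → ℝ} {x : N} (hf : MDifferentiableAt (𝓡 (n + 1)) 𝓘(ℝ, ℝ) f x)
    (hg : MDifferentiableAt (𝓡 (n + 1)) 𝓘(ℝ, ℝ) g x) (u : Tan n x) :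
    diff (n := n) (fun y => f y - g y) x u = diff (n := n) f x u - diff (n := n) g x u := by
  have := mvfderiv_sub hf hg
  exact congrArg (fun L => L u) this

theorem diff_mul {f g : N → ℝ} {x : N} (hf : MDifferentiableAt (𝓡 (n + 1)) 𝓘(ℝ, ℝ) f x)
    (hg : MDifferentiableAt (𝓡 (n + 1)) 𝓘(ℝ, ℝ) g x) (u : Tan n x) :
    diff (n := n) (fun y => f y * g y) x u =
      f x * diff (n := n) g x u + g x * diff (n := n) f x u := by
  have := mvfderiv_mul hf hg
  exact congrArg (fun L => L u) this

theorem diff_const (a : ℝ) (x : N) (u : Tan n x) : diff (n := n) (fun _ : N => a) x u = 0 := by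
  have := mvfderiv_const (I := 𝓡 (n + 1)) a (x := x)
  exact congrArg (fun L => L u) this

theorem diff_congr {f g : N → ℝ} {x : N} (h : ∀ᶠ y in 𝓝 x, f y = g y) (u : Tan n x) :
    diff (n := n) f x u = diff (n := n) g x u := by
  have h' : f =ᶠ[𝓝 x] g := h
  simp only [diff, mvfderiv, h'.mfderiv_eq, ContinuousLinearMap.comp_apply]
  rfl

theorem diff_comp {f : N → ℝ} {x : N} {h : ℝ → ℝ} (hh : DifferentiableAt ℝ h (f x))
    (hf : MDifferentiableAt (𝓡 (n + 1)) 𝓘(ℝ, ℝ) f x) (u : Tan n x) :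
    diff (n := n) (fun y => h (f y)) x u = deriv h (f x) * diff (n := n) f x u := by
  have := mfderiv_comp x (I' := 𝓘(ℝ, ℝ)) hh.mdifferentiableAt hf
  simp only [diff, mvfderiv, ContinuousLinearMap.comp_apply]
  have h2 : mfderiv (𝓡 (n + 1)) 𝓘(ℝ, ℝ) (fun y => h (f y)) x u =
    mfderiv 𝓘(ℝ, ℝ) 𝓘(ℝ, ℝ) h (f x) (mfderiv (𝓡 (n + 1)) 𝓘(ℝ, ℝ) f x u) :=
    congrArg (fun L => L u) this
  rw [mfderiv_eq_fderiv] at h2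
  change (mfderiv (𝓡 (n + 1)) 𝓘(ℝ, ℝ) (fun y => h (f y)) x u : ℝ) = _
  refine h2.trans ?_
  rw [mul_comm]
  exact (fderiv_eq_smul_deriv (𝕜 := ℝ) (f := h) (x := f x) _)

/-- The Hessian `∇_u ∇_v f`. -/
noncomputable def AffineConnection.hess (c : AffineConnection n N) (f : N → ℝ) (x : N)
    (u v : Tan n x) : ℝ :=
  c.covOneForm (diff (n := n) f) x u v

variable {c : AffineConnection n N} {f g : N → ℝ} {x : N}

theorem contMDiffAt_mdiff (h : ContMDiffAt (𝓡 (n + 1)) 𝓘(ℝ, ℝ) ∞ f x) :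
    MDifferentiableAt (𝓡 (n + 1)) 𝓘(ℝ, ℝ) f x := h.mdifferentiableAt (by simp)

theorem contMDiff_mdiff (h : ContMDiff (𝓡 (n + 1)) 𝓘(ℝ, ℝ) ∞ f) (x : N) :
    MDifferentiableAt (𝓡 (n + 1)) 𝓘(ℝ, ℝ) f x := h.mdifferentiableAt (by simp)

/-- The Leibniz terms `dg(u) df(V)` of the two summands cancel, so the expression is linear over
functions and `ext (V x)` may be replaced by any smooth extension. -/
theorem hess_eq (hf : ContMDiff (𝓡 (n + 1)) 𝓘(ℝ, ℝ) ∞ f) {V : ∀ y : N, Tan n y}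
    (hV : SmoothNear V x) (u : Tan n x) :
    c.hess f x u (V x) = diff (n := n) (fun y => diff (n := n) f y (V y)) x u
      - diff (n := n) f x (c.cov V x u) := by
  rw [AffineConnection.hess, AffineConnection.covOneForm]
  refine pointwise_of_smooth_linear (x := x) (V := ext (V x)) (W := V)
    (fun V => diff (n := n) (fun y => diff (n := n) f y (V y)) x u
      - diff (n := n) f x (c.cov V x u)) ?_ ?_ (ext_smoothNear _) hV (ext_self _)
  · intro V W hV hW
    have h1 : ∀ y, diff (n := n) f y ((V + W) y) =
        diff (n := n) f y (V y) + diff (n := n) f y (W y) := fun y => by simp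
    simp only [h1]
    rw [diff_add (contMDiffAt_mdiff (contMDiffAt_diff (hf x) hV.smoothAt))
      (contMDiffAt_mdiff (contMDiffAt_diff (hf x) hW.smoothAt)),
      c.cov_add hV.smoothAt hW.smoothAt]
    simp only [add_apply, map_add]
    ring
  · intro g V hg hV
    have h1 : ∀ y, diff (n := n) f y ((g • V) y) = g y * diff (n := n) f y (V y) :=
      fun y => by simp
    have hg' := contMDiffAt_mdiff hg.self_of_nhds
    simp only [h1]
    rw [diff_mul hg' (contMDiffAt_mdiff (contMDiffAt_diff (hf x) hV.smoothAt)),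
      c.cov_smul hg' hV.smoothAt]
    simp only [map_add, map_smul, smul_eq_mul]
    ring

theorem hess_add (hf : ContMDiff (𝓡 (n + 1)) 𝓘(ℝ, ℝ) ∞ f)
    (hg : ContMDiff (𝓡 (n + 1)) 𝓘(ℝ, ℝ) ∞ g) (u v : Tan n x) :
    c.hess (fun y => f y + g y) x u v = c.hess f x u v + c.hess g x u v := by
  simp only [AffineConnection.hess, AffineConnection.covOneForm]
  have h1 : ∀ y, diff (n := n) (fun y => f y + g y) y (ext v y) =
      diff (n := n) f y (ext v y) + diff (n := n) g y (ext v y) := fun y =>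
    diff_add (contMDiff_mdiff hf y) (contMDiff_mdiff hg y) _
  have hv := (ext_smoothNear v).smoothAt
  simp only [h1]
  rw [diff_add (contMDiffAt_mdiff (contMDiffAt_diff (hf x) hv))
      (contMDiffAt_mdiff (contMDiffAt_diff (hg x) hv)),
    diff_add (contMDiff_mdiff hf x) (contMDiff_mdiff hg x)]
  ring

theorem hess_mul (hf : ContMDiff (𝓡 (n + 1)) 𝓘(ℝ, ℝ) ∞ f)
    (hg : ContMDiff (𝓡 (n + 1)) 𝓘(ℝ, ℝ) ∞ g) (u v : Tan n x) :
    c.hess (fun y => f y * g y) x u v = f x * c.hess g x u v + g x * c.hess f x u v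
      + diff (n := n) f x u * diff (n := n) g x v + diff (n := n) g x u * diff (n := n) f x v := by
  simp only [AffineConnection.hess, AffineConnection.covOneForm]
  have h1 : ∀ y, diff (n := n) (fun y => f y * g y) y (ext v y) =
      f y * diff (n := n) g y (ext v y) + g y * diff (n := n) f y (ext v y) := fun y =>
    diff_mul (contMDiff_mdiff hf y) (contMDiff_mdiff hg y) _
  have hv := (ext_smoothNear v).smoothAt
  have h2 := contMDiffAt_mdiff (contMDiffAt_diff (hf x) hv)
  have h3 := contMDiffAt_mdiff (contMDiffAt_diff (hg x) hv)
  have hf' := contMDiff_mdiff hf x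
  have hg' := contMDiff_mdiff hg x
  simp only [h1]
  rw [diff_add (f := fun y => f y * diff (n := n) g y (ext v y))
    (g := fun y => g y * diff (n := n) f y (ext v y)) (hf'.mul h3) (hg'.mul h2), diff_mul hf' h3, diff_mul hg' h2, diff_mul hf' hg']
  simp only [ext_self]
  ring

/-- The definition involves `ext (v + w)`, which `hess_eq` allows one to replace by the extension
`ext v + ext w`. -/
theorem hess_add_right (hf : ContMDiff (𝓡 (n + 1)) 𝓘(ℝ, ℝ) ∞ f) (u v w : Tan n x) :
    c.hess f x u (v + w) = c.hess f x u v + c.hess f x u w := by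
  have hv := ext_smoothNear v
  have hw := ext_smoothNear w
  have hvw : SmoothNear (ext v + ext w : ∀ y : N, Tan n y) x := by
    filter_upwards [hv, hw] with y h1 h2 using h1.add h2
  have := hess_eq (c := c) hf hvw u
  rw [Pi.add_apply, ext_self, ext_self] at this
  rw [this, c.cov_add hv.smoothAt hw.smoothAt]
  have h1 : ∀ y, diff (n := n) f y ((ext v + ext w : ∀ y : N, Tan n y) y) =
    diff (n := n) f y (ext v y) + diff (n := n) f y (ext w y) := fun y => by simp
  simp only [h1]
  rw [diff_add (contMDiffAt_mdiff (contMDiffAt_diff (hf x) hv.smoothAt))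
      (contMDiffAt_mdiff (contMDiffAt_diff (hf x) hw.smoothAt))]
  simp only [AffineConnection.hess, AffineConnection.covOneForm, add_apply,
    map_add]
  ring

theorem hess_smul_right (hf : ContMDiff (𝓡 (n + 1)) 𝓘(ℝ, ℝ) ∞ f) (a : ℝ) (u v : Tan n x) :
    c.hess f x u (a • v) = a * c.hess f x u v := by
  have hv := ext_smoothNear v
  have hav : SmoothNear ((fun _ => a : N → ℝ) • ext v : ∀ y : N, Tan n y) x := by
    filter_upwards [hv] with y h1 using h1.smul contMDiffAt_const
  have := hess_eq (c := c) hf hav u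
  rw [Pi.smul_apply', ext_self] at this
  rw [this, c.cov_smul mdifferentiableAt_const hv.smoothAt]
  have h1 : ∀ y, diff (n := n) f y (((fun _ => a : N → ℝ) • ext v : ∀ y : N, Tan n y) y) =
    a * diff (n := n) f y (ext v y) := fun y => by simp
  simp only [h1]
  rw [diff_mul mdifferentiableAt_const
    (contMDiffAt_mdiff (contMDiffAt_diff (hf x) hv.smoothAt)), diff_const]
  simp only [AffineConnection.hess, AffineConnection.covOneForm, zero_smul, add_zero, map_smul,
    smul_eq_mul]
  ring

theorem hess_add_left (u v w : Tan n x) :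
    c.hess f x (u + v) w = c.hess f x u w + c.hess f x v w := by
  simp only [AffineConnection.hess, AffineConnection.covOneForm, map_add]
  ring

theorem hess_smul_left (a : ℝ) (u v : Tan n x) :
    c.hess f x (a • u) v = a * c.hess f x u v := by
  simp only [AffineConnection.hess, AffineConnection.covOneForm, map_smul, smul_eq_mul]
  ring

theorem hess_smooth [T2Space N] (hf : ContMDiff (𝓡 (n + 1)) 𝓘(ℝ, ℝ) ∞ f)
    {U V : ∀ y : N, Tan n y} (hU : SmoothAt U x) (hV : SmoothNear V x) :
    ContMDiffAt (𝓡 (n + 1)) 𝓘(ℝ, ℝ) ∞ (fun y => c.hess f y (U y) (V y)) x := by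
  have hd : ContMDiffAt (𝓡 (n + 1)) 𝓘(ℝ, ℝ) ∞ (fun y => diff (n := n) f y (V y)) x :=
    contMDiffAt_diff (hf x) hV.smoothAt
  have := (contMDiffAt_diff hd hU).sub (contMDiffAt_diff (hf x) (c.smoothAt_cov hU hV))
  refine this.congr_of_eventuallyEq ?_
  filter_upwards [hV.eventually] with y hy
  exact hess_eq hf hy _

/-! ### Curvature -/

theorem curvature_swap (X Y Z : ∀ y : N, Tan n y) :
    c.curvature X Y Z x = -c.curvature Y X Z x := by
  simp only [AffineConnection.curvature]
  rw [VectorField.mlieBracket_swap_apply, map_neg]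
  abel

theorem curvature_add_left [T2Space N] {X X' Y Z : ∀ y : N, Tan n y} (hX : SmoothNear X x)
    (hX' : SmoothNear X' x) (hZ : SmoothNear Z x) :
    c.curvature (X + X') Y Z x = c.curvature X Y Z x + c.curvature X' Y Z x := by
  simp only [AffineConnection.curvature]
  have h1 : (fun y => c.cov Z y ((X + X') y)) =
      (fun y => c.cov Z y (X y)) + fun y => c.cov Z y (X' y) := by
    funext y; simp
  rw [h1, c.cov_add (c.smoothAt_cov hX.smoothAt hZ) (c.smoothAt_cov hX'.smoothAt hZ),
    VectorField.mlieBracket_add_left hX.mdiff hX'.mdiff]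
  simp only [Pi.add_apply, map_add, add_apply]
  abel

theorem curvature_smul_left [T2Space N] {X Y Z : ∀ y : N, Tan n y} {g : N → ℝ}
    (hg : ContMDiffAt (𝓡 (n + 1)) 𝓘(ℝ, ℝ) ∞ g x) (hX : SmoothNear X x) (hZ : SmoothNear Z x) :
    c.curvature (g • X) Y Z x = g x • c.curvature X Y Z x := by
  simp only [AffineConnection.curvature]
  have h1 : (fun y => c.cov Z y ((g • X) y)) = g • (fun y => c.cov Z y (X y)) := by
    funext y; simp
  rw [h1, c.cov_smul (contMDiffAt_mdiff hg) (c.smoothAt_cov hX.smoothAt hZ),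
    VectorField.mlieBracket_smul_left (contMDiffAt_mdiff hg) hX.mdiff]
  simp only [Pi.smul_apply', map_add, map_smul]
  change _ - (g x • _ + diff (n := n) g x (Y x) • _)
    - (-(diff (n := n) g x (Y x)) • _ + _) = _
  module

theorem curvature_add_right [T2Space N] {X Y Z Z' : ∀ y : N, Tan n y} (hX : SmoothNear X x)
    (hY : SmoothNear Y x) (hZ : SmoothNear Z x) (hZ' : SmoothNear Z' x) :
    c.curvature X Y (Z + Z') x = c.curvature X Y Z x + c.curvature X Y Z' x := by
  have h : ∀ W : ∀ y : N, Tan n y, SmoothNear W x →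
      c.cov (fun y => c.cov (Z + Z') y (W y)) x =
        c.cov (fun y => c.cov Z y (W y)) x + c.cov (fun y => c.cov Z' y (W y)) x := by
    intro W hW
    rw [← c.cov_add (c.smoothAt_cov hW.smoothAt hZ) (c.smoothAt_cov hW.smoothAt hZ')]
    refine c.cov_congr (c.smoothAt_cov hW.smoothAt ?_) ?_
    · filter_upwards [hZ, hZ'] with y h1 h2 using h1.add h2
    · filter_upwards [hZ, hZ'] with y h1 h2
      rw [c.cov_add h1 h2]
      rfl
  simp only [AffineConnection.curvature]
  rw [h Y hY, h X hX, c.cov_add hZ.smoothAt hZ'.smoothAt]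
  simp only [add_apply]
  abel

/-- The first-order terms in `g` are symmetric in `X` and `Y`; the second derivatives of `g`
antisymmetrise to `dg([X, Y])`, which the bracket term of the curvature removes. -/
theorem curvature_smul_right [T2Space N] {X Y Z : ∀ y : N, Tan n y} {g : N → ℝ}
    (hg : ∀ᶠ y in 𝓝 x, ContMDiffAt (𝓡 (n + 1)) 𝓘(ℝ, ℝ) ∞ g y) (hX : SmoothNear X x)
    (hY : SmoothNear Y x) (hZ : SmoothNear Z x) :
    c.curvature X Y (g • Z) x = g x • c.curvature X Y Z x := by
  have hgx := hg.self_of_nhds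
  have hgm := contMDiffAt_mdiff hgx
  have h : ∀ W : ∀ y : N, Tan n y, SmoothNear W x → ∀ u : Tan n x,
      c.cov (fun y => c.cov (g • Z) y (W y)) x u =
        g x • c.cov (fun y => c.cov Z y (W y)) x u + diff (n := n) g x u • c.cov Z x (W x)
        + (diff (n := n) g x (W x) • c.cov Z x u
        + diff (n := n) (fun y => diff (n := n) g y (W y)) x u • Z x) := by
    intro W hW u
    have hd : ContMDiffAt (𝓡 (n + 1)) 𝓘(ℝ, ℝ) ∞ (fun y => diff (n := n) g y (W y)) x :=
      contMDiffAt_diff hgx hW.smoothAt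
    have hZW := c.smoothAt_cov hW.smoothAt hZ
    rw [← c.cov_smul hgm hZW, ← c.cov_smul (contMDiffAt_mdiff hd) hZ.smoothAt,
      ← add_apply, ← c.cov_add (hZW.smul hgx) (hZ.smoothAt.smul hd)]
    congr 1
    refine c.cov_congr (c.smoothAt_cov hW.smoothAt ?_) ?_
    · filter_upwards [hg, hZ] with y h1 h2 using h2.smul h1
    · filter_upwards [hg, hZ] with y h1 h2
      rw [c.cov_smul (contMDiffAt_mdiff h1) h2]
      rfl
  simp only [AffineConnection.curvature]
  rw [h Y hY, h X hX, c.cov_smul hgm hZ.smoothAt,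
    diff_mlieBracket hgx hX.smoothAt hY.smoothAt]
  module

/-- The curvature depends only on the values of the vector fields at the point. -/
theorem curvature_eq [T2Space N] {X Y Z : ∀ y : N, Tan n y} (hX : SmoothNear X x)
    (hY : SmoothNear Y x) (hZ : SmoothNear Z x) :
    c.curvature X Y Z x = c.curvature (ext (X x)) (ext (Y x)) (ext (Z x)) x := by
  have h1 : ∀ {X Y Z : ∀ y : N, Tan n y}, SmoothNear X x → SmoothNear Y x → SmoothNear Z x →
      c.curvature X Y Z x = c.curvature (ext (X x)) Y Z x := fun {X Y Z} hX hY hZ =>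
    pointwise_of_smooth_linear (x := x) (fun X => c.curvature X Y Z x)
      (fun V W hV hW => curvature_add_left hV hW hZ)
      (fun g V hg hV => curvature_smul_left hg.self_of_nhds hV hZ) hX (ext_smoothNear _)
      (ext_self _).symm
  have h2 : c.curvature X Y Z x = c.curvature X Y (ext (Z x)) x :=
    pointwise_of_smooth_linear (x := x) (fun Z => c.curvature X Y Z x)
      (fun V W hV hW => curvature_add_right hX hY hV hW)
      (fun g V hg hV => curvature_smul_right hg hX hY hV) hZ (ext_smoothNear _)
      (ext_self _).symm
  -- The middle slot is handled as a first slot after exchanging the two.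
  rw [h2, h1 hX hY (ext_smoothNear _), curvature_swap,
    h1 hY (ext_smoothNear _) (ext_smoothNear _), ← curvature_swap]

/-- The sum is the trace of `u ↦ R(u, v) w`. This freedom matters for smoothness: `stdFrame n y`
uses the preferred chart of each `y`, which need not depend smoothly on `y`. -/
theorem ricci_eq [T2Space N] (b : Frame n x) (v w : Tan n x) :
    c.ricci x v w = ∑ i, b.repr (c.curvature (ext (b i)) (ext v) (ext w) x) i := by
  let L : Tan n x →ₗ[ℝ] Tan n x :=
    { toFun := fun u => c.curvature (ext u) (ext v) (ext w) x
      map_add' := fun u u' => by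
        have hs : SmoothNear (ext u + ext u' : ∀ y : N, Tan n y) x := by
          filter_upwards [ext_smoothNear u, ext_smoothNear u'] with y h1 h2 using h1.add h2
        have := curvature_eq (c := c) hs (ext_smoothNear v) (ext_smoothNear w)
        rw [Pi.add_apply, ext_self, ext_self, ext_self, ext_self,
          curvature_add_left (ext_smoothNear u) (ext_smoothNear u') (ext_smoothNear w)] at this
        exact this.symm
      map_smul' := fun a u => by
        have hs : SmoothNear ((fun _ => a : N → ℝ) • ext u : ∀ y : N, Tan n y) x := by
          filter_upwards [ext_smoothNear u] with y h1 using h1.smul contMDiffAt_const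
        have := curvature_eq (c := c) hs (ext_smoothNear v) (ext_smoothNear w)
        rw [Pi.smul_apply', ext_self, ext_self, ext_self,
          curvature_smul_left contMDiffAt_const (ext_smoothNear u) (ext_smoothNear w)] at this
        exact this.symm }
  have key : ∀ b : Frame n x, ∑ i, b.repr (c.curvature (ext (b i)) (ext v) (ext w) x) i =
      LinearMap.trace ℝ _ L := by
    intro b
    rw [LinearMap.trace_eq_matrix_trace ℝ b]
    simp only [Matrix.trace, Matrix.diag, LinearMap.toMatrix_apply]
    rfl
  rw [key b, ← key (stdFrame n x)]
  rfl

theorem ricci_smooth [T2Space N] {V W : ∀ y : N, Tan n y} (hV : SmoothNear V x)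
    (hW : SmoothNear W x) :
    ContMDiffAt (𝓡 (n + 1)) 𝓘(ℝ, ℝ) ∞ (fun y => c.ricci y (V y) (W y)) x := by
  have hx := mem_frameDomain (n := n) x
  have hR : ∀ i, SmoothAt (fun y => c.curvature (locFrame x i) V W y) x := by
    intro i
    have hE := smoothNear_locFrame hx i
    have : IsManifold (𝓡 (n + 1)) (((⊤ : ℕ∞) : ℕ∞ω) + 1) N :=
      inferInstanceAs (IsManifold (𝓡 (n + 1)) ∞ N)
    have : IsManifold (𝓡 (n + 1)) (minSmoothness ℝ 2) N := by
      rw [minSmoothness_of_isRCLikeNormedField]; infer_instance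
    have hb : SmoothAt (VectorField.mlieBracket (𝓡 (n + 1)) (locFrame x i) V) x :=
      ContMDiffAt.mlieBracket_vectorField (n := ⊤) (m := ⊤) hE.smoothAt hV.smoothAt (by
        rw [minSmoothness_of_isRCLikeNormedField]; exact le_rfl)
    exact ((c.smoothAt_cov hE.smoothAt (c.smoothNear_cov hV hW)).sub
      (c.smoothAt_cov hV.smoothAt (c.smoothNear_cov hE hW))).sub (c.smoothAt_cov hb hW)
  choose a ha ha' using fun i => exists_coeff hx (hR i) i
  have : ContMDiffAt (𝓡 (n + 1)) 𝓘(ℝ, ℝ) ∞ (fun y => ∑ i, a i y) x :=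
    contMDiffAt_finsetSum fun i _ => ha i
  refine this.congr_of_eventuallyEq ?_
  filter_upwards [(isOpen_frameDomain x).mem_nhds hx, hV.eventually, hW.eventually]
    with y hy h1 h2
  rw [ricci_eq (locBasis x hy)]
  refine Finset.sum_congr rfl fun i _ => ?_
  rw [ha' i y hy, curvature_eq (smoothNear_locFrame hy i) h1 h2, locBasis_apply]

end

/-! ### Determinants of perturbed and bordered matrices. -/

section
variable {R : Type*} [CommRing R] {ι : Type*} [Fintype ι] [DecidableEq ι]

/-- With `X` the basis vector at `o`, the perturbed matrix factors as (rank-one change of `1`) `* H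
*` (scalar times a rank-one change of `1`): row and column `o` of `H` are `X` multiplied by `H`. The
unwanted cross terms carry `t * t` or `t * (H o o)` and vanish. The determinant of a rank-one change
of `1` is explicit. -/
theorem det_rank_two_perturbation_of_nilpotent (H : Matrix ι ι R) (o : ι) {f t a β γ : R} (w : ι → R)
    (hH : H o o = 2 * f) (htf : t * f = 0) (htt : t * t = 0) :
    (H + a • Matrix.vecMulVec (fun i => H i o) (H o) + t • (β • H
      + γ • (Matrix.vecMulVec w (H o) + Matrix.vecMulVec (fun i => H i o) w))).det =
    H.det * (1 + 2 * a * f + t * (Fintype.card ι * β + 2 * γ * w o)) := by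
  classical
  set X : ι → R := Pi.single o 1
  have hv : H.mulVec X = fun i => H i o := by
    funext i; simp [X]
  have hv' : Matrix.vecMul X H = H o := by
    funext i; simp [X]
  have e1 : H * Matrix.vecMulVec X (H o) = Matrix.vecMulVec (fun i => H i o) (H o) := by
    rw [Matrix.mul_vecMulVec, hv]
  have e2 : H * Matrix.vecMulVec X w = Matrix.vecMulVec (fun i => H i o) w := by
    rw [Matrix.mul_vecMulVec, hv]
  have e3 : Matrix.vecMulVec w X * H = Matrix.vecMulVec w (H o) := by
    rw [Matrix.vecMulVec_mul, hv']
  have e4 : Matrix.vecMulVec w X * H * Matrix.vecMulVec X (H o) =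
      (2 * f) • Matrix.vecMulVec w (H o) := by
    rw [e3, Matrix.vecMulVec_mul_vecMulVec]
    simp [X, ← hH, Matrix.vecMulVec_smul]
  have key : H + a • Matrix.vecMulVec (fun i => H i o) (H o) + t • (β • H
      + γ • (Matrix.vecMulVec w (H o) + Matrix.vecMulVec (fun i => H i o) w)) =
      (1 + Matrix.vecMulVec ((t * γ) • w) X) * H *
        ((1 + t * β) • (1 + Matrix.vecMulVec X ((a * (1 - t * β)) • H o + (t * γ) • w))) := by
    have h2 : (1 + Matrix.vecMulVec ((t * γ) • w) X) * H *
        ((1 + t * β) • (1 + Matrix.vecMulVec X ((a * (1 - t * β)) • H o + (t * γ) • w))) =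
        (1 + t * β) • (H + (t * γ) • (Matrix.vecMulVec w X * H) +
          ((a * (1 - t * β)) • (H * Matrix.vecMulVec X (H o)) +
            (t * γ) • (H * Matrix.vecMulVec X w)) +
          ((t * γ * (a * (1 - t * β))) • (Matrix.vecMulVec w X * H * Matrix.vecMulVec X (H o)) +
            (t * γ * (t * γ)) • (Matrix.vecMulVec w X * H * Matrix.vecMulVec X w))) := by
      simp only [Matrix.vecMulVec_add, Matrix.smul_vecMulVec, Matrix.vecMulVec_smul,
        Matrix.mul_smul, Matrix.smul_mul, Matrix.mul_add, Matrix.add_mul, Matrix.one_mul,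
        Matrix.mul_one, smul_add, smul_smul]
      module
    rw [h2, e4, e1, e2, e3]
    have z1 : t * γ * (t * γ) = 0 := by linear_combination γ ^ 2 * htt
    rw [z1]
    ext i j
    simp only [Matrix.add_apply, Matrix.smul_apply, smul_eq_mul, zero_mul]
    generalize Matrix.vecMulVec (fun i => H i o) (H o) i j = p
    generalize Matrix.vecMulVec w (H o) i j = q
    generalize Matrix.vecMulVec (fun i => H i o) w i j = r
    linear_combination (a * β ^ 2 * p - β * γ * q - β * γ * r) * htt
      - (2 * γ * a * q * (1 + t * β) * (1 - t * β)) * htf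
  rw [key, Matrix.det_mul, Matrix.det_mul, Matrix.det_smul]
  have d1 : ∀ u w : ι → R, (1 + Matrix.vecMulVec u w).det = 1 + w ⬝ᵥ u := by
    intro u w
    rw [Matrix.vecMulVec_eq Unit, Matrix.det_one_add_replicateCol_mul_replicateRow]
  rw [d1, d1]
  -- The scalar factor contributes its power of exponent `Fintype.card ι`, of which only the linear
  -- part in `t` survives.
  have hp : ∀ k : ℕ, (1 + t * β) ^ k = 1 + k * (t * β) := by
    intro k
    induction k with
    | zero => simp
    | succ k ih => rw [pow_succ, ih]; push_cast; linear_combination (k * β ^ 2) * htt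
  rw [hp]
  have c1 : X ⬝ᵥ ((t * γ) • w) = t * γ * w o := by simp [X]
  have c2 : ((a * (1 - t * β)) • H o + (t * γ) • w) ⬝ᵥ X =
      a * (1 - t * β) * (2 * f) + t * γ * w o := by
    simp [X, hH]
  rw [c1, c2]
  set k : R := (Fintype.card ι : R)
  linear_combination H.det * (-2 * a * β + γ * w o * (2 * a * (1 - t * β))
    + k * β * (2 * a * (1 - t * β))) * htf + H.det * ((γ * w o) ^ 2 + k * β * γ * w o +
    k * β * γ * w o * (1 + 2 * a * f * (1 - t * β) + t * γ * w o)) * htt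

/-- Reduction modulo the ideal `(t f)`. There `t f = 0`, and `t ^ 2 = 0` because `f` divides `t`;
the term with `S` disappears as well. -/
theorem det_rank_two_perturbation (H S : Matrix ι ι R) (o : ι) {f t a β γ : R} (w : ι → R)
    (hH : H o o = 2 * f) (hft : f ∣ t) : ∃ q,
    (H + a • Matrix.vecMulVec (fun i => H i o) (H o) + t • (β • H
      + γ • (Matrix.vecMulVec w (H o) + Matrix.vecMulVec (fun i => H i o) w)) + (t * f) • S).det =
    H.det * (1 + 2 * a * f + t * (Fintype.card ι * β + 2 * γ * w o)) + t * f * q := by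
  obtain ⟨s, rfl⟩ := hft
  set t := f * s
  set I := Ideal.span {t * f}
  let π := Ideal.Quotient.mk I
  have h2 : π 2 = 2 := map_ofNat π 2
  have htf : π t * π f = 0 := by
    rw [← map_mul]; exact Ideal.Quotient.eq_zero_iff_mem.2 (Ideal.mem_span_singleton_self _)
  have key := det_rank_two_perturbation_of_nilpotent (π.mapMatrix H) o (f := π f) (t := π t)
    (a := π a) (β := π β) (γ := π γ) (fun i => π (w i)) (by simp [hH, h2]) htf
    (by
      have : π t * π t = π t * π f * π s := by simp only [← map_mul]; congr 1; simp only [t]; ring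
      rw [this, htf, zero_mul])
  rw [← RingHom.map_det] at key
  suffices h : t * f ∣ (H + a • Matrix.vecMulVec (fun i => H i o) (H o) + t • (β • H
      + γ • (Matrix.vecMulVec w (H o) + Matrix.vecMulVec (fun i => H i o) w)) + (t * f) • S).det -
      H.det * (1 + 2 * a * f + t * (Fintype.card ι * β + 2 * γ * w o)) by
    obtain ⟨q, hq⟩ := h
    exact ⟨q, by rw [← hq]; ring⟩
  rw [← Ideal.mem_span_singleton, ← Ideal.Quotient.eq]
  change π _ = π _
  have e2 : π (H.det * (1 + 2 * a * f + t * (Fintype.card ι * β + 2 * γ * w o))) = π H.det *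
      (1 + 2 * π a * π f + π t * (Fintype.card ι * π β + 2 * π γ * π (w o))) := by
    simp [h2]
  rw [e2, ← key, RingHom.map_det]
  congr 1
  ext i j
  simp [Matrix.vecMulVec_apply, htf]

theorem det_add_smul_perturbation (H S : Matrix ι ι R) (t : R) :
    ∃ q, (H + t • S).det = H.det + t * q := by
  have : t ∣ (H + t • S).det - H.det := by
    rw [← Ideal.mem_span_singleton, ← Ideal.Quotient.eq, RingHom.map_det, RingHom.map_det]
    congr 1
    ext i j
    have : Ideal.Quotient.mk (Ideal.span {t}) t = 0 :=
      Ideal.Quotient.eq_zero_iff_mem.2 (Ideal.mem_span_singleton_self _)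
    simp [this]
  obtain ⟨q, hq⟩ := this
  exact ⟨q, by rw [← hq]; ring⟩

/-- Adding to the rows and columns of a bordered matrix multiples of the border does not change
the determinant. -/
theorem det_bordered_unipotent (a : R) (b c p : ι → R) (d : ι → ι → R) :
    (Matrix.fromBlocks (Matrix.of fun _ _ : Unit => a) (Matrix.of fun _ j => b j + a * p j)
      (Matrix.of fun i _ => c i + a * p i)
      (Matrix.of fun i j => d i j + p i * b j + c i * p j + a * p i * p j)).det =
    (Matrix.fromBlocks (Matrix.of fun _ _ : Unit => a) (Matrix.of fun _ j => b j)
      (Matrix.of fun i _ => c i) (Matrix.of d)).det := by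
  have : Matrix.fromBlocks (Matrix.of fun _ _ : Unit => a) (Matrix.of fun _ j => b j + a * p j)
      (Matrix.of fun i _ => c i + a * p i)
      (Matrix.of fun i j => d i j + p i * b j + c i * p j + a * p i * p j) =
      Matrix.fromBlocks (1 : Matrix Unit Unit R) 0 (Matrix.of fun i _ => p i) 1 *
        Matrix.fromBlocks (Matrix.of fun _ _ : Unit => a) (Matrix.of fun _ j => b j)
          (Matrix.of fun i _ => c i) (Matrix.of d) *
        Matrix.fromBlocks 1 (Matrix.of fun _ j => p j) 0 1 := by
    rw [Matrix.fromBlocks_multiply, Matrix.fromBlocks_multiply]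
    congr 1 <;> ext i j <;> simp [Matrix.mul_apply] <;> ring
  rw [this, Matrix.det_mul, Matrix.det_mul, Matrix.det_fromBlocks_zero₁₂,
    Matrix.det_fromBlocks_zero₂₁]
  simp

end

/-- A bordered symmetric matrix with zero corner has negative determinant if it is positive
definite on the kernel of the border. -/
theorem det_bordered_neg {ι : Type*} [Fintype ι] [DecidableEq ι] (v : ι → ℝ) (Q : Matrix ι ι ℝ)
    (hv : v ≠ 0) (hQ : ∀ u : ι → ℝ, v ⬝ᵥ u = 0 → u ≠ 0 → 0 < u ⬝ᵥ Q.mulVec u) :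
    (Matrix.fromBlocks (0 : Matrix Unit Unit ℝ) (Matrix.of fun _ j => v j)
      (Matrix.of fun i _ => v i) Q).det < 0 := by
  -- The block `Q` is deformed linearly to the identity, where the determinant is `-|v|²`. Every
  -- stage remains positive definite on the kernel of `v`, so a null vector `(a, u)` has `u = 0` and
  -- then `a = 0`; the determinant never vanishes and keeps its sign.
  let M : ℝ → Matrix (Unit ⊕ ι) (Unit ⊕ ι) ℝ := fun s =>
    Matrix.fromBlocks (0 : Matrix Unit Unit ℝ) (Matrix.of fun _ j => v j)
      (Matrix.of fun i _ => v i) ((1 - s) • Q + s • 1)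
  have hM : Continuous fun s => (M s).det := by
    refine Continuous.matrix_det ?_
    refine Continuous.matrix_fromBlocks continuous_const continuous_const continuous_const ?_
    fun_prop
  have h1 : (M 1).det < 0 := by
    simp only [M, sub_self, zero_smul, zero_add, one_smul]
    rw [Matrix.det_fromBlocks_one₂₂, Matrix.det_unique]
    simp only [Matrix.sub_apply, Matrix.zero_apply, zero_sub, Matrix.mul_apply, Matrix.of_apply,
      neg_lt_zero]
    obtain ⟨i, hi⟩ := Function.ne_iff.1 hv
    exact Finset.sum_pos' (fun i _ => mul_self_nonneg _)
      ⟨i, Finset.mem_univ _, mul_self_pos.2 hi⟩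
  have hne : ∀ s ∈ Icc (0 : ℝ) 1, (M s).det ≠ 0 := by
    intro s hs h0
    obtain ⟨z, hz, hMz⟩ := Matrix.exists_mulVec_eq_zero_iff.2 h0
    obtain ⟨a, u, rfl⟩ : ∃ (a : ℝ) (u : ι → ℝ), z = Sum.elim (fun _ => a) u :=
      ⟨z (Sum.inl ()), fun i => z (Sum.inr i), by ext (i | i) <;> rfl⟩
    rw [Matrix.fromBlocks_mulVec] at hMz
    have e1 : v ⬝ᵥ u = 0 := by
      have := congrFun hMz (Sum.inl ())
      simpa [Matrix.mulVec, dotProduct] using this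
    have e2 : ∀ i, v i * a + ((1 - s) * (Q.mulVec u) i + s * u i) = 0 := by
      intro i
      have := congrFun hMz (Sum.inr i)
      simpa [Matrix.mulVec, dotProduct, Matrix.add_mulVec, Matrix.smul_mulVec, add_mul,
        Finset.sum_add_distrib, mul_assoc, Finset.mul_sum, Matrix.one_apply] using this
    have hu : u = 0 := by
      by_contra hu
      have p1 := hQ u e1 hu
      have p2 : 0 < u ⬝ᵥ u := by
        obtain ⟨i, hi⟩ := Function.ne_iff.1 hu
        exact Finset.sum_pos' (fun i _ => mul_self_nonneg _)
          ⟨i, Finset.mem_univ _, mul_self_pos.2 hi⟩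
      have : a * (v ⬝ᵥ u) + ((1 - s) * (u ⬝ᵥ Q.mulVec u) + s * (u ⬝ᵥ u)) = 0 := by
        simp only [dotProduct, Finset.mul_sum, ← Finset.sum_add_distrib]
        refine Finset.sum_eq_zero fun i _ => ?_
        linear_combination u i * e2 i
      rw [e1] at this
      rcases hs.2.lt_or_eq with h | h
      · nlinarith [mul_pos (sub_pos.2 h) p1, mul_nonneg hs.1 p2.le]
      · subst h; linarith
    subst hu
    obtain ⟨i, hi⟩ := Function.ne_iff.1 hv
    have ha : a = 0 := by
      have := e2 i
      simpa [show v i ≠ 0 from hi] using this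
    subst ha
    exact hz (by ext (i | i) <;> rfl)
  have h0 : (M 0).det < 0 := by
    by_contra! h
    obtain ⟨s, hs, hs'⟩ := intermediate_value_Icc' (zero_le_one (α := ℝ)) hM.continuousOn
      (show (0 : ℝ) ∈ Icc _ _ from ⟨h1.le, h⟩)
    exact hne s hs hs'
  simpa [M] using h0

/-! ### Smooth division and Borel summation in a vector space -/

section
open MeasureTheory

variable {E G : Type} [NormedAddCommGroup E] [NormedSpace ℝ E] [FiniteDimensional ℝ E]
  [NormedAddCommGroup G] [NormedSpace ℝ G]

theorem hasFDerivAt_intervalIntegral_of_contDiff {F : E × ℝ → G} (hF : ContDiff ℝ ∞ F) (x₀ : E) :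
    HasFDerivAt (fun x => ∫ s in (0 : ℝ)..1, F (x, s))
      (∫ s in (0 : ℝ)..1, (fderiv ℝ F (x₀, s)).comp (ContinuousLinearMap.inl ℝ E ℝ)) x₀ := by
  have hF' : Continuous fun q : E × ℝ => (fderiv ℝ F q).comp (ContinuousLinearMap.inl ℝ E ℝ) :=
    (hF.continuous_fderiv (by simp)).clm_comp continuous_const
  have hK : IsCompact (Metric.closedBall x₀ 1 ×ˢ Icc (0 : ℝ) 1) :=
    (isCompact_closedBall x₀ 1).prod isCompact_Icc
  obtain ⟨C, hC⟩ := hK.exists_bound_of_continuousOn hF'.continuousOn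
  refine intervalIntegral.hasFDerivAt_integral_of_dominated_of_fderiv_le
    (F := fun x s => F (x, s))
    (F' := fun x s => (fderiv ℝ F (x, s)).comp (ContinuousLinearMap.inl ℝ E ℝ))
    (bound := fun _ => C) (Metric.closedBall_mem_nhds x₀ one_pos) ?_ ?_ ?_ ?_ ?_ ?_
  · exact Filter.Eventually.of_forall fun x => by
      have : Continuous fun s : ℝ => F (x, s) := hF.continuous.comp (by fun_prop)
      exact this.aestronglyMeasurable
  · have : Continuous fun s : ℝ => F (x₀, s) := hF.continuous.comp (by fun_prop)
    exact this.intervalIntegrable _ _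
  · have : Continuous fun s : ℝ => (fderiv ℝ F (x₀, s)).comp (ContinuousLinearMap.inl ℝ E ℝ) :=
      hF'.comp (by fun_prop : Continuous fun s : ℝ => (x₀, s))
    exact this.aestronglyMeasurable
  · refine Filter.Eventually.of_forall fun s hs x hx => hC (x, s) ⟨hx, ?_⟩
    rw [uIoc_of_le zero_le_one] at hs
    exact ⟨hs.1.le, hs.2⟩
  · exact intervalIntegrable_const
  · refine Filter.Eventually.of_forall fun s _ x _ => ?_
    have h1 : HasFDerivAt F (fderiv ℝ F (x, s)) (x, s) :=
      (hF.differentiable (by simp) _).hasFDerivAt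
    exact h1.comp x (hasFDerivAt_prodMk_left x s)

theorem contDiff_intervalIntegral {F : E × ℝ → G} (hF : ContDiff ℝ ∞ F) :
    ContDiff ℝ ∞ fun x => ∫ s in (0 : ℝ)..1, F (x, s) := by
  rw [contDiff_infty]
  intro k
  -- The derivative is an integral of the same form with values in a space of linear maps, so the
  -- target has to vary in the induction.
  induction k generalizing G with
  | zero =>
    rw [Nat.cast_zero, contDiff_zero]
    exact continuous_iff_continuousAt.2 fun x =>
      (hasFDerivAt_intervalIntegral_of_contDiff hF x).continuousAt
  | succ k ih =>
    push_cast
    rw [contDiff_succ_iff_hasFDerivAt]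
    refine ⟨_, ?_, hasFDerivAt_intervalIntegral_of_contDiff hF⟩
    refine ih (F := fun q : E × ℝ => (fderiv ℝ F q).comp (ContinuousLinearMap.inl ℝ E ℝ)) ?_
    exact (hF.fderiv_right (by simp)).clm_comp contDiff_const

/-- A smooth function which vanishes on the kernel of a linear functional is divisible by it. -/
theorem exists_eq_mul_of_vanish_on_ker (ℓ : E →L[ℝ] ℝ) (hℓ : ℓ ≠ 0) {h : E → ℝ}
    (hh : ContDiff ℝ ∞ h) (h0 : ∀ y, ℓ y = 0 → h y = 0) :
    ∃ q : E → ℝ, ContDiff ℝ ∞ q ∧ ∀ y, h y = ℓ y * q y := by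
  obtain ⟨v, hv⟩ : ∃ v, ℓ v = 1 := by
    obtain ⟨w, hw⟩ : ∃ w, ℓ w ≠ 0 := by
      by_contra! H
      exact hℓ (ContinuousLinearMap.ext H)
    exact ⟨(ℓ w)⁻¹ • w, by simp [hw]⟩
  -- Integration along the segment from `y` to its projection `y - ℓ y • v` onto the kernel, where
  -- `h` vanishes; the velocity supplies the factor `ℓ y`.
  refine ⟨fun y => ∫ s in (0 : ℝ)..1, fderiv ℝ h (y - (s * ℓ y) • v) v, ?_, fun y => ?_⟩
  · refine contDiff_intervalIntegral
      (F := fun q : E × ℝ => fderiv ℝ h (q.1 - (q.2 * ℓ q.1) • v) v) ?_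
    have h1 : ContDiff ℝ ∞ (fderiv ℝ h) := hh.fderiv_right (by simp)
    have h2 : ContDiff ℝ ∞ fun q : E × ℝ => q.1 - (q.2 * ℓ q.1) • v := by fun_prop
    exact (h1.comp h2).clm_apply contDiff_const
  · have hd : ∀ s : ℝ, HasDerivAt (fun s => -h (y - (s * ℓ y) • v))
        (ℓ y * fderiv ℝ h (y - (s * ℓ y) • v) v) s := by
      intro s
      have h1 : HasDerivAt (fun s : ℝ => y - (s * ℓ y) • v) (-(ℓ y • v)) s := by
        have := (((hasDerivAt_id s).mul_const (ℓ y)).smul_const v).const_sub y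
        simpa using this
      have h2 := (hh.differentiable (by simp) (y - (s * ℓ y) • v)).hasFDerivAt.comp_hasDerivAt s h1
      have := h2.neg
      simpa [Function.comp_def] using! this
    have hc : Continuous fun s : ℝ => ℓ y * fderiv ℝ h (y - (s * ℓ y) • v) v := by
      refine continuous_const.mul ?_
      exact ((hh.continuous_fderiv (by simp)).comp (by fun_prop)).clm_apply continuous_const
    have := intervalIntegral.integral_eq_sub_of_hasDerivAt (a := 0) (b := 1) (fun s _ => hd s)
      (hc.intervalIntegrable _ _)
    rw [intervalIntegral.integral_const_mul] at this
    rw [this, h0 (y - (1 * ℓ y) • v) (by simp [hv])]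
    simp

theorem natCast_le_infty (m : ℕ) : (m : ℕ∞ω) ≤ ∞ := by exact_mod_cast le_top

theorem exists_bound_iteratedFDeriv {h : E → ℝ} (hh : ContDiff ℝ ∞ h) (hc : HasCompactSupport h)
    (j : ℕ) : ∃ C, ∀ x, ‖iteratedFDeriv ℝ j h x‖ ≤ C :=
  (hh.continuous_iteratedFDeriv (m := j) (natCast_le_infty _)).bounded_above_of_compact_support (hc.iteratedFDeriv j)

/-- The scaling estimate behind Borel's lemma. -/
theorem exists_bound_scaled (ℓ : E →L[ℝ] ℝ) {A : E → ℝ} (hA : ContDiff ℝ ∞ A)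
    (hAc : HasCompactSupport A) {χ : ℝ → ℝ} (hχ : ContDiff ℝ ∞ χ) (hχc : HasCompactSupport χ)
    (p j : ℕ) (hj : j < p) : ∃ C, ∀ ε : ℝ, 0 < ε → ε ≤ 1 → ∀ x,
      ‖iteratedFDeriv ℝ j (fun x => A x * ℓ x ^ p * χ (ℓ x / ε)) x‖ ≤ C * ε := by
  set θ : ℝ → ℝ := fun t => t ^ p * χ t
  have hθ : ContDiff ℝ ∞ θ := (contDiff_id.pow p).mul hχ
  have hθc : HasCompactSupport θ := hχc.mul_left
  choose CA hCA using exists_bound_iteratedFDeriv hA hAc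
  choose Cθ hCθ using exists_bound_iteratedFDeriv hθ hθc
  have hCA0 : ∀ i, 0 ≤ CA i := fun i => (norm_nonneg _).trans (hCA i 0)
  have hCθ0 : ∀ i, 0 ≤ Cθ i := fun i => (norm_nonneg _).trans (hCθ i 0)
  refine ⟨∑ i ∈ Finset.range (j + 1), (j.choose i : ℝ) * CA i * (Cθ (j - i) * ‖ℓ‖ ^ (j - i)),
    fun ε hε hε1 x => ?_⟩
  -- Rescaling with `θ t = t ^ p * χ t` extracts `ε ^ p`. Each derivative of `θ ∘ (ε⁻¹ • ℓ)` costs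
  -- one `ε⁻¹`, and `j < p` leaves at least one factor `ε`.
  have e1 : (fun x => A x * ℓ x ^ p * χ (ℓ x / ε)) =
      fun x => A x * (ε ^ p • (θ ∘ (ε⁻¹ • ℓ : E →L[ℝ] ℝ))) x := by
    funext x
    simp only [θ, Pi.smul_apply, Function.comp_apply, smul_apply, smul_eq_mul]
    rw [mul_pow, div_eq_inv_mul, inv_pow]
    field_simp
  have hs : ContDiff ℝ ∞ (θ ∘ (ε⁻¹ • ℓ : E →L[ℝ] ℝ)) := hθ.comp (ContinuousLinearMap.contDiff _)
  rw [e1]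
  refine (norm_iteratedFDeriv_mul_le hA (hs.const_smul (ε ^ p)) x
    (n := j) (natCast_le_infty _)).trans ?_
  rw [Finset.sum_mul]
  refine Finset.sum_le_sum fun i hi => ?_
  have hi' : i ≤ j := Nat.lt_succ_iff.1 (Finset.mem_range.1 hi)
  have e2 : ‖iteratedFDeriv ℝ (j - i) (ε ^ p • (θ ∘ (ε⁻¹ • ℓ : E →L[ℝ] ℝ))) x‖ ≤
      Cθ (j - i) * ‖ℓ‖ ^ (j - i) * ε := by
    rw [iteratedFDeriv_const_smul_apply (hs.contDiffAt.of_le (natCast_le_infty _)), norm_smul,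
      ContinuousLinearMap.iteratedFDeriv_comp_right _ hθ x (i := j - i) (natCast_le_infty _)]
    have h1 := ContinuousMultilinearMap.norm_compContinuousLinearMap_le
      (iteratedFDeriv ℝ (j - i) θ ((ε⁻¹ • ℓ : E →L[ℝ] ℝ) x)) (fun _ => (ε⁻¹ • ℓ : E →L[ℝ] ℝ))
    rw [Finset.prod_const, Finset.card_univ, Fintype.card_fin, norm_smul, norm_inv,
      Real.norm_of_nonneg hε.le] at h1
    rw [norm_pow, Real.norm_of_nonneg hε.le]
    have h2 : ε ^ p * ε⁻¹ ^ (j - i) ≤ ε := by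
      have : p = (p - (j - i) - 1) + 1 + (j - i) := by omega
      rw [inv_pow, this, pow_add, pow_succ, mul_assoc, mul_inv_cancel₀ (by positivity), mul_one]
      exact mul_le_of_le_one_left hε.le (pow_le_one₀ hε.le hε1)
    calc ε ^ p * _ ≤ ε ^ p * (Cθ (j - i) * (ε⁻¹ * ‖ℓ‖) ^ (j - i)) := by
          gcongr
          exact h1.trans (by gcongr; exact hCθ _ _)
      _ = (Cθ (j - i) * ‖ℓ‖ ^ (j - i)) * (ε ^ p * ε⁻¹ ^ (j - i)) := by rw [mul_pow]; ring
      _ ≤ _ := by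
          have := hCθ0 (j - i)
          gcongr
  calc _ ≤ (j.choose i : ℝ) * CA i * (Cθ (j - i) * ‖ℓ‖ ^ (j - i) * ε) := by
        have := hCA0 i
        gcongr
        · exact hCA i x
        · exact e2
    _ = _ := by ring

/-- **Borel's lemma**: a smooth function with a prescribed expansion in powers of a linear
functional. -/
theorem exists_borel_sum (ℓ : E →L[ℝ] ℝ) (a : ℕ → E → ℝ) (ha : ∀ k, ContDiff ℝ ∞ (a k))
    (hac : ∀ k, HasCompactSupport (a k)) :
    ∃ F : E → ℝ, ContDiff ℝ ∞ F ∧ ∀ K : ℕ, ∃ q : E → ℝ, ContDiff ℝ ∞ q ∧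
      ∀ x, F x = ∑ k ∈ Finset.range K, a k x * ℓ x ^ k + q x * ℓ x ^ K := by
  let χ : ContDiffBump (0 : ℝ) := ⟨1, 2, one_pos, one_lt_two⟩
  have hχ : ContDiff ℝ ∞ (χ : ℝ → ℝ) := χ.contDiff
  have hχ1 : ∀ t : ℝ, |t| ≤ 1 → χ t = 1 := fun t ht =>
    χ.one_of_mem_closedBall (by simpa [χ] using ht)
  -- All exponents `p ≤ k` are needed, not only `p = k`: the remainder of order `K` is the series
  -- with `ℓ ^ K` divided out, and it must converge with the same `ε`.
  have hbd : ∀ k : ℕ, ∃ ε : ℝ, 0 < ε ∧ ∀ p ≤ k, ∀ j < p, ∀ x,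
      ‖iteratedFDeriv ℝ j (fun x => a k x * ℓ x ^ p * χ (ℓ x / ε)) x‖ ≤ (1 / 2) ^ k := by
    intro k
    have h1 : ∀ p j, ∃ C, j < p → ∀ ε : ℝ, 0 < ε → ε ≤ 1 → ∀ x,
        ‖iteratedFDeriv ℝ j (fun x => a k x * ℓ x ^ p * χ (ℓ x / ε)) x‖ ≤ C * ε := by
      intro p j
      by_cases hj : j < p
      · obtain ⟨C, hC⟩ := exists_bound_scaled ℓ (ha k) (hac k) hχ χ.hasCompactSupport p j hj
        exact ⟨C, fun _ => hC⟩
      · exact ⟨0, fun h => absurd h hj⟩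
    choose C hC using h1
    -- A common upper bound for the finitely many constants; the summand `1` makes the width `(1 /
    -- 2) ^ k / D` at most `1`.
    set D := 1 + ∑ p ∈ Finset.range (k + 1), ∑ j ∈ Finset.range p, |C p j|
    have hD1 : 1 ≤ D := le_add_of_nonneg_right
      (Finset.sum_nonneg fun p _ => Finset.sum_nonneg fun j _ => abs_nonneg _)
    have hDC : ∀ p ≤ k, ∀ j < p, C p j ≤ D := by
      intro p hp j hj
      have e1 : |C p j| ≤ ∑ j ∈ Finset.range p, |C p j| :=
        Finset.single_le_sum (f := fun j => |C p j|) (fun j _ => abs_nonneg _)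
          (Finset.mem_range.2 hj)
      have e2 : ∑ j ∈ Finset.range p, |C p j| ≤
          ∑ p ∈ Finset.range (k + 1), ∑ j ∈ Finset.range p, |C p j| :=
        Finset.single_le_sum (f := fun p => ∑ j ∈ Finset.range p, |C p j|)
          (fun p _ => Finset.sum_nonneg fun j _ => abs_nonneg _)
          (Finset.mem_range.2 (by omega))
      have := le_abs_self (C p j)
      simp only [D]
      linarith
    have hhalf : (0 : ℝ) < (1 / 2) ^ k := by positivity
    refine ⟨(1 / 2) ^ k / D, by positivity, fun p hp j hj x => ?_⟩
    refine (hC p j hj _ (by positivity) ?_ x).trans ?_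
    · rw [div_le_one (by positivity)]
      exact (pow_le_one₀ (by norm_num) (by norm_num)).trans hD1
    · calc C p j * ((1 / 2) ^ k / D) ≤ D * ((1 / 2) ^ k / D) := by
            gcongr
            exact hDC p hp j hj
        _ = _ := by field_simp
  choose ε hε hbd using hbd
  have hT : ∀ k p, ContDiff ℝ ∞ (fun x => a k x * ℓ x ^ p * χ (ℓ x / ε k)) := fun k p =>
    ((ha k).mul (ℓ.contDiff.pow p)).mul (hχ.comp (ℓ.contDiff.div_const _))
  have hS : ∀ K, ContDiff ℝ ∞ fun x => ∑' k, a (k + K) x * ℓ x ^ k * χ (ℓ x / ε (k + K)) := by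
    intro K
    -- The bound for the derivative of order `j` is available from the index `j + 1` on, which is
    -- enough.
    refine contDiff_tsum_of_eventually (N := ⊤) (v := fun _ i => (1 / 2) ^ i)
      (fun k => hT (k + K) k) (fun _ _ => summable_geometric_two) fun j _ => ?_
    rw [Nat.cofinite_eq_atTop]
    filter_upwards [Filter.eventually_gt_atTop j] with i hi x
    exact (hbd (i + K) i (by omega) j hi x).trans
      (pow_le_pow_of_le_one (by norm_num) (by norm_num) (by omega))
  -- The remainder consists of the tail divided by `ℓ ^ K` and of the error made by the cut-offs in
  -- the first `K` terms. The latter is divisible by `ℓ ^ K` because `χ - 1` vanishes near `0`; the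
  -- value of the quotient at `0` is `0`.
  refine ⟨_, hS 0, fun K => ⟨fun x => ∑' k, a (k + K) x * ℓ x ^ k * χ (ℓ x / ε (k + K)) +
    ∑ k ∈ Finset.range K, a k x * ℓ x ^ k * ((χ (ℓ x / ε k) - 1) / ℓ x ^ K), ?_, fun x => ?_⟩⟩
  · refine (hS K).add (ContDiff.sum fun k _ => ((ha k).mul (ℓ.contDiff.pow k)).mul ?_)
    have : ContDiff ℝ ∞ fun t : ℝ => (χ (t / ε k) - 1) / t ^ K := by
      rw [contDiff_iff_contDiffAt]
      intro t
      by_cases ht : t = 0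
      · subst ht
        refine (contDiffAt_const (c := (0 : ℝ))).congr_of_eventuallyEq ?_
        filter_upwards [Metric.closedBall_mem_nhds (0 : ℝ) (hε k)] with t ht
        rw [hχ1, sub_self, zero_div]
        rw [abs_div, abs_of_pos (hε k), div_le_one (hε k)]
        simpa using ht
      · exact ((hχ.comp (contDiff_id.div_const _)).sub contDiff_const).contDiffAt.div
          (contDiff_id.pow K).contDiffAt (pow_ne_zero _ ht)
    exact this.comp ℓ.contDiff
  · have hsum : Summable fun k => a k x * ℓ x ^ k * χ (ℓ x / ε k) := by
      refine Summable.of_norm_bounded_eventually_nat summable_geometric_two ?_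
      filter_upwards [Filter.eventually_gt_atTop 0] with k hk
      have := hbd k k le_rfl 0 hk x
      rwa [norm_iteratedFDeriv_zero] at this
    have h1 := hsum.sum_add_tsum_nat_add K
    simp only [Nat.add_zero]
    rw [← h1, add_mul, ← tsum_mul_right, Finset.sum_mul, add_comm (∑' _, _), ← add_assoc,
      ← Finset.sum_add_distrib]
    congr 1
    · refine Finset.sum_congr rfl fun k hk => ?_
      by_cases hx : ℓ x = 0
      · rw [hx, zero_div, hχ1 0 (by simp)]
        simp
      · field_simp
        ring
    · refine tsum_congr fun k => ?_
      rw [pow_add]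
      ring

end

/-! ### Smooth division and Borel summation on a manifold -/

/-- Near a regular zero, a smooth function is a linear functional in suitable coordinates. -/
theorem exists_straightening {E : Type} [NormedAddCommGroup E] [NormedSpace ℝ E]
    [FiniteDimensional ℝ E] {f : E → ℝ} {s : Set E} {p : E} (hs : IsOpen s) (hp : p ∈ s)
    (hf : ContDiffOn ℝ ∞ f s) (hd : fderiv ℝ f p ≠ 0) :
    ∃ (e : OpenPartialHomeomorph E E) (ℓ : E →L[ℝ] ℝ), ℓ ≠ 0 ∧ p ∈ e.source ∧ e.source ⊆ s ∧
      ContDiffOn ℝ ∞ e e.source ∧ ContDiffOn ℝ ∞ e.symm e.target ∧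
      ∀ x ∈ e.source, ℓ (e x) = f x := by
  have : CompleteSpace E := FiniteDimensional.complete ℝ E
  set ℓ := fderiv ℝ f p
  obtain ⟨v, hv⟩ : ∃ v, ℓ v = 1 := by
    obtain ⟨w, hw⟩ : ∃ w, ℓ w ≠ 0 := by
      by_contra! H
      exact hd (ContinuousLinearMap.ext H)
    exact ⟨(ℓ w)⁻¹ • w, by simp [hw]⟩
  -- Since `ℓ v = 1`, one has `ℓ ∘ Φ = f`, and the derivative at `p` is the identity because `ℓ` is
  -- the derivative of `f` there.
  set Φ : E → E := fun x => x + (f x - ℓ x) • v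
  have hΦ : ContDiffOn ℝ ∞ Φ s := contDiffOn_id.add
    ((hf.sub ℓ.contDiff.contDiffOn).smul contDiffOn_const)
  have hΦat : ∀ x ∈ s, ContDiffAt ℝ ∞ Φ x := fun x hx => hΦ.contDiffAt (hs.mem_nhds hx)
  have hfp : HasFDerivAt f ℓ p :=
    ((hf.contDiffAt (hs.mem_nhds hp)).differentiableAt (by simp)).hasFDerivAt
  have hΦp : HasFDerivAt Φ ((ContinuousLinearEquiv.refl ℝ E : E ≃L[ℝ] E) : E →L[ℝ] E) p := by
    have := (hasFDerivAt_id p).add ((hfp.sub ℓ.hasFDerivAt).smul_const v)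
    convert this using 1
    · rfl
    · ext x
      simp
  let e₀ := (hΦat p hp).toOpenPartialHomeomorph Φ hΦp (by simp)
  have he₀ : (e₀ : E → E) = Φ := ContDiffAt.toOpenPartialHomeomorph_coe _ _ _
  -- Restricting to points with invertible derivative makes the inverse smooth on the whole target,
  -- not only at the image of `p`.
  have hU : IsOpen (s ∩ fderiv ℝ Φ ⁻¹' range ((↑) : (E ≃L[ℝ] E) → E →L[ℝ] E)) :=
    ContinuousOn.isOpen_inter_preimage (hΦ.continuousOn_fderiv_of_isOpen hs (by simp)) hs
      ContinuousLinearEquiv.isOpen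
  let e := e₀.restrOpen _ hU
  have hes : e.source ⊆ s := fun x hx => hx.2.1
  have heΦ : ∀ x, e x = Φ x := fun x => congrFun he₀ x
  refine ⟨e, ℓ, hd, ⟨ContDiffAt.mem_toOpenPartialHomeomorph_source _ _ _, hp, _, hΦp.fderiv.symm⟩,
    hes, ?_, fun z hz => ?_, fun x _ => ?_⟩
  · exact (hΦ.mono hes).congr fun x _ => heΦ x
  · obtain ⟨-, hx, A, hA⟩ : e.symm z ∈ e.source := e.map_target hz
    have hfun : (e : E → E) = Φ := funext heΦ
    refine (e.contDiffAt_symm hz (f₀' := A) ?_ ?_).contDiffWithinAt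
    · rw [hfun, hA]
      exact ((hΦat _ hx).differentiableAt (by simp)).hasFDerivAt
    · rw [hfun]
      exact hΦat _ hx
  · rw [heΦ]
    simp [Φ, hv]

/-- Smoothness of a real function on the manifold. -/
abbrev Smooth (n : ℕ) {N : Type*} [TopologicalSpace N]
    [ChartedSpace (EuclideanSpace ℝ (Fin (n + 1))) N] (f : N → ℝ) : Prop :=
  ContMDiff (𝓡 (n + 1)) 𝓘(ℝ, ℝ) ∞ f

/-- Smoothness of a real function in a neighbourhood of a point. -/
def SmoothFunNear (n : ℕ) {N : Type*} [TopologicalSpace N]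
    [ChartedSpace (EuclideanSpace ℝ (Fin (n + 1))) N] (f : N → ℝ) (x : N) : Prop :=
  ∀ᶠ y in 𝓝 x, ContMDiffAt (𝓡 (n + 1)) 𝓘(ℝ, ℝ) ∞ f y

section
variable {n : ℕ} {N : Type*} [TopologicalSpace N]
  [ChartedSpace (EuclideanSpace ℝ (Fin (n + 1))) N] [IsManifold (𝓡 (n + 1)) ∞ N]

theorem Smooth.near {f : N → ℝ} (hf : Smooth n f) (x : N) : SmoothFunNear n f x :=
  Filter.Eventually.of_forall fun y => hf y

/-- Coordinates near a regular zero of `f` in which `f` is a linear functional `ℓ`, with a linear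
operator `T` transporting global smooth functions. -/
theorem exists_straightening_transport {f : N → ℝ} (hf : Smooth n f) {x₀ : N}
    (hd : diff (n := n) f x₀ ≠ 0) :
    ∃ (ℓ : EuclideanSpace ℝ (Fin (n + 1)) →L[ℝ] ℝ) (ψ : N → EuclideanSpace ℝ (Fin (n + 1)))
      (T : (N → ℝ) → EuclideanSpace ℝ (Fin (n + 1)) → ℝ), ℓ ≠ 0 ∧
      (∀ᶠ y in 𝓝 x₀, ContMDiffAt (𝓡 (n + 1)) 𝓘(ℝ, EuclideanSpace ℝ (Fin (n + 1))) ∞ ψ y ∧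
        ℓ (ψ y) = f y ∧ ∀ g, T g (ψ y) = g y) ∧
      ∀ g, Smooth n g → ContDiff ℝ ∞ (T g) ∧ HasCompactSupport (T g) ∧
        ((∀ y, f y = 0 → g y = 0) → ∀ z, ℓ z = 0 → T g z = 0) := by
  set φ := extChartAt (𝓡 (n + 1)) x₀ with hφ
  have hpt : φ x₀ ∈ φ.target := mem_extChartAt_target x₀
  have hto : IsOpen φ.target := isOpen_extChartAt_target x₀
  have hsm : ∀ g : N → ℝ, Smooth n g → ContDiffOn ℝ ∞ (g ∘ φ.symm) φ.target := fun g hg =>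
    (hg.comp_contMDiffOn (contMDiffOn_extChartAt_symm x₀)).contDiffOn
  have hd' : fderiv ℝ (f ∘ φ.symm) (φ x₀) ≠ 0 := by
    intro h0
    apply hd
    ext v
    have := diff_eq_fderiv (x := x₀) (mem_chart_source _ x₀) (contMDiff_mdiff hf x₀) (ext v)
    rw [← hφ, h0, ext_self] at this
    exact this
  obtain ⟨e, ℓ, hℓ, hpe, hes, he, he', hef⟩ := exists_straightening hto hpt (hsm f hf) hd'
  obtain ⟨R, hR, hRt⟩ := Metric.nhds_basis_closedBall.mem_iff.1
    (e.open_target.mem_nhds (e.map_source hpe))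
  let χ : ContDiffBump (e (φ x₀)) := ⟨R / 2, R, by linarith, by linarith⟩
  have hW : ∀ᶠ y in 𝓝 x₀, y ∈ φ.source ∧ φ y ∈ e.source := by
    refine Filter.Eventually.and (extChartAt_source_mem_nhds x₀) ?_
    exact (continuousAt_extChartAt x₀).eventually (e.open_source.mem_nhds hpe)
  -- The cut-off is supported inside `e.target` and equals `1` near the base point, so the
  -- transported function is globally smooth with compact support and still represents `g` locally.
  refine ⟨ℓ, fun y => e (φ y), fun g z => χ z * g (φ.symm (e.symm z)), hℓ, ?_, fun g hg => ?_⟩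
  · have hχ : ∀ᶠ y in 𝓝 x₀, χ (e (φ y)) = 1 := by
      have hc : ContinuousAt (fun y => e (φ y)) x₀ :=
        ContinuousAt.comp (f := φ) (e.continuousAt hpe) (continuousAt_extChartAt x₀)
      exact hc.eventually χ.eventuallyEq_one
    filter_upwards [hW, hχ] with y hy h1
    refine ⟨?_, ?_, fun g => ?_⟩
    · have h2 : ContMDiffAt 𝓘(ℝ, EuclideanSpace ℝ (Fin (n + 1)))
          𝓘(ℝ, EuclideanSpace ℝ (Fin (n + 1))) ∞ e (φ y) :=
        (he.contDiffAt (e.open_source.mem_nhds hy.2)).contMDiffAt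
      exact h2.comp y (contMDiffAt_extChartAt' (by simpa [hφ] using hy.1))
    · rw [hef _ hy.2, Function.comp_apply, φ.left_inv hy.1]
    · rw [h1, e.left_inv hy.2, φ.left_inv hy.1, one_mul]
  · refine ⟨?_, χ.hasCompactSupport.mul_right, fun h0 z hz => ?_⟩
    · rw [contDiff_iff_contDiffAt]
      intro z
      by_cases hz : z ∈ e.target
      · refine χ.contDiffAt.mul ?_
        have h1 := (hsm g hg).contDiffAt (hto.mem_nhds (hes (e.map_target hz)))
        exact h1.comp z (he'.contDiffAt (e.open_target.mem_nhds hz))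
      · have hz' : z ∉ tsupport χ := fun h => hz (hRt (by rwa [χ.tsupport_eq] at h))
        refine (contDiffAt_const (c := (0 : ℝ))).congr_of_eventuallyEq ?_
        filter_upwards [notMem_tsupport_iff_eventuallyEq.1 hz'] with w hw
        rw [hw, Pi.zero_apply, zero_mul]
    · change χ z * g (φ.symm (e.symm z)) = 0
      by_cases hzt : z ∈ e.target
      · rw [h0, mul_zero]
        have := hef _ (e.map_target hzt)
        rw [e.right_inv hzt, hz] at this
        exact this.symm
      · have hz' : z ∉ tsupport χ := fun h => hzt (hRt (by rwa [χ.tsupport_eq] at h))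
        rw [image_eq_zero_of_notMem_tsupport hz', zero_mul]

variable [T2Space N] [SecondCountableTopology N]

/-- Local smooth solutions of a convex pointwise condition can be glued. -/
theorem exists_smooth_of_local (P : N → ℝ → Prop) (hP : ∀ x, Convex ℝ {q | P x q})
    (h : ∀ x, ∃ q : N → ℝ, SmoothFunNear n q x ∧ ∀ᶠ y in 𝓝 x, P y (q y)) :
    ∃ q : N → ℝ, Smooth n q ∧ ∀ x, P x (q x) := by
  have : LocallyCompactSpace N := ChartedSpace.locallyCompactSpace (EuclideanSpace ℝ (Fin (n + 1))) N
  obtain ⟨q, hq⟩ := exists_contMDiffMap_forall_mem_convex_of_local (𝓡 (n + 1)) (n := ⊤) (F := ℝ)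
    (t := fun x => {q | P x q}) hP fun x => by
      obtain ⟨q, hq, hP⟩ := h x
      exact ⟨_, hq.and hP, q, fun y hy => hy.1.contMDiffWithinAt, fun y hy => hy.2⟩
  exact ⟨q, q.contMDiff, hq⟩

theorem convex_mul_eq (a b : ℝ) : Convex ℝ {q : ℝ | b = q * a} := by
  intro q hq q' hq' s t _ _ hst
  simp only [mem_ofPred_eq, smul_eq_mul] at *
  linear_combination (s * hq + t * hq' - b * hst)

/-- The values `q` with `g x = q * f x` form a convex set, so local quotients can be averaged even
where `f` vanishes and they are not determined. -/
theorem exists_smooth_quotient {f g : N → ℝ} (h : ∀ x, ∃ q : N → ℝ, SmoothFunNear n q x ∧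
    ∀ᶠ y in 𝓝 x, g y = q y * f y) : ∃ q : N → ℝ, Smooth n q ∧ ∀ x, g x = q x * f x :=
  exists_smooth_of_local (fun x q => g x = q * f x) (fun x => convex_mul_eq (f x) (g x)) h

theorem SmoothFunNear.div {f g : N → ℝ} {x : N} (hg : SmoothFunNear n g x)
    (hf : SmoothFunNear n f x) (h : f x ≠ 0) : SmoothFunNear n (fun y => g y / f y) x := by
  filter_upwards [hg, hf, hf.self_of_nhds.continuousAt.eventually_ne h] with y h1 h2 h3
  exact ContMDiffAt.div₀ h1 h2 h3

/-- **Hadamard's lemma**: a smooth function vanishing on the regular zero set of `f` is divisible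
by `f`. -/
theorem exists_smooth_quotient_of_vanish {f g : N → ℝ} (hf : Smooth n f) (hg : Smooth n g)
    (hd : ∀ x, f x = 0 → diff (n := n) f x ≠ 0) (h : ∀ x, f x = 0 → g x = 0) :
    ∃ q : N → ℝ, Smooth n q ∧ ∀ x, g x = q x * f x := by
  refine exists_smooth_quotient fun x => ?_
  by_cases hx : f x = 0
  · obtain ⟨ℓ, ψ, T, hℓ, hψ, hT⟩ := exists_straightening_transport hf (hd x hx)
    obtain ⟨h1, -, h3⟩ := hT g hg
    obtain ⟨q, hq, hq'⟩ := exists_eq_mul_of_vanish_on_ker ℓ hℓ h1 (h3 h)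
    refine ⟨fun y => q (ψ y), ?_, ?_⟩
    · filter_upwards [hψ] with y hy
      exact hq.contMDiff.contMDiffAt.comp y hy.1
    · filter_upwards [hψ] with y hy
      rw [← hy.2.2 g, hq', hy.2.1, mul_comm]
  · refine ⟨fun y => g y / f y, (hg.near x).div (hf.near x) hx, ?_⟩
    filter_upwards [(hf x).continuousAt.eventually_ne hx] with y hy
    field_simp

/-- **Borel's lemma**: a smooth function with a prescribed expansion in powers of a function `f`
with regular zero set. -/
theorem exists_smooth_borel_sum {f : N → ℝ} (hf : Smooth n f)
    (hd : ∀ x, f x = 0 → diff (n := n) f x ≠ 0) (a : ℕ → N → ℝ) (ha : ∀ k, Smooth n (a k)) :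
    ∃ F : N → ℝ, Smooth n F ∧ ∀ K : ℕ, ∃ q : N → ℝ, Smooth n q ∧
      ∀ x, F x - ∑ k ∈ Finset.range K, a k x * f x ^ k = q x * f x ^ K := by
  have : LocallyCompactSpace N := ChartedSpace.locallyCompactSpace (EuclideanSpace ℝ (Fin (n + 1))) N
  have hloc : ∀ x, ∃ (U : Set N) (F : N → ℝ) (q : ℕ → N → ℝ), IsOpen U ∧ x ∈ U ∧
      ContMDiffOn (𝓡 (n + 1)) 𝓘(ℝ, ℝ) ∞ F U ∧ (∀ K, ContMDiffOn (𝓡 (n + 1)) 𝓘(ℝ, ℝ) ∞ (q K) U) ∧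
      ∀ K, ∀ y ∈ U, F y - ∑ k ∈ Finset.range K, a k y * f y ^ k = q K y * f y ^ K := by
    intro x
    by_cases hx : f x = 0
    · obtain ⟨ℓ, ψ, T, hℓ, hψ, hT⟩ := exists_straightening_transport hf (hd x hx)
      obtain ⟨F, hF, hq⟩ := exists_borel_sum ℓ (fun k => T (a k)) (fun k => (hT _ (ha k)).1)
        (fun k => (hT _ (ha k)).2.1)
      choose q hq hFq using hq
      obtain ⟨U, hU, hUo, hxU⟩ := eventually_nhds_iff.1 hψ
      refine ⟨U, fun y => F (ψ y), fun K y => q K (ψ y), hUo, hxU, fun y hy => ?_,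
        fun K y hy => ?_, fun K y hy => ?_⟩
      · exact (hF.contMDiff.contMDiffAt.comp y (hU y hy).1).contMDiffWithinAt
      · exact ((hq K).contMDiff.contMDiffAt.comp y (hU y hy).1).contMDiffWithinAt
      · obtain ⟨-, h2, h3⟩ := hU y hy
        dsimp only
        rw [hFq K]
        simp only [h2, h3]
        ring
    -- Off the zero set any `F` is admissible, since division by `f ^ K` is smooth there.
    · refine ⟨{y | f y ≠ 0}, fun _ => 0,
        fun K y => (0 - ∑ k ∈ Finset.range K, a k y * f y ^ k) / f y ^ K,
        isOpen_ne_fun hf.continuous continuous_const, hx, contMDiffOn_const, fun K y hy => ?_,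
        fun K y hy => ?_⟩
      · refine ContMDiffAt.contMDiffWithinAt ?_
        refine ContMDiffAt.div₀ ?_ ((hf y).pow K) (pow_ne_zero _ hy)
        exact contMDiffAt_const.sub
          (contMDiffAt_finsetSum fun k _ => (ha k y).mul ((hf y).pow k))
      · have : f y ^ K ≠ 0 := pow_ne_zero _ hy
        field_simp
  choose U F q hU hxU hF hq hFq using hloc
  obtain ⟨ρ, hρ⟩ := SmoothPartitionOfUnity.exists_isSubordinate (𝓡 (n + 1)) isClosed_univ U hU
    (fun x _ => mem_iUnion.2 ⟨x, hxU x⟩)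
  refine ⟨fun x => ∑ᶠ i, ρ i x • F i x, hρ.contMDiff_finsum_smul hU hF, fun K =>
    ⟨fun x => ∑ᶠ i, ρ i x • q i K x, hρ.contMDiff_finsum_smul hU fun i => hq i K, fun x => ?_⟩⟩
  dsimp only
  rw [← ρ.sum_finsupport_smul_eq_finsum (fun i x => F i x) (x₀ := x), ← ρ.sum_finsupport_smul_eq_finsum (fun i x => q i K x) (x₀ := x),
    Finset.sum_mul]
  have h1 := ρ.sum_finsupport x (mem_univ x)
  set S := ∑ k ∈ Finset.range K, a k x * f x ^ k
  -- The weights sum to `1` and the partial sum `S` is the same in all charts, so the expansions may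
  -- be averaged term by term.
  have h2 : S = ∑ i ∈ ρ.finsupport x, ρ i x * S := by
    rw [← Finset.sum_mul, h1, one_mul]
  rw [h2, ← Finset.sum_sub_distrib]
  refine Finset.sum_congr rfl fun i hi => ?_
  have hxi : x ∈ U i := hρ i (subset_tsupport _ ((ρ.mem_finsupport x).1 hi))
  have := hFq i K x hxi
  simp only [smul_eq_mul]
  linear_combination ρ i x * this

end

/-! ### Change of frame -/

section
variable {n : ℕ} {N : Type*} [TopologicalSpace N]
  [ChartedSpace (EuclideanSpace ℝ (Fin (n + 1))) N] [IsManifold (𝓡 (n + 1)) ∞ N]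

variable {c : AffineConnection n N} {x : N}

theorem SmoothNear.add {U V : ∀ y : N, Tan n y} (hU : SmoothNear U x) (hV : SmoothNear V x) :
    SmoothNear (U + V : ∀ y : N, Tan n y) x := by
  filter_upwards [hU, hV] with y h1 h2 using h1.add h2

theorem SmoothNear.const_smul {U : ∀ y : N, Tan n y} (a : ℝ) (hU : SmoothNear U x) :
    SmoothNear ((fun _ => a : N → ℝ) • U : ∀ y : N, Tan n y) x := by
  filter_upwards [hU] with y h1 using h1.smul contMDiffAt_const

theorem curvature_ext_add_left [T2Space N] (u u' v w : Tan n x) :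
    c.curvature (ext (u + u')) (ext v) (ext w) x =
      c.curvature (ext u) (ext v) (ext w) x + c.curvature (ext u') (ext v) (ext w) x := by
  have := curvature_eq (c := c) ((ext_smoothNear u).add (ext_smoothNear u')) (ext_smoothNear v)
    (ext_smoothNear w)
  rw [Pi.add_apply, ext_self, ext_self, ext_self, ext_self,
    curvature_add_left (ext_smoothNear u) (ext_smoothNear u') (ext_smoothNear w)] at this
  exact this.symm

theorem curvature_ext_smul_left [T2Space N] (a : ℝ) (u v w : Tan n x) :
    c.curvature (ext (a • u)) (ext v) (ext w) x = a • c.curvature (ext u) (ext v) (ext w) x := by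
  have := curvature_eq (c := c) ((ext_smoothNear u).const_smul a) (ext_smoothNear v)
    (ext_smoothNear w)
  rw [Pi.smul_apply', ext_self, ext_self, ext_self,
    curvature_smul_left contMDiffAt_const (ext_smoothNear u) (ext_smoothNear w)] at this
  exact this.symm

theorem curvature_ext_add_right [T2Space N] (u v w w' : Tan n x) :
    c.curvature (ext u) (ext v) (ext (w + w')) x =
      c.curvature (ext u) (ext v) (ext w) x + c.curvature (ext u) (ext v) (ext w') x := by
  have := curvature_eq (c := c) (ext_smoothNear u) (ext_smoothNear v)
    ((ext_smoothNear w).add (ext_smoothNear w'))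
  rw [Pi.add_apply, ext_self, ext_self, ext_self, ext_self,
    curvature_add_right (ext_smoothNear u) (ext_smoothNear v) (ext_smoothNear w)
      (ext_smoothNear w')] at this
  exact this.symm

theorem curvature_ext_smul_right [T2Space N] (a : ℝ) (u v w : Tan n x) :
    c.curvature (ext u) (ext v) (ext (a • w)) x = a • c.curvature (ext u) (ext v) (ext w) x := by
  have := curvature_eq (c := c) (ext_smoothNear u) (ext_smoothNear v)
    ((ext_smoothNear w).const_smul a)
  rw [Pi.smul_apply', ext_self, ext_self, ext_self,
    curvature_smul_right (Filter.Eventually.of_forall fun _ => contMDiffAt_const)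
      (ext_smoothNear u) (ext_smoothNear v) (ext_smoothNear w)] at this
  exact this.symm

/-- The Ricci tensor as a bilinear form. -/
noncomputable def ricciForm [T2Space N] (c : AffineConnection n N) (x : N) :
    Tan n x →ₗ[ℝ] Tan n x →ₗ[ℝ] ℝ :=
  LinearMap.mk₂ ℝ (fun v w => c.ricci x v w)
    (fun v v' w => by
      simp only [AffineConnection.ricci]
      rw [← Finset.sum_add_distrib]
      refine Finset.sum_congr rfl fun i _ => ?_
      rw [curvature_swap, curvature_ext_add_left, neg_add, ← curvature_swap, ← curvature_swap,
        map_add]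
      rfl)
    (fun a v w => by
      simp only [AffineConnection.ricci]
      rw [smul_eq_mul, Finset.mul_sum]
      refine Finset.sum_congr rfl fun i _ => ?_
      rw [curvature_swap, curvature_ext_smul_left, ← smul_neg, ← curvature_swap, map_smul]
      rfl)
    (fun v w w' => by
      simp only [AffineConnection.ricci]
      rw [← Finset.sum_add_distrib]
      refine Finset.sum_congr rfl fun i _ => ?_
      rw [curvature_ext_add_right, map_add]
      rfl)
    (fun a v w => by
      simp only [AffineConnection.ricci]
      rw [smul_eq_mul, Finset.mul_sum]
      refine Finset.sum_congr rfl fun i _ => ?_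
      rw [curvature_ext_smul_right, map_smul]
      rfl)

theorem schouten_eq [T2Space N] (v w : Tan n x) :
    c.schouten x v w = ricciForm c x v w / n := rfl

/-- The Hessian as a bilinear form. -/
noncomputable def hessForm (c : AffineConnection n N) {f : N → ℝ} (hf : Smooth n f) (x : N) :
    Tan n x →ₗ[ℝ] Tan n x →ₗ[ℝ] ℝ :=
  LinearMap.mk₂ ℝ (fun v w => c.hess f x v w) (fun u v w => hess_add_left u v w)
    (fun a u v => hess_smul_left a u v) (fun u v w => hess_add_right hf u v w)
    (fun a u v => hess_smul_right hf a u v)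

/-- The matrix of `D_I D_J ρ` in a scale in which `ρ` is represented by the function `f`. -/
noncomputable def hessMatrix (c : AffineConnection n N) (f : N → ℝ) (x : N)
    (e : Fin (n + 1) → Tan n x) :
    Matrix (Unit ⊕ Fin (n + 1)) (Unit ⊕ Fin (n + 1)) ℝ :=
  Matrix.fromBlocks (Matrix.of fun _ _ => 2 * f x) (Matrix.of fun _ j => diff (n := n) f x (e j))
    (Matrix.of fun i _ => diff (n := n) f x (e i))
    (Matrix.of fun i j => c.hess f x (e i) (e j) + 2 * f x * c.schouten x (e i) (e j))

theorem tractorDD_eq {f : N → ℝ} (hf : Smooth n f) (e : Frame n x) :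
    tractorDD c 1 (tractorD 2 f) x e = hessMatrix c f x e := by
  have h : ∀ u, diff (n := n) (fun y => 2 * f y) x u = 2 * diff (n := n) f x u := by
    intro u
    rw [diff_mul mdifferentiableAt_const (contMDiff_mdiff hf x), diff_const]
    ring
  simp only [tractorDD, tractorD, hessMatrix, AffineConnection.hess, h]
  congr 1
  · ext; simp
  · ext; simp
  · ext i j; simp; ring
  · ext i j; simp; ring

/-- Congruence by the block matrix of `1` and the change of basis; the border transforms as a
covector and the corner is unaffected. -/
theorem det_bordered_change_basis {T : Type*} [AddCommGroup T] [Module ℝ T] {ι : Type*}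
    [Fintype ι] [DecidableEq ι] (a : ℝ) (μ : T →ₗ[ℝ] ℝ) (Q : T →ₗ[ℝ] T →ₗ[ℝ] ℝ)
    (e : Basis ι ℝ T) (v : ι → T) :
    (Matrix.fromBlocks (Matrix.of fun _ _ : Unit => a) (Matrix.of fun _ j => μ (v j))
      (Matrix.of fun i _ => μ (v i)) (Matrix.of fun i j => Q (v i) (v j))).det =
    e.det v ^ 2 * (Matrix.fromBlocks (Matrix.of fun _ _ : Unit => a)
      (Matrix.of fun _ j => μ (e j)) (Matrix.of fun i _ => μ (e i))
      (Matrix.of fun i j => Q (e i) (e j))).det := by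
  have hv : ∀ j, v j = ∑ i, e.toMatrix v i j • e i := fun j => by
    simp [Basis.toMatrix_apply, e.sum_repr]
  have h1 : ∀ j, μ (v j) = ∑ i, e.toMatrix v i j * μ (e i) := fun j => by
    conv_lhs => rw [hv j]
    simp only [map_sum, map_smul, smul_eq_mul]
  have h2 : ∀ i j, Q (v i) (v j) =
      ∑ l, (∑ k, e.toMatrix v k i * Q (e k) (e l)) * e.toMatrix v l j := fun i j => by
    conv_lhs => rw [hv i, hv j]
    simp only [map_sum, map_smul, LinearMap.sum_apply, LinearMap.smul_apply, smul_eq_mul,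
      Finset.sum_mul, Finset.mul_sum]
    refine Finset.sum_congr rfl fun l _ => Finset.sum_congr rfl fun k _ => ?_
    ring
  have : Matrix.fromBlocks (Matrix.of fun _ _ : Unit => a) (Matrix.of fun _ j => μ (v j))
      (Matrix.of fun i _ => μ (v i)) (Matrix.of fun i j => Q (v i) (v j)) =
      Matrix.fromBlocks (1 : Matrix Unit Unit ℝ) 0 0 (e.toMatrix v).transpose *
      Matrix.fromBlocks (Matrix.of fun _ _ : Unit => a)
        (Matrix.of fun _ j => μ (e j)) (Matrix.of fun i _ => μ (e i))
        (Matrix.of fun i j => Q (e i) (e j)) *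
      Matrix.fromBlocks (1 : Matrix Unit Unit ℝ) 0 0 (e.toMatrix v) := by
    rw [Matrix.fromBlocks_multiply, Matrix.fromBlocks_multiply]
    congr 1 <;> ext i j <;> simp [Matrix.mul_apply, h1, h2, mul_comm]
  rw [this, Matrix.det_mul, Matrix.det_mul, Matrix.det_fromBlocks_zero₁₂,
    Matrix.det_fromBlocks_zero₁₂, Matrix.det_transpose, Basis.det_apply]
  simp
  ring

theorem det_hessMatrix_change [T2Space N] {f : N → ℝ} (hf : Smooth n f) (e : Frame n x)
    (v : Fin (n + 1) → Tan n x) :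
    (hessMatrix c f x v).det = e.det v ^ 2 * (hessMatrix c f x e).det :=
  det_bordered_change_basis (2 * f x) (diff (n := n) f x : Tan n x →ₗ[ℝ] ℝ)
    (hessForm c hf x + (2 * f x / n) • ricciForm c x) e v |> fun h => by
      have e1 : ∀ v w, (hessForm c hf x + (2 * f x / n) • ricciForm c x) v w =
          c.hess f x v w + 2 * f x * c.schouten x v w := by
        intro v w
        rw [schouten_eq]
        simp [hessForm]
        ring
      simp only [e1] at h
      exact h

/-! ### Densities -/

theorem Density.val_eq {w : ℝ} (σ : Density n N w) (e e' : Frame n x) :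
    σ.val x e' = |e.det e'| ^ (-w / ((n : ℝ) + 2)) * σ.val x e := by
  have h := σ.equivariant x e (e.equiv e' (Equiv.refl _))
  have h1 : (fun i => e.equiv e' (Equiv.refl _) (e i)) = e' := by
    funext i; simp
  have h2 : LinearMap.det ((e.equiv e' (Equiv.refl _) : Tan n x ≃ₗ[ℝ] Tan n x) :
      Tan n x →ₗ[ℝ] Tan n x) = e.det e' := by
    have := e.det_comp ((e.equiv e' (Equiv.refl _) : Tan n x ≃ₗ[ℝ] Tan n x) :
      Tan n x →ₗ[ℝ] Tan n x) e
    rw [e.det_self, mul_one] at this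
    rw [← this]
    congr 1
  rw [h1, h2] at h
  exact h

theorem exists_det_coeff {x₀ : N} (hx : x ∈ frameDomain n x₀)
    {V : Fin (n + 1) → ∀ y : N, Tan n y} (hV : ∀ i, SmoothAt (V i) x) : ∃ a : N → ℝ,
    ContMDiffAt (𝓡 (n + 1)) 𝓘(ℝ, ℝ) ∞ a x ∧
      ∀ y, ∀ hy : y ∈ frameDomain n x₀, a y = (locBasis x₀ hy).det (fun i => V i y) := by
  choose a ha ha' using fun j i => exists_coeff hx (hV j) i
  refine ⟨fun y => (Matrix.of fun i j => a j i y).det, ?_, fun y hy => ?_⟩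
  · simp only [Matrix.det_apply']
    refine contMDiffAt_finsetSum fun σ _ => contMDiffAt_const.mul ?_
    exact contMDiffAt_finsetProd fun i _ => ha _ _
  · rw [Basis.det_apply]
    refine congrArg Matrix.det ?_
    ext i j
    simp [Basis.toMatrix_apply, ha' j i y hy]

/-- The component of a density with respect to a smooth frame field is smooth. -/
theorem Density.contMDiffAt {w : ℝ} (σ : Density n N w) {V : Fin (n + 1) → ∀ y : N, Tan n y}
    (hV : ∀ i, SmoothAt (V i) x) (hb : ∀ᶠ y in 𝓝 x, ∃ e : Frame n y, ∀ i, e i = V i y) :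
    ContMDiffAt (𝓡 (n + 1)) 𝓘(ℝ, ℝ) ∞ (fun y => σ.val y (fun i => V i y)) x := by
  have hx := mem_frameDomain (n := n) x
  set e := stdFrame n x
  obtain ⟨a, ha, ha'⟩ := exists_det_coeff hx hV
  obtain ⟨b, hb', hb''⟩ := exists_det_coeff hx (V := fun i => ext (e i))
    (fun i => (ext_smoothNear _).smoothAt)
  have ha0 : a x ≠ 0 := by
    obtain ⟨e, he⟩ := hb.self_of_nhds
    rw [ha' x hx, ← funext he]
    exact ((locBasis x hx).isUnit_det e).ne_zero
  have hb0 : b x ≠ 0 := by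
    rw [hb'' x hx]
    simp only [ext_self]
    exact ((locBasis x hx).isUnit_det e).ne_zero
  -- The component in the frame `V` is that in the extended frame times a power of the absolute
  -- value of the transition determinant `a / b`, smooth because that determinant is non-zero.
  have hab : ContMDiffAt (𝓡 (n + 1)) 𝓘(ℝ, ℝ) ∞
      (fun y => |a y / b y| ^ (-w / ((n : ℝ) + 2)) * σ.val y (fun i => ext (e i) y)) x := by
    refine ContMDiffAt.mul ?_ (σ.smooth x e)
    have h1 : ContMDiffAt (𝓡 (n + 1)) 𝓘(ℝ, ℝ) ∞ (fun y => a y / b y) x := ha.div₀ hb' hb0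
    have h2 : ContDiffAt ℝ ∞ (fun t : ℝ => |t| ^ (-w / ((n : ℝ) + 2))) (a x / b x) :=
      (contDiffAt_abs (div_ne_zero ha0 hb0)).rpow_const_of_ne
        (abs_ne_zero.2 (div_ne_zero ha0 hb0))
    exact h2.contMDiffAt.comp (f := fun y => a y / b y) x h1
  refine hab.congr_of_eventuallyEq ?_
  filter_upwards [hb, exists_basis_ext (n := n) x, (isOpen_frameDomain x).mem_nhds hx] with y h1 h2 hy
  obtain ⟨e₁, he₁⟩ := h1
  obtain ⟨e₂, he₂⟩ := h2 e
  rw [← funext he₁, ← funext he₂, σ.val_eq e₂ e₁, ha' y hy, hb'' y hy, ← funext he₁,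
    ← funext he₂]
  congr 3
  rw [eq_div_iff ((locBasis x hy).isUnit_det e₂).ne_zero]
  simp only [Basis.det_apply]
  rw [mul_comm, ← Matrix.det_mul, Basis.toMatrix_mul_toMatrix]

theorem Density.contMDiffAt_locFrame {w : ℝ} (σ : Density n N w) {x₀ : N}
    (hx : x ∈ frameDomain n x₀) : ContMDiffAt (𝓡 (n + 1)) 𝓘(ℝ, ℝ) ∞
      (fun y => σ.val y (fun i => locFrame x₀ i y)) x := by
  refine σ.contMDiffAt (fun i => smoothAt_locFrame hx i) ?_
  filter_upwards [(isOpen_frameDomain x₀).mem_nhds hx] with y hy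
  exact ⟨locBasis x₀ hy, locBasis_apply hy⟩

/-! ### The Monge–Ampère operator on functions -/

/-- The function representing `det (D_I D_J ρ)`, for `ρ` represented by `f` in the scale `τ`. -/
noncomputable def mongeAmpere (c : AffineConnection n N) (τ : Density n N 1) (f : N → ℝ) (x : N) :
    ℝ :=
  (hessMatrix c f x (stdFrame n x)).det * τ.val x (stdFrame n x) ^ (2 * (n + 2))

/-- A change of frame with determinant `d` multiplies the bordered determinant by `d ^ 2` and the
value of `τ` by `|d| ^ (-1 / (n + 2))`. The exponent `2 * (n + 2)` is chosen so that these cancel,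
and in a unimodular frame the factor is `1`. -/
theorem mongeAmpere_eq [T2Space N] (τ : Density n N 1) {f : N → ℝ} (hf : Smooth n f)
    (e : Frame n x) :
    mongeAmpere c τ f x = (hessMatrix c f x e).det * τ.val x e ^ (2 * (n + 2)) := by
  rw [mongeAmpere, det_hessMatrix_change hf (stdFrame n x) e, τ.val_eq (stdFrame n x) e]
  set d := (stdFrame n x).det e
  have hd : d ≠ 0 := ((stdFrame n x).isUnit_det e).ne_zero
  have hd' : (0 : ℝ) < |d| := abs_pos.2 hd
  have h1 : (|d| ^ (-1 / ((n : ℝ) + 2))) ^ (2 * (n + 2)) = (d ^ 2)⁻¹ := by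
    rw [← Real.rpow_natCast, ← Real.rpow_mul hd'.le]
    have : -1 / ((n : ℝ) + 2) * ((2 * (n + 2) : ℕ) : ℝ) = ((-2 : ℤ) : ℝ) := by
      push_cast
      field_simp
    rw [this, Real.rpow_intCast, zpow_neg]
    norm_cast
    rw [sq_abs]
  rw [mul_pow, h1]
  field_simp

end

/-! ### Expansion of the Monge–Ampère operator under perturbations. -/

section
variable {n : ℕ} {N : Type*} [TopologicalSpace N]
  [ChartedSpace (EuclideanSpace ℝ (Fin (n + 1))) N] [IsManifold (𝓡 (n + 1)) ∞ N]

variable {c : AffineConnection n N} {x : N}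

theorem diff_pow {f : N → ℝ} (hf : Smooth n f) (m : ℕ) (u : Tan n x) :
    diff (n := n) (fun y => f y ^ (m + 1)) x u = (m + 1) * f x ^ m * diff (n := n) f x u := by
  have := diff_comp (n := n) (f := f) (x := x) (h := fun t => t ^ (m + 1)) (by fun_prop)
    (contMDiff_mdiff hf x) u
  rw [this]
  simp

theorem hess_pow {f : N → ℝ} (hf : Smooth n f) (m : ℕ) (u v : Tan n x) :
    c.hess (fun y => f y ^ (m + 2)) x u v = (m + 2) * f x ^ (m + 1) * c.hess f x u v +
      (m + 2) * (m + 1) * f x ^ m * (diff (n := n) f x u * diff (n := n) f x v) := by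
  induction m with
  | zero =>
    have h : (fun y => f y ^ (0 + 2)) = fun y => f y * f y := by funext y; ring
    rw [h, hess_mul hf hf]
    push_cast
    ring
  | succ m ih =>
    have h : (fun y => f y ^ (m + 1 + 2)) = fun y => f y * f y ^ (m + 2) := by funext y; ring
    rw [h, hess_mul hf (hf.pow (m + 2)), ih, diff_pow hf (m + 1), diff_pow hf (m + 1)]
    push_cast
    ring

variable [T2Space N]

theorem schouten_smooth {V W : ∀ y : N, Tan n y} (hV : SmoothNear V x) (hW : SmoothNear W x) :
    ContMDiffAt (𝓡 (n + 1)) 𝓘(ℝ, ℝ) ∞ (fun y => c.schouten y (V y) (W y)) x :=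
  (ricci_smooth hV hW).div_const _

/-- The functions smooth on a set, as a ring. -/
def smoothOnRing (n : ℕ) {N : Type*} [TopologicalSpace N]
    [ChartedSpace (EuclideanSpace ℝ (Fin (n + 1))) N] (U : Set N) : Subring (N → ℝ) where
  carrier := {g | ContMDiffOn (𝓡 (n + 1)) 𝓘(ℝ, ℝ) ∞ g U}
  mul_mem' ha hb := ContMDiffOn.mul ha hb
  add_mem' ha hb := ContMDiffOn.add ha hb
  one_mem' := contMDiffOn_const
  zero_mem' := contMDiffOn_const
  neg_mem' ha := ContMDiffOn.neg ha

theorem mem_smoothOnRing_locFrame (c : AffineConnection n N) {f : N → ℝ} (hf : Smooth n f)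
    (x₀ : N) :
    (∀ i, (fun y => diff (n := n) f y (locFrame x₀ i y)) ∈ smoothOnRing n (frameDomain n x₀)) ∧
    (∀ i j, (fun y => c.hess f y (locFrame x₀ i y) (locFrame x₀ j y)) ∈
      smoothOnRing n (frameDomain n x₀)) ∧
    (∀ i j, (fun y => c.schouten y (locFrame x₀ i y) (locFrame x₀ j y)) ∈
      smoothOnRing n (frameDomain n x₀)) :=
  ⟨fun i y hy => (contMDiffAt_diff (hf y) (smoothAt_locFrame hy i)).contMDiffWithinAt,
    fun i j _ hy => (hess_smooth hf (smoothAt_locFrame hy i)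
      (smoothNear_locFrame hy j)).contMDiffWithinAt,
    fun i j _ hy => (schouten_smooth (smoothNear_locFrame hy i)
      (smoothNear_locFrame hy j)).contMDiffWithinAt⟩

/-- The Hessian matrix with respect to a coordinate frame, as a matrix of smooth functions. -/
noncomputable def hessMatrixRing (c : AffineConnection n N) {f : N → ℝ} (hf : Smooth n f) (x₀ : N) :
    Matrix (Unit ⊕ Fin (n + 1)) (Unit ⊕ Fin (n + 1)) (smoothOnRing n (frameDomain n x₀)) :=
  Matrix.of fun i j => ⟨fun y => hessMatrix c f y (fun i => locFrame x₀ i y) i j, by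
    obtain ⟨h1, h2, h3⟩ := mem_smoothOnRing_locFrame c hf x₀
    have hf' : f ∈ smoothOnRing n (frameDomain n x₀) := hf.contMDiffOn
    have h2' : (fun _ => (2 : ℝ)) ∈ smoothOnRing n (frameDomain n x₀) := contMDiffOn_const
    rcases i with i | i <;> rcases j with j | j
    · exact mul_mem h2' hf'
    · exact h1 j
    · exact h1 i
    · exact add_mem (h2 i j) (mul_mem (mul_mem h2' hf') (h3 i j))⟩

/-- Evaluation at a point. -/
def evalRing {S : Subring (N → ℝ)} (y : N) : S →+* ℝ := (Pi.evalRingHom (fun _ => ℝ) y).comp S.subtype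

theorem mapMatrix_hessMatrixRing {f : N → ℝ} (hf : Smooth n f) (x₀ y : N) :
    (evalRing y).mapMatrix (hessMatrixRing c hf x₀) = hessMatrix c f y (fun i => locFrame x₀ i y) :=
  rfl

theorem mongeAmpere_eq_locFrame {τ : Density n N 1} {f : N → ℝ} (hf : Smooth n f) {x₀ y : N}
    (hy : y ∈ frameDomain n x₀) : mongeAmpere c τ f y = evalRing y (hessMatrixRing c hf x₀).det *
      τ.val y (fun i => locFrame x₀ i y) ^ (2 * (n + 2)) := by
  rw [mongeAmpere_eq τ hf (locBasis x₀ hy), RingHom.map_det, mapMatrix_hessMatrixRing,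
    funext (locBasis_apply hy)]

theorem SmoothFunNear.of_ring {x₀ : N} (g : smoothOnRing n (frameDomain n x₀)) :
    SmoothFunNear n (fun y => evalRing y g) x₀ := by
  filter_upwards [(isOpen_frameDomain x₀).mem_nhds (mem_frameDomain (n := n) x₀)] with y hy
  exact ContMDiffOn.contMDiffAt (s := frameDomain n x₀) g.2 ((isOpen_frameDomain x₀).mem_nhds hy)

theorem smoothFunNear_density {w : ℝ} (σ : Density n N w) (x₀ : N) :
    SmoothFunNear n (fun y => σ.val y (fun i => locFrame x₀ i y)) x₀ := by
  filter_upwards [(isOpen_frameDomain x₀).mem_nhds (mem_frameDomain (n := n) x₀)] with y hy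
  exact σ.contMDiffAt_locFrame hy

theorem SmoothFunNear.mul {f g : N → ℝ} (hf : SmoothFunNear n f x) (hg : SmoothFunNear n g x) :
    SmoothFunNear n (fun y => f y * g y) x := by
  filter_upwards [hf, hg] with y h1 h2 using ContMDiffAt.mul h1 h2

theorem SmoothFunNear.pow {f : N → ℝ} (hf : SmoothFunNear n f x) (k : ℕ) :
    SmoothFunNear n (fun y => f y ^ k) x := by
  filter_upwards [hf] with y h1 using ContMDiffAt.pow h1 k

theorem mongeAmpere_smooth (c : AffineConnection n N) (τ : Density n N 1) {f : N → ℝ}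
    (hf : Smooth n f) : Smooth n (mongeAmpere c τ f) := by
  intro x₀
  refine (((SmoothFunNear.of_ring (hessMatrixRing c hf x₀).det).mul
    ((smoothFunNear_density τ x₀).pow (2 * (n + 2)))).self_of_nhds).congr_of_eventuallyEq ?_
  filter_upwards [(isOpen_frameDomain x₀).mem_nhds (mem_frameDomain (n := n) x₀)] with y hy
  exact mongeAmpere_eq_locFrame hf hy

variable [SecondCountableTopology N]

/-- In the application `R` consists of smooth functions and `π` is evaluation at a point. A single
`q` serves all `π`, which makes the remainder a smooth function. The letters `b`, `β` stand for the
first derivatives of `f`, `φ`, and `Q`, `θ` for their Hessians. -/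
theorem det_bordered_perturbation {R : Type*} [CommRing R] {ι : Type*} [Fintype ι] [DecidableEq ι]
    (f φ : R) (b β : ι → R) (Q P θ : ι → ι → R) (m : ℕ) : ∃ q : R, ∀ π : R →+* ℝ,
    (Matrix.fromBlocks (Matrix.of fun _ _ : Unit => 2 * (π f + π φ * π f ^ (m + 2)))
      (Matrix.of fun _ j => π (b j) + (π φ * ((m + 2) * π f ^ (m + 1) * π (b j)) +
        π f ^ (m + 2) * π (β j)))
      (Matrix.of fun i _ => π (b i) + (π φ * ((m + 2) * π f ^ (m + 1) * π (b i)) +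
        π f ^ (m + 2) * π (β i)))
      (Matrix.of fun i j => π (Q i j) + (π φ * ((m + 2) * π f ^ (m + 1) * π (Q i j) +
        (m + 2) * (m + 1) * π f ^ m * (π (b i) * π (b j))) + π f ^ (m + 2) * π (θ i j) +
        π (β i) * ((m + 2) * π f ^ (m + 1) * π (b j)) +
        (m + 2) * π f ^ (m + 1) * π (b i) * π (β j)) +
        2 * (π f + π φ * π f ^ (m + 2)) * π (P i j))).det =
    (Matrix.fromBlocks (Matrix.of fun _ _ : Unit => 2 * π f) (Matrix.of fun _ j => π (b j))
      (Matrix.of fun i _ => π (b i))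
      (Matrix.of fun i j => π (Q i j) + 2 * π f * π (P i j))).det *
      (1 + (m + 2) * (Fintype.card ι - 1 - 2 * m) * π φ * π f ^ (m + 1)) +
      π q * π f ^ (m + 2) := by
  let H : Matrix (Unit ⊕ ι) (Unit ⊕ ι) R :=
    Matrix.fromBlocks (Matrix.of fun _ _ : Unit => 2 * f) (Matrix.of fun _ j => b j)
      (Matrix.of fun i _ => b i) (Matrix.of fun i j => Q i j + 2 * f * P i j)
  -- The term `a • vecMulVec` produces the wanted multiple of `b i * b j`, but since the corner of
  -- `H` is `2 * f` it also adds `2 * a * f * b j` to the border; the entry of `w` at the corner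
  -- index cancels this. The traces then combine to `(m+2) * ((card ι + 1) - 4 * (m+1) + 2 * (m+1))
  -- = (m+2) * (card ι - 1 - 2 * m)`.
  let w : Unit ⊕ ι → R := Sum.elim (fun _ => -2 * (m + 1) * φ) β
  -- The leftover terms, all of which carry the factor `f ^ (m + 2)` and only enter the remainder.
  let M : Matrix (Unit ⊕ ι) (Unit ⊕ ι) R :=
    Matrix.fromBlocks
      (Matrix.of fun _ _ => 2 * φ - 4 * (m + 2) * (m + 1) * φ - 2 * (m + 2) * φ +
        8 * (m + 2) * (m + 1) * φ)
      (Matrix.of fun _ j => (1 - 2 * (m + 2)) * β j)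
      (Matrix.of fun i _ => (1 - 2 * (m + 2)) * β i)
      (Matrix.of fun i j => θ i j + (2 * φ - 2 * (m + 2) * φ) * P i j)
  obtain ⟨q, hq⟩ := det_rank_two_perturbation H M (Sum.inl ()) (f := f) (t := f ^ (m + 1))
    (a := (m + 2) * (m + 1) * φ * f ^ m) (β := (m + 2) * φ) (γ := m + 2) w rfl
    ⟨f ^ m, pow_succ' f m⟩
  refine ⟨q, fun π => ?_⟩
  have h := congrArg π hq
  rw [map_add, map_mul, RingHom.map_det, RingHom.map_det] at h
  convert h using 1
  · refine congrArg Matrix.det ?_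
    ext (i | i) (j | j) <;>
    · simp only [RingHom.mapMatrix_apply, Matrix.map_apply, Matrix.add_apply, Matrix.smul_apply,
        Matrix.vecMulVec_apply, smul_eq_mul, map_add, map_mul, map_pow, map_natCast,
        H, w, M, Sum.elim_inl, Sum.elim_inr, Matrix.fromBlocks_apply₁₁, Matrix.fromBlocks_apply₁₂,
        Matrix.fromBlocks_apply₂₁, Matrix.fromBlocks_apply₂₂, Matrix.of_apply, map_sub,
        map_neg, map_one, map_ofNat]
      ring
  · have e : π.mapMatrix H = Matrix.fromBlocks (Matrix.of fun _ _ : Unit => 2 * π f)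
        (Matrix.of fun _ j => π (b j)) (Matrix.of fun i _ => π (b i))
        (Matrix.of fun i j => π (Q i j) + 2 * π f * π (P i j)) := by
      ext (i | i) (j | j) <;> simp [H, map_ofNat]
    rw [e]
    simp only [map_add, map_mul, map_one, map_pow, map_natCast, map_ofNat, w, Sum.elim_inl,
      map_neg, Fintype.card_sum, Fintype.card_unit, Nat.cast_add, Nat.cast_one]
    ring

/-- The first variation of the Monge–Ampère operator under a perturbation of order at least 2. -/
theorem mongeAmpere_add_mul_pow (c : AffineConnection n N) (τ : Density n N 1) {f φ : N → ℝ}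
    (hf : Smooth n f) (hφ : Smooth n φ) (m : ℕ) :
    ∃ q : N → ℝ, Smooth n q ∧ ∀ x, mongeAmpere c τ (fun y => f y + φ y * f y ^ (m + 2)) x =
      mongeAmpere c τ f x * (1 + (m + 2) * (n - 2 * m) * φ x * f x ^ (m + 1)) +
        q x * f x ^ (m + 2) := by
  have hF : Smooth n (fun y => f y + φ y * f y ^ (m + 2)) := hf.add (hφ.mul (hf.pow _))
  obtain ⟨q, hq, hq'⟩ := exists_smooth_quotient (n := n) (f := fun x => f x ^ (m + 2))
    (g := fun x => mongeAmpere c τ (fun y => f y + φ y * f y ^ (m + 2)) x -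
      mongeAmpere c τ f x * (1 + (m + 2) * (n - 2 * m) * φ x * f x ^ (m + 1))) fun x₀ => by
    obtain ⟨h1, h2, h3⟩ := mem_smoothOnRing_locFrame c hφ x₀
    obtain ⟨k1, k2, -⟩ := mem_smoothOnRing_locFrame c hf x₀
    obtain ⟨q, hq⟩ := det_bordered_perturbation
      (R := smoothOnRing n (frameDomain n x₀)) ⟨f, hf.contMDiffOn⟩ ⟨φ, hφ.contMDiffOn⟩
      (fun j => ⟨_, k1 j⟩) (fun j => ⟨_, h1 j⟩) (fun i j => ⟨_, k2 i j⟩) (fun i j => ⟨_, h3 i j⟩)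
      (fun i j => ⟨_, h2 i j⟩) m
    refine ⟨fun y => evalRing y q * τ.val y (fun i => locFrame x₀ i y) ^ (2 * (n + 2)),
      (SmoothFunNear.of_ring q).mul ((smoothFunNear_density τ x₀).pow _), ?_⟩
    filter_upwards [(isOpen_frameDomain x₀).mem_nhds (mem_frameDomain (n := n) x₀)] with y hy
    have hd : ∀ u : Tan n y, diff (n := n) (fun y => f y + φ y * f y ^ (m + 2)) y u =
        diff (n := n) f y u + (φ y * ((m + 2) * f y ^ (m + 1) * diff (n := n) f y u) +
          f y ^ (m + 2) * diff (n := n) φ y u) := by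
      intro u
      rw [diff_add (g := fun y => φ y * f y ^ (m + 2)) (contMDiff_mdiff hf y)
        (contMDiff_mdiff (hφ.mul (hf.pow _)) y),
        diff_mul (g := fun y => f y ^ (m + 2)) (contMDiff_mdiff hφ y)
          (contMDiff_mdiff (hf.pow _) y), diff_pow hf (m + 1)]
      push_cast
      ring
    have hh : ∀ u v : Tan n y, c.hess (fun y => f y + φ y * f y ^ (m + 2)) y u v =
        c.hess f y u v + (φ y * ((m + 2) * f y ^ (m + 1) * c.hess f y u v +
          (m + 2) * (m + 1) * f y ^ m * (diff (n := n) f y u * diff (n := n) f y v)) +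
          f y ^ (m + 2) * c.hess φ y u v +
          diff (n := n) φ y u * ((m + 2) * f y ^ (m + 1) * diff (n := n) f y v) +
          (m + 2) * f y ^ (m + 1) * diff (n := n) f y u * diff (n := n) φ y v) := by
      intro u v
      rw [hess_add hf (g := fun y => φ y * f y ^ (m + 2)) (hφ.mul (hf.pow _)),
        hess_mul hφ (g := fun y => f y ^ (m + 2)) (hf.pow _), hess_pow hf,
        diff_pow hf (m + 1), diff_pow hf (m + 1)]
      push_cast
      ring
    have e1 := hq (evalRing y)
    have e2 : (hessMatrix c (fun y => f y + φ y * f y ^ (m + 2)) y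
        (fun i => locFrame x₀ i y)).det = (hessMatrix c f y (fun i => locFrame x₀ i y)).det *
        (1 + (m + 2) * (Fintype.card (Fin (n + 1)) - 1 - 2 * m) * φ y * f y ^ (m + 1)) +
        evalRing y q * f y ^ (m + 2) := by
      refine Eq.trans (congrArg Matrix.det ?_) e1
      simp only [hessMatrix, hd, hh]
      rfl
    rw [mongeAmpere_eq τ hF (locBasis x₀ hy), mongeAmpere_eq τ hf (locBasis x₀ hy),
      funext (locBasis_apply hy), e2, Fintype.card_fin]
    push_cast
    ring
  exact ⟨q, hq, fun x => by linear_combination hq' x⟩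

/-- The crude effect of a perturbation on the Monge–Ampère operator. -/
theorem mongeAmpere_add_mul_pow_crude (c : AffineConnection n N) (τ : Density n N 1)
    {f φ r : N → ℝ} (hf : Smooth n f) (hφ : Smooth n φ) (hr : Smooth n r) (m : ℕ) :
    ∃ q : N → ℝ, Smooth n q ∧ ∀ x, mongeAmpere c τ (fun y => f y + φ y * r y ^ (m + 2)) x =
      mongeAmpere c τ f x + q x * r x ^ m := by
  have hF : Smooth n (fun y => f y + φ y * r y ^ (m + 2)) := hf.add (hφ.mul (hr.pow _))
  obtain ⟨q, hq, hq'⟩ := exists_smooth_quotient (n := n) (f := fun x => r x ^ m)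
    (g := fun x => mongeAmpere c τ (fun y => f y + φ y * r y ^ (m + 2)) x -
      mongeAmpere c τ f x) fun x₀ => by
    obtain ⟨h1, h2, h3⟩ := mem_smoothOnRing_locFrame c hφ x₀
    obtain ⟨k1, k2, -⟩ := mem_smoothOnRing_locFrame c hr x₀
    let S := smoothOnRing n (frameDomain n x₀)
    let rS : S := ⟨r, hr.contMDiffOn⟩
    let φS : S := ⟨φ, hφ.contMDiffOn⟩
    -- Two derivatives lower the order in `r` by at most two, so every entry changes by a smooth
    -- multiple of `r ^ m`.
    have hS : ∀ i j, ∃ s : S, ∀ y, hessMatrix c (fun y => f y + φ y * r y ^ (m + 2)) y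
        (fun i => locFrame x₀ i y) i j = hessMatrix c f y (fun i => locFrame x₀ i y) i j +
        r y ^ m * evalRing y s := by
      have hd : ∀ y, ∀ u : Tan n y, diff (n := n) (fun y => f y + φ y * r y ^ (m + 2)) y u =
          diff (n := n) f y u + (φ y * ((m + 2) * r y ^ (m + 1) * diff (n := n) r y u) +
            r y ^ (m + 2) * diff (n := n) φ y u) := by
        intro y u
        rw [diff_add (g := fun y => φ y * r y ^ (m + 2)) (contMDiff_mdiff hf y)
          (contMDiff_mdiff (hφ.mul (hr.pow _)) y),
          diff_mul (g := fun y => r y ^ (m + 2)) (contMDiff_mdiff hφ y)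
            (contMDiff_mdiff (hr.pow _) y), diff_pow hr (m + 1)]
        push_cast
        ring
      have hh : ∀ y, ∀ u v : Tan n y, c.hess (fun y => f y + φ y * r y ^ (m + 2)) y u v =
          c.hess f y u v + (φ y * ((m + 2) * r y ^ (m + 1) * c.hess r y u v +
            (m + 2) * (m + 1) * r y ^ m * (diff (n := n) r y u * diff (n := n) r y v)) +
            r y ^ (m + 2) * c.hess φ y u v +
            diff (n := n) φ y u * ((m + 2) * r y ^ (m + 1) * diff (n := n) r y v) +
            (m + 2) * r y ^ (m + 1) * diff (n := n) r y u * diff (n := n) φ y v) := by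
        intro y u v
        rw [hess_add hf (g := fun y => φ y * r y ^ (m + 2)) (hφ.mul (hr.pow _)),
          hess_mul hφ (g := fun y => r y ^ (m + 2)) (hr.pow _), hess_pow hr,
          diff_pow hr (m + 1), diff_pow hr (m + 1)]
        push_cast
        ring
      have hcon : ∀ a : ℝ, (fun _ => a) ∈ S := fun a => contMDiffOn_const
      have hr' : r ∈ S := rS.2
      have hφ' : φ ∈ S := φS.2
      rintro (i | i) (j | j)
      · refine ⟨⟨fun y => 2 * (φ y * (r y * r y)),
          mul_mem (hcon 2) (mul_mem hφ' (mul_mem hr' hr'))⟩, fun y => ?_⟩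
        change 2 * (f y + φ y * r y ^ (m + 2)) = 2 * f y + r y ^ m * (2 * (φ y * (r y * r y)))
        ring
      · refine ⟨⟨fun y => φ y * ((m + 2) * (r y * diff (n := n) r y (locFrame x₀ j y))) +
          r y * (r y * diff (n := n) φ y (locFrame x₀ j y)),
          add_mem (mul_mem hφ' (mul_mem (hcon _) (mul_mem hr' (k1 j))))
            (mul_mem hr' (mul_mem hr' (h1 j)))⟩, fun y => ?_⟩
        refine (hd y _).trans ?_
        change _ = diff (n := n) f y _ + r y ^ m * (φ y * ((m + 2) * (r y * diff (n := n) r y (locFrame x₀ j y))) +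
          r y * (r y * diff (n := n) φ y (locFrame x₀ j y)))
        ring
      · refine ⟨⟨fun y => φ y * ((m + 2) * (r y * diff (n := n) r y (locFrame x₀ i y))) +
          r y * (r y * diff (n := n) φ y (locFrame x₀ i y)),
          add_mem (mul_mem hφ' (mul_mem (hcon _) (mul_mem hr' (k1 i))))
            (mul_mem hr' (mul_mem hr' (h1 i)))⟩, fun y => ?_⟩
        refine (hd y _).trans ?_
        change _ = diff (n := n) f y _ + r y ^ m * (φ y * ((m + 2) * (r y * diff (n := n) r y (locFrame x₀ i y))) +
          r y * (r y * diff (n := n) φ y (locFrame x₀ i y)))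
        ring
      · refine ⟨⟨fun y => φ y * ((m + 2) * (r y * c.hess r y (locFrame x₀ i y) (locFrame x₀ j y)) +
            (m + 2) * (m + 1) * (diff (n := n) r y (locFrame x₀ i y) *
              diff (n := n) r y (locFrame x₀ j y))) +
            r y * (r y * c.hess φ y (locFrame x₀ i y) (locFrame x₀ j y)) +
            diff (n := n) φ y (locFrame x₀ i y) * ((m + 2) * (r y *
              diff (n := n) r y (locFrame x₀ j y))) +
            diff (n := n) φ y (locFrame x₀ j y) * ((m + 2) * (r y *
              diff (n := n) r y (locFrame x₀ i y))) +
            2 * (φ y * (r y * (r y * c.schouten y (locFrame x₀ i y) (locFrame x₀ j y)))),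
          add_mem (add_mem (add_mem (add_mem (mul_mem hφ' (add_mem (mul_mem (hcon _)
            (mul_mem hr' (k2 i j))) (mul_mem (hcon _) (mul_mem (k1 i) (k1 j)))))
            (mul_mem hr' (mul_mem hr' (h2 i j))))
            (mul_mem (h1 i) (mul_mem (hcon _) (mul_mem hr' (k1 j)))))
            (mul_mem (h1 j) (mul_mem (hcon _) (mul_mem hr' (k1 i)))))
            (mul_mem (hcon 2) (mul_mem hφ' (mul_mem hr' (mul_mem hr' (h3 i j)))))⟩, fun y => ?_⟩
        refine (congrArg (· + _) (hh y _ _)).trans ?_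
        change _ = c.hess f y _ _ + 2 * f y * c.schouten y _ _ + r y ^ m * (φ y * ((m + 2) * (r y * c.hess r y (locFrame x₀ i y) (locFrame x₀ j y)) +
            (m + 2) * (m + 1) * (diff (n := n) r y (locFrame x₀ i y) *
              diff (n := n) r y (locFrame x₀ j y))) +
            r y * (r y * c.hess φ y (locFrame x₀ i y) (locFrame x₀ j y)) +
            diff (n := n) φ y (locFrame x₀ i y) * ((m + 2) * (r y *
              diff (n := n) r y (locFrame x₀ j y))) +
            diff (n := n) φ y (locFrame x₀ j y) * ((m + 2) * (r y *
              diff (n := n) r y (locFrame x₀ i y))) +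
            2 * (φ y * (r y * (r y * c.schouten y (locFrame x₀ i y) (locFrame x₀ j y)))))
        ring
    choose s hs using hS
    obtain ⟨q, hq⟩ := det_add_smul_perturbation (hessMatrixRing c hf x₀) (Matrix.of s) (rS ^ m)
    refine ⟨fun y => evalRing y q * τ.val y (fun i => locFrame x₀ i y) ^ (2 * (n + 2)),
      (SmoothFunNear.of_ring q).mul ((smoothFunNear_density τ x₀).pow _), ?_⟩
    filter_upwards [(isOpen_frameDomain x₀).mem_nhds (mem_frameDomain (n := n) x₀)] with y hy
    have e1 := congrArg (evalRing y) hq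
    rw [map_add, RingHom.map_det, RingHom.map_det, mapMatrix_hessMatrixRing, map_mul, map_pow] at e1
    have e2 : (evalRing y).mapMatrix (hessMatrixRing c hf x₀ + rS ^ m • Matrix.of s) =
        hessMatrix c (fun y => f y + φ y * r y ^ (m + 2)) y (fun i => locFrame x₀ i y) := by
      ext i j
      rw [hs]
      simp only [RingHom.mapMatrix_apply, Matrix.map_apply, Matrix.add_apply, Matrix.smul_apply,
        smul_eq_mul, map_add, map_mul, map_pow, Matrix.of_apply]
      rfl
    rw [e2] at e1
    rw [mongeAmpere_eq τ hF (locBasis x₀ hy), mongeAmpere_eq τ hf (locBasis x₀ hy),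
      funext (locBasis_apply hy), e1]
    have : evalRing y rS = r y := rfl
    rw [this]
    ring
  exact ⟨q, hq, fun x => by linear_combination hq' x⟩

end

/-! ### Covariant derivatives of densities -/

section
variable {n : ℕ} {N : Type*} [TopologicalSpace N]
  [ChartedSpace (EuclideanSpace ℝ (Fin (n + 1))) N] [IsManifold (𝓡 (n + 1)) ∞ N]

variable {x : N}

/-- The components of a smooth vector field with respect to the extension of a frame. -/
theorem exists_coeff_ext (e : Frame n x) {V : ∀ y : N, Tan n y} (hV : SmoothNear V x) :
    ∃ a : Fin (n + 1) → N → ℝ, (∀ i, SmoothFunNear n (a i) x) ∧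
      ∀ᶠ y in 𝓝 x, V y = ∑ i, a i y • ext (e i) y := by
  have hx := mem_frameDomain (n := n) x
  set t := trivializationAt (EuclideanSpace ℝ (Fin (n + 1)))
    (fun z : N => TangentSpace (𝓡 (n + 1)) z) x
  -- The frame `e` read in the trivialization; its local frame is then the frame of extensions `ext
  -- (e i)`.
  let b : Basis (Fin (n + 1)) ℝ (EuclideanSpace ℝ (Fin (n + 1))) :=
    e.map (t.linearEquivAt (R := ℝ) x hx)
  refine ⟨fun i z => t.localFrameCoeff (𝓡 (n + 1)) b i z (V z), fun i => ?_, ?_⟩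
  · filter_upwards [hV, (isOpen_frameDomain x).mem_nhds hx] with y hy hy'
    exact contMDiffAt_localFrameCoeff b hy' hy i
  · filter_upwards [(isOpen_frameDomain x).mem_nhds hx] with y hy
    have := Bundle.Trivialization.eq_sum_localFrameCoeff_smul (I := 𝓡 (n + 1))
      (b := b) (s := V) hy
    refine this.trans (Finset.sum_congr rfl fun i _ => congrArg _ ?_)
    rw [Bundle.Trivialization.localFrame_apply_of_mem_baseSet _ _ hy, ext_eq]
    change t.symm y (t.linearEquivAt (R := ℝ) x hx (e i)) = t.symm y (t.continuousLinearMapAt ℝ x (e i))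
    have hx' : x ∈ t.baseSet := hx
    rw [Bundle.Trivialization.continuousLinearMapAt_apply,
      Bundle.Trivialization.linearMapAt_apply, if_pos hx']
    rfl

theorem mdiff_sum {ι : Type*} (s : Finset ι) {f : ι → N → ℝ}
    (hf : ∀ i ∈ s, MDifferentiableAt (𝓡 (n + 1)) 𝓘(ℝ, ℝ) (f i) x) :
    MDifferentiableAt (𝓡 (n + 1)) 𝓘(ℝ, ℝ) (fun y => ∑ i ∈ s, f i y) x ∧ ∀ u : Tan n x,
    diff (n := n) (fun y => ∑ i ∈ s, f i y) x u = ∑ i ∈ s, diff (n := n) (f i) x u := by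
  classical
  induction s using Finset.induction_on with
  | empty => exact ⟨by simpa using mdifferentiableAt_const, fun u => by simp [diff_const]⟩
  | insert a s ha ih =>
    obtain ⟨h1, h2⟩ := ih fun i hi => hf i (Finset.mem_insert_of_mem hi)
    have h3 := hf a (Finset.mem_insert_self _ _)
    simp only [Finset.sum_insert ha]
    exact ⟨h3.add h1, fun u => by rw [diff_add h3 h1, h2]⟩

theorem mdiff_prod {ι : Type*} [DecidableEq ι] (s : Finset ι) {f : ι → N → ℝ}
    (hf : ∀ i ∈ s, MDifferentiableAt (𝓡 (n + 1)) 𝓘(ℝ, ℝ) (f i) x) :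
    MDifferentiableAt (𝓡 (n + 1)) 𝓘(ℝ, ℝ) (fun y => ∏ i ∈ s, f i y) x ∧ ∀ u : Tan n x,
    diff (n := n) (fun y => ∏ i ∈ s, f i y) x u =
      ∑ i ∈ s, (∏ j ∈ s.erase i, f j x) * diff (n := n) (f i) x u := by
  induction s using Finset.induction_on with
  | empty => exact ⟨by simpa using mdifferentiableAt_const, fun u => by simp [diff_const]⟩
  | insert a s ha ih =>
    obtain ⟨h1, h2⟩ := ih fun i hi => hf i (Finset.mem_insert_of_mem hi)
    have h3 := hf a (Finset.mem_insert_self _ _)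
    simp only [Finset.prod_insert ha, Finset.sum_insert ha]
    refine ⟨h3.mul h1, fun u => ?_⟩
    rw [diff_mul (f := f a) (g := fun y => ∏ i ∈ s, f i y) h3 h1, h2, Finset.erase_insert ha,
      add_comm, Finset.mul_sum]
    congr 1
    refine Finset.sum_congr rfl fun i hi => ?_
    have hia : a ≠ i := fun h => ha (h ▸ hi)
    rw [Finset.erase_insert_of_ne hia, Finset.prod_insert (by simp [ha])]
    ring

/-- The derivative of the determinant at the identity is the trace. -/
theorem mdiff_det_of_eq_one {ι : Type*} [Fintype ι] [DecidableEq ι] {a : ι → ι → N → ℝ}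
    (ha : ∀ i j, MDifferentiableAt (𝓡 (n + 1)) 𝓘(ℝ, ℝ) (a i j) x)
    (h1 : ∀ i j, a i j x = if i = j then 1 else 0) :
    MDifferentiableAt (𝓡 (n + 1)) 𝓘(ℝ, ℝ) (fun y => (Matrix.of fun i j => a i j y).det) x ∧
    ∀ u : Tan n x, diff (n := n) (fun y => (Matrix.of fun i j => a i j y).det) x u =
      ∑ i, diff (n := n) (a i i) x u := by
  simp only [Matrix.det_apply', Matrix.of_apply]
  have hp : ∀ σ : Equiv.Perm ι, MDifferentiableAt (𝓡 (n + 1)) 𝓘(ℝ, ℝ)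
      (fun y => ((Equiv.Perm.sign σ : ℤ) : ℝ) * ∏ i, a (σ i) i y) x := fun σ =>
    mdifferentiableAt_const.mul (mdiff_prod Finset.univ fun i _ => ha (σ i) i).1
  obtain ⟨h2, h3⟩ := mdiff_sum Finset.univ fun σ _ => hp σ
  refine ⟨h2, fun u => ?_⟩
  rw [h3, Finset.sum_eq_single (1 : Equiv.Perm ι)]
  · rw [diff_mul mdifferentiableAt_const (mdiff_prod Finset.univ fun i _ => ha _ i).1,
      (mdiff_prod Finset.univ fun i _ => ha _ i).2, diff_const]
    simp only [Equiv.Perm.sign_one, Units.val_one, Int.cast_one, one_mul, mul_zero, add_zero,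
      Equiv.Perm.one_apply]
    refine Finset.sum_congr rfl fun i _ => ?_
    rw [Finset.prod_eq_one fun j _ => by rw [h1, if_pos rfl], one_mul]
  · intro σ _ hσ
    rw [diff_mul mdifferentiableAt_const (mdiff_prod Finset.univ fun i _ => ha _ i).1,
      (mdiff_prod Finset.univ fun i _ => ha _ i).2, diff_const, mul_zero, add_zero]
    refine mul_eq_zero_of_right _ (Finset.sum_eq_zero fun i _ => ?_)
    -- A non-trivial permutation moves at least two indices, so after differentiating one factor an
    -- off-diagonal entry, which is zero at `x`, remains.
    obtain ⟨j, hji, hj⟩ : ∃ j, j ≠ i ∧ σ j ≠ j := by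
      by_contra! H
      apply hσ
      ext j
      by_cases hj : j = i
      · subst hj
        by_contra h
        have := H (σ j) h
        exact h (σ.injective this)
      · exact H j hj
    rw [Finset.prod_eq_zero (Finset.mem_erase.2 ⟨hji, Finset.mem_univ j⟩), zero_mul]
    rw [h1, if_neg hj]
  · simp

theorem cov_sum (c : AffineConnection n N) {ι : Type*} (s : Finset ι) {a : ι → N → ℝ}
    {V : ι → ∀ y : N, Tan n y} (ha : ∀ i ∈ s, SmoothFunNear n (a i) x)
    (hV : ∀ i ∈ s, SmoothNear (V i) x) (u : Tan n x) :
    c.cov (∑ i ∈ s, a i • V i) x u =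
      ∑ i ∈ s, (a i x • c.cov (V i) x u + diff (n := n) (a i) x u • V i x) := by
  classical
  induction s using Finset.induction_on with
  | empty => simp [c.cov.zero]
  | insert j s hj ih =>
    have hsm : ∀ i ∈ insert j s, SmoothNear (a i • V i) x := by
      intro i hi
      filter_upwards [ha i hi, hV i hi] with y h1 h2 using h2.smul h1
    rw [Finset.sum_insert hj, Finset.sum_insert hj,
      c.cov_add (hsm j (Finset.mem_insert_self _ _)).smoothAt
        (smoothNear_sum s fun i hi => hsm i (Finset.mem_insert_of_mem hi)).smoothAt, add_apply,
      ih (fun i hi => ha i (Finset.mem_insert_of_mem hi))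
        (fun i hi => hV i (Finset.mem_insert_of_mem hi)),
      c.cov_smul (contMDiffAt_mdiff (ha j (Finset.mem_insert_self _ _)).self_of_nhds)
        (hV j (Finset.mem_insert_self _ _)).smoothAt]

/-- The covariant derivative of a density, computed in an arbitrary smooth frame field. -/
theorem Density.covDeriv_eq {w : ℝ} (σ : Density n N w) (c : AffineConnection n N) (e : Frame n x)
    {V : Fin (n + 1) → ∀ y : N, Tan n y} (hV : ∀ i, SmoothNear (V i) x) (hVe : ∀ i, V i x = e i)
    (u : Tan n x) :
    σ.covDeriv c x e u = diff (n := n) (fun y => σ.val y (fun i => V i y)) x u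
      + w / ((n : ℝ) + 2) * (∑ j, e.repr (c.cov (V j) x u) j) * σ.val x e := by
  choose b hb hVb using fun j => exists_coeff_ext e (hV j)
  have hb1 : ∀ i j, b j i x = if i = j then 1 else 0 := by
    intro i j
    have h1 := (hVb j).self_of_nhds
    rw [hVe] at h1
    simp only [ext_self] at h1
    have h2 := congrArg (fun v => e.repr v i) h1
    simp only [Basis.repr_self, map_sum, map_smul, Finsupp.coe_finsetSum, Finset.sum_apply,
      Finsupp.smul_apply, smul_eq_mul] at h2
    rw [Finset.sum_eq_single i (fun k _ hk => by simp [hk]) (by simp)] at h2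
    simp only [Finsupp.single_eq_same, mul_one] at h2
    rw [← h2, Finsupp.single_apply]
    simp [eq_comm]
  have hbd : ∀ i j, MDifferentiableAt (𝓡 (n + 1)) 𝓘(ℝ, ℝ) (b j i) x := fun i j =>
    contMDiffAt_mdiff (hb j i).self_of_nhds
  obtain ⟨hD, hD'⟩ := mdiff_det_of_eq_one (a := fun i j => b j i) hbd hb1
  set D : N → ℝ := fun y => (Matrix.of fun i j => b j i y).det
  have hDx : D x = 1 := by
    have : (Matrix.of fun i j => b j i x) = (1 : Matrix (Fin (n + 1)) (Fin (n + 1)) ℝ) := by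
      ext i j
      simp [hb1, Matrix.one_apply]
    simp only [D, this, Matrix.det_one]
  have hval : ∀ᶠ y in 𝓝 x, σ.val y (fun i => V i y) =
      D y ^ (-w / ((n : ℝ) + 2)) * σ.val y (fun i => ext (e i) y) := by
    have hpos : ∀ᶠ y in 𝓝 x, 0 < D y :=
      hD.continuousAt.eventually (lt_mem_nhds (by rw [hDx]; exact one_pos))
    filter_upwards [exists_basis_ext (n := n) x, Filter.eventually_all.2 hVb, hpos]
      with y h1 h2 h3
    obtain ⟨E, hE⟩ := h1 e
    have hdet : E.det (fun i => V i y) = D y := by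
      rw [Basis.det_apply]
      refine congrArg Matrix.det ?_
      ext i j
      rw [Basis.toMatrix_apply, h2 j]
      simp only [← hE, Matrix.of_apply]
      rw [E.repr_sum_self]
    have hu : IsUnit (E.det (fun i => V i y)) := by
      rw [hdet]; exact isUnit_iff_ne_zero.2 h3.ne'
    obtain ⟨hli, hsp⟩ := (Basis.is_basis_iff_det E).2 hu
    have h5 := σ.val_eq E (Basis.mk hli hsp.ge)
    rw [Basis.coe_mk, hdet, abs_of_pos h3] at h5
    rw [h5, ← funext hE]
  have hτ := contMDiffAt_mdiff (σ.smooth x e)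
  have hDr : MDifferentiableAt (𝓡 (n + 1)) 𝓘(ℝ, ℝ) (fun y => D y ^ (-w / ((n : ℝ) + 2))) x := by
    have : DifferentiableAt ℝ (fun t : ℝ => t ^ (-w / ((n : ℝ) + 2))) (D x) :=
      (Real.differentiableAt_rpow_const_of_ne _ (by rw [hDx]; exact one_ne_zero))
    exact this.mdifferentiableAt.comp (f := D) x hD
  have hdr : diff (n := n) (fun y => D y ^ (-w / ((n : ℝ) + 2))) x u =
      -w / ((n : ℝ) + 2) * ∑ i, diff (n := n) (b i i) x u := by
    rw [diff_comp (h := fun t : ℝ => t ^ (-w / ((n : ℝ) + 2)))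
      (Real.differentiableAt_rpow_const_of_ne _ (by rw [hDx]; exact one_ne_zero)) hD, hD',
      Real.deriv_rpow_const _, hDx]
    simp
  have hcov : ∀ j, c.cov (V j) x u = c.cov (ext (e j)) x u + ∑ i, diff (n := n) (b j i) x u • e i := by
    intro j
    have h1 : ∀ᶠ y in 𝓝 x, V j y = (∑ i, b j i • ext (e i) : ∀ y : N, Tan n y) y := by
      filter_upwards [hVb j] with y hy
      rw [hy, Finset.sum_apply]
      rfl
    rw [c.cov_congr (hV j).smoothAt h1, cov_sum c Finset.univ (fun i _ => hb j i)
      (fun i _ => ext_smoothNear (e i)), Finset.sum_add_distrib]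
    simp only [hb1, ext_self, ite_smul, one_smul, zero_smul]
    simp
  rw [Density.covDeriv, diff_congr hval, diff_mul hDr hτ, hdr, hDx]
  -- The trace of the derivative of the transition matrix enters here with coefficient `w / (n + 2)`
  -- and through `hdr` with the opposite one.
  have htr : ∑ j, e.repr (c.cov (V j) x u) j = ∑ j, e.repr (c.cov (ext (e j)) x u) j +
      ∑ i, diff (n := n) (b i i) x u := by
    rw [← Finset.sum_add_distrib]
    refine Finset.sum_congr rfl fun j _ => ?_
    rw [hcov, map_add, Finsupp.add_apply, e.repr_sum_self]
  rw [htr]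
  simp only [ext_self, Real.one_rpow]
  ring

end

/-! ### Projective change of the connection -/

section
variable {n : ℕ} {N : Type*} [TopologicalSpace N]
  [ChartedSpace (EuclideanSpace ℝ (Fin (n + 1))) N] [IsManifold (𝓡 (n + 1)) ∞ N]

variable {x : N} {c c' : AffineConnection n N}

/-- `c'` is obtained from `c` by the exact projective change with the form `-dυ`. -/
def ExactProjChange (c c' : AffineConnection n N) (υ : N → ℝ) : Prop :=
  ∀ (Y : ∀ y : N, Tan n y) (x : N), SmoothAt Y x → ∀ u : Tan n x,
    c'.cov Y x u = c.cov Y x u - diff (n := n) υ x u • Y x - diff (n := n) υ x (Y x) • u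

theorem ProjEquiv.hess_eq {p : ∀ x : N, Tan n x →L[ℝ] ℝ}
    (hp : ∀ (Y : ∀ x : N, Tan n x) (x : N), SmoothAt Y x → ∀ u : Tan n x,
      c'.cov Y x u = c.cov Y x u + p x u • Y x + p x (Y x) • u) (f : N → ℝ) (u v : Tan n x) :
    c'.hess f x u v = c.hess f x u v - p x u * diff (n := n) f x v - p x v * diff (n := n) f x u := by
  simp only [AffineConnection.hess, AffineConnection.covOneForm]
  rw [hp _ _ (ext_smoothNear v).smoothAt]
  simp only [ext_self, map_add, map_smul, smul_eq_mul]
  ring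

variable [T2Space N] {υ : N → ℝ}

theorem ExactProjChange.cov_cov (h : ExactProjChange c c' υ) (hυ : Smooth n υ)
    {Y Z : ∀ y : N, Tan n y} (hY : SmoothNear Y x) (hZ : SmoothNear Z x) (u : Tan n x) :
    c'.cov (fun y => c'.cov Z y (Y y)) x u =
      c.cov (fun y => c.cov Z y (Y y)) x u
      - (diff (n := n) υ x (Y x) • c.cov Z x u
        + diff (n := n) (fun y => diff (n := n) υ y (Y y)) x u • Z x)
      - (diff (n := n) υ x (Z x) • c.cov Y x u
        + diff (n := n) (fun y => diff (n := n) υ y (Z y)) x u • Y x)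
      - diff (n := n) υ x u • (c.cov Z x (Y x) - diff (n := n) υ x (Y x) • Z x
          - diff (n := n) υ x (Z x) • Y x)
      - (diff (n := n) υ x (c.cov Z x (Y x))
          - 2 * (diff (n := n) υ x (Y x) * diff (n := n) υ x (Z x))) • u := by
  have hgY : ContMDiffAt (𝓡 (n + 1)) 𝓘(ℝ, ℝ) ∞ (fun y => diff (n := n) υ y (Y y)) x :=
    contMDiffAt_diff (hυ x) hY.smoothAt
  have hgZ : ContMDiffAt (𝓡 (n + 1)) 𝓘(ℝ, ℝ) ∞ (fun y => diff (n := n) υ y (Z y)) x :=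
    contMDiffAt_diff (hυ x) hZ.smoothAt
  have hn1 : ContMDiffAt (𝓡 (n + 1)) 𝓘(ℝ, ℝ) ∞ (fun y => -diff (n := n) υ y (Y y)) x := hgY.neg
  have hn2 : ContMDiffAt (𝓡 (n + 1)) 𝓘(ℝ, ℝ) ∞ (fun y => -diff (n := n) υ y (Z y)) x := hgZ.neg
  have hneg : ∀ {g : N → ℝ}, MDifferentiableAt (𝓡 (n + 1)) 𝓘(ℝ, ℝ) g x → ∀ u : Tan n x,
      diff (n := n) (fun y => -g y) x u = -diff (n := n) g x u := by
    intro g hg u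
    have := diff_sub (n := n) (f := fun _ : N => (0 : ℝ)) mdifferentiableAt_const hg u
    rw [diff_const] at this
    simpa using this
  set W : ∀ y : N, Tan n y := fun y => c.cov Z y (Y y)
  have hW : SmoothAt W x := c.smoothAt_cov hY.smoothAt hZ
  have hYn : SmoothAt ((fun y => -diff (n := n) υ y (Y y)) • Z) x := hZ.smoothAt.smul hn1
  have hZn : SmoothAt ((fun y => -diff (n := n) υ y (Z y)) • Y) x := hY.smoothAt.smul hn2
  have hev : ∀ᶠ y in 𝓝 x, (W + (fun y => -diff (n := n) υ y (Y y)) • Z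
      + (fun y => -diff (n := n) υ y (Z y)) • Y : ∀ y : N, Tan n y) y = c'.cov Z y (Y y) := by
    filter_upwards [hZ] with y hz
    rw [h Z y hz]
    simp only [Pi.add_apply, Pi.smul_apply', W]
    module
  have hs : SmoothAt (W + (fun y => -diff (n := n) υ y (Y y)) • Z
      + (fun y => -diff (n := n) υ y (Z y)) • Y : ∀ y : N, Tan n y) x := (hW.add hYn).add hZn
  rw [← c'.cov_congr hs hev, h _ _ hs, c.cov_add (hW.add hYn) hZn, add_apply,
    c.cov_add hW hYn, add_apply, c.cov_smul (contMDiffAt_mdiff hn1) hZ.smoothAt,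
    c.cov_smul (contMDiffAt_mdiff hn2) hY.smoothAt, hneg (contMDiffAt_mdiff hgY),
    hneg (contMDiffAt_mdiff hgZ)]
  simp only [Pi.add_apply, Pi.smul_apply', map_add, map_smul, smul_eq_mul, W]
  module

/-- The form of the change is exact, so after antisymmetrising no multiple of `Z` survives: the
second derivatives of `υ` along `X`, `Y` cancel against the bracket, and torsion-freeness matches
the remaining first-order terms. -/
theorem ExactProjChange.curvature_eq (h : ExactProjChange c c' υ) (hυ : Smooth n υ)
    {X Y Z : ∀ y : N, Tan n y} (hX : SmoothNear X x) (hY : SmoothNear Y x) (hZ : SmoothNear Z x) :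
    c'.curvature X Y Z x = c.curvature X Y Z x
      + (c.hess υ x (Y x) (Z x) + diff (n := n) υ x (Y x) * diff (n := n) υ x (Z x)) • X x
      - (c.hess υ x (X x) (Z x) + diff (n := n) υ x (X x) * diff (n := n) υ x (Z x)) • Y x := by
  simp only [AffineConnection.curvature]
  rw [h.cov_cov hυ hY hZ, h.cov_cov hυ hX hZ, h _ _ hZ.smoothAt,
    diff_mlieBracket (hυ x) hX.smoothAt hY.smoothAt, ← c.cov_sub_cov hX.smoothAt hY.smoothAt,
    ProjGeom.hess_eq hυ hZ, ProjGeom.hess_eq hυ hZ]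
  module

/-- Tracing the two new curvature terms gives the factor `(n + 1) - 1 = n`, which the normalisation
`1 / n` removes. -/
theorem ExactProjChange.schouten_eq (hn : n ≠ 0) (h : ExactProjChange c c' υ) (hυ : Smooth n υ)
    (v w : Tan n x) : c'.schouten x v w = c.schouten x v w + c.hess υ x v w +
      diff (n := n) υ x v * diff (n := n) υ x w := by
  have hR : c'.ricci x v w = c.ricci x v w + n * (c.hess υ x v w +
      diff (n := n) υ x v * diff (n := n) υ x w) := by
    set b := stdFrame n x
    set B := hessForm c hυ x
    have e1 : ∀ i, b.repr (c'.curvature (ext (b i)) (ext v) (ext w) x) i =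
        b.repr (c.curvature (ext (b i)) (ext v) (ext w) x) i +
        (c.hess υ x v w + diff (n := n) υ x v * diff (n := n) υ x w) -
        (B (b i) w + diff (n := n) υ x (b i) * diff (n := n) υ x w) * b.repr v i := by
      intro i
      rw [h.curvature_eq hυ (ext_smoothNear _) (ext_smoothNear _) (ext_smoothNear _)]
      simp only [ext_self, map_add, map_sub, map_smul, Finsupp.add_apply, Finsupp.sub_apply,
        Finsupp.smul_apply, smul_eq_mul, Basis.repr_self, Finsupp.single_eq_same, mul_one]
      rfl
    simp only [AffineConnection.ricci]
    rw [Finset.sum_congr rfl fun i _ => e1 i, Finset.sum_sub_distrib, Finset.sum_add_distrib]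
    have e2 : ∑ i, (B (b i) w + diff (n := n) υ x (b i) * diff (n := n) υ x w) * b.repr v i =
        c.hess υ x v w + diff (n := n) υ x v * diff (n := n) υ x w := by
      have h1 : B v w + diff (n := n) υ x v * diff (n := n) υ x w =
          ∑ i, (B (b i) w + diff (n := n) υ x (b i) * diff (n := n) υ x w) * b.repr v i := by
        conv_lhs => rw [← b.sum_repr v]
        simp only [map_sum, map_smul, LinearMap.sum_apply, LinearMap.smul_apply, smul_eq_mul,
          Finset.sum_mul, ← Finset.sum_add_distrib]
        refine Finset.sum_congr rfl fun i _ => by ring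
      exact h1.symm
    rw [e2]
    simp only [Finset.sum_const, Finset.card_univ, Fintype.card_fin, nsmul_eq_mul]
    push_cast
    ring
  have hn' : (n : ℝ) ≠ 0 := Nat.cast_ne_zero.2 hn
  rw [AffineConnection.schouten, AffineConnection.schouten, hR]
  field_simp
  ring

/-- The new matrix is `exp (-2υ)` times a unipotent congruence of the old one, with shift `-dυ`; the
Schouten term absorbs the quadratic part. The determinant of size `n + 2` scales by `exp (-2 (n + 2)
υ)`, compensated by the power of `τ'`. -/
theorem ExactProjChange.mongeAmpere_eq (hn : n ≠ 0) (h : ExactProjChange c c' υ)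
    (hυ : Smooth n υ) {τ τ' : Density n N 1}
    (hτ : ∀ (x : N) (e : Frame n x), τ'.val x e = Real.exp (υ x) * τ.val x e)
    {f : N → ℝ} (hf : Smooth n f) (x : N) :
    mongeAmpere c' τ' (fun y => Real.exp (-2 * υ y) * f y) x = mongeAmpere c τ f x := by
  set e := stdFrame n x with he
  set E : N → ℝ := fun y => Real.exp (-2 * υ y) with hE
  have hEs : Smooth n E := by
    have : ContDiff ℝ ∞ fun t : ℝ => Real.exp (-2 * t) := by fun_prop
    exact this.contMDiff.comp hυ
  have hEd : ∀ y, ∀ u : Tan n y, diff (n := n) E y u = -2 * E y * diff (n := n) υ y u := by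
    intro y u
    have hd : HasDerivAt (fun t : ℝ => Real.exp (-2 * t)) (-2 * Real.exp (-2 * υ y)) (υ y) := by
      have := ((hasDerivAt_id (υ y)).const_mul (-2)).exp
      simpa [mul_comm] using this
    rw [hE, diff_comp (h := fun t : ℝ => Real.exp (-2 * t)) hd.differentiableAt
      (contMDiff_mdiff hυ y), hd.deriv]
  have hEh : ∀ u v : Tan n x, c.hess E x u v = E x * (-2 * c.hess υ x u v +
      4 * (diff (n := n) υ x u * diff (n := n) υ x v)) := by
    intro u v
    simp only [AffineConnection.hess, AffineConnection.covOneForm, hEd]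
    have hυv : ContMDiffAt (𝓡 (n + 1)) 𝓘(ℝ, ℝ) ∞ (fun y => diff (n := n) υ y (ext v y)) x :=
      contMDiffAt_diff (hυ x) (ext_smoothNear v).smoothAt
    rw [diff_mul (f := fun y => -2 * E y) (g := fun y => diff (n := n) υ y (ext v y))
      (mdifferentiableAt_const.mul (contMDiff_mdiff hEs x)) (contMDiffAt_mdiff hυv),
      diff_mul mdifferentiableAt_const (contMDiff_mdiff hEs x), diff_const, hEd]
    simp only [ext_self]
    ring
  have hfd : ∀ u : Tan n x, diff (n := n) (fun y => E y * f y) x u =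
      E x * (diff (n := n) f x u + 2 * f x * -diff (n := n) υ x u) := by
    intro u
    rw [diff_mul (contMDiff_mdiff hEs x) (contMDiff_mdiff hf x), hEd]
    ring
  have hfh : ∀ u v : Tan n x, c'.hess (fun y => E y * f y) x u v +
      2 * (E x * f x) * c'.schouten x u v = E x * ((c.hess f x u v + 2 * f x * c.schouten x u v) +
        -diff (n := n) υ x u * diff (n := n) f x v + diff (n := n) f x u * -diff (n := n) υ x v +
        2 * f x * -diff (n := n) υ x u * -diff (n := n) υ x v) := by
    intro u v
    rw [ProjEquiv.hess_eq (c := c) (p := fun y => -diff (n := n) υ y) (fun Y y hY u => by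
      rw [h Y y hY]; simp only [neg_apply]; module), hess_mul hEs hf, hEh, hEd, hEd, hfd, hfd,
      h.schouten_eq hn hυ]
    simp only [neg_apply]
    ring
  have hM : hessMatrix c' (fun y => E y * f y) x e = E x • Matrix.fromBlocks
      (Matrix.of fun _ _ : Unit => 2 * f x)
      (Matrix.of fun _ j => diff (n := n) f x (e j) + 2 * f x * -diff (n := n) υ x (e j))
      (Matrix.of fun i _ => diff (n := n) f x (e i) + 2 * f x * -diff (n := n) υ x (e i))
      (Matrix.of fun i j => (c.hess f x (e i) (e j) + 2 * f x * c.schouten x (e i) (e j)) +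
        -diff (n := n) υ x (e i) * diff (n := n) f x (e j) +
        diff (n := n) f x (e i) * -diff (n := n) υ x (e j) +
        2 * f x * -diff (n := n) υ x (e i) * -diff (n := n) υ x (e j)) := by
    rw [Matrix.fromBlocks_smul, hessMatrix]
    congr 1
    · ext i j; simp; ring
    · ext i j; simp [hfd]
    · ext i j; simp [hfd]
    · ext i j; simp only [Matrix.of_apply, Matrix.smul_apply, hfh, smul_eq_mul]
  have hdet := det_bordered_unipotent (2 * f x) (fun j => diff (n := n) f x (e j))
    (fun j => diff (n := n) f x (e j)) (fun j => -diff (n := n) υ x (e j))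
    (fun i j => c.hess f x (e i) (e j) + 2 * f x * c.schouten x (e i) (e j))
  have hEx : E x * Real.exp (υ x) ^ 2 = 1 := by
    rw [hE, ← Real.exp_nat_mul, ← Real.exp_add]
    simp
  rw [mongeAmpere, mongeAmpere, ← he, hM, Matrix.det_smul, hdet, hτ, mul_pow, pow_mul,
    Fintype.card_sum, Fintype.card_unit, Fintype.card_fin]
  have h3 : E x ^ (1 + (n + 1)) * (Real.exp (υ x) ^ 2) ^ (n + 2) = 1 := by
    rw [show 1 + (n + 1) = n + 2 by ring, ← mul_pow, hEx, one_pow]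
  change E x ^ (1 + (n + 1)) * (hessMatrix c f x e).det * _ = _
  linear_combination (hessMatrix c f x e).det * τ.val x e ^ (2 * (n + 2)) * h3

end

/-! ### Projective scales -/

section
variable {n : ℕ} {N : Type*} [TopologicalSpace N]
  [ChartedSpace (EuclideanSpace ℝ (Fin (n + 1))) N] [IsManifold (𝓡 (n + 1)) ∞ N]

variable {x : N}

/-- The density `τ ^ w * g`. -/
noncomputable def Density.IsScale.toDensity {τ : Density n N 1} (hτ : τ.IsScale) (w : ℝ)
    {g : N → ℝ} (hg : Smooth n g) : Density n N w where
  val x v := τ.val x v ^ w * g x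
  equivariant x e A := by
    rw [τ.equivariant, Real.mul_rpow (by positivity) (hτ x e).le, ← Real.rpow_mul (abs_nonneg _),
      mul_assoc]
    congr 2
    ring
  smooth x e := by
    refine ContMDiffAt.mul ?_ (hg x)
    have h0 : (fun i => ext (e i) x) = e := funext fun i => ext_self _
    have h1 : ContDiffAt ℝ ∞ (fun t : ℝ => t ^ w) (τ.val x (fun i => ext (e i) x)) :=
      Real.contDiffAt_rpow_const_of_ne (by rw [h0]; exact (hτ x e).ne')
    exact h1.contMDiffAt.comp (f := fun y => τ.val y (fun i => ext (e i) y)) x (τ.smooth x e)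

theorem Density.IsScale.toDensity_val {τ : Density n N 1} (hτ : τ.IsScale) (w : ℝ)
    {g : N → ℝ} (hg : Smooth n g) (x : N) (v : Fin (n + 1) → Tan n x) :
    (hτ.toDensity w hg).val x v = τ.val x v ^ w * g x := rfl

/-- The ratio of two densities is a function. -/
theorem Density.div_rpow_eq {τ : Density n N 1} (hτ : τ.IsScale) {w : ℝ} (σ : Density n N w)
    (e e' : Frame n x) : σ.val x e / τ.val x e ^ w = σ.val x e' / τ.val x e' ^ w := by
  have hd : 0 < |e.det e'| := abs_pos.2 (e.isUnit_det e').ne_zero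
  rw [σ.val_eq e e', τ.val_eq e e', Real.mul_rpow (Real.rpow_nonneg hd.le _) (hτ x e).le,
    ← Real.rpow_mul hd.le, show -1 / ((n : ℝ) + 2) * w = -w / ((n : ℝ) + 2) by ring,
    mul_div_mul_left _ _ (Real.rpow_pos_of_pos hd _).ne']

theorem Density.smooth_div_rpow {τ : Density n N 1} (hτ : τ.IsScale) {w : ℝ} (σ : Density n N w) :
    Smooth n fun x => σ.val x (stdFrame n x) / τ.val x (stdFrame n x) ^ w := by
  intro x
  set e := stdFrame n x
  have h0 : (fun i => ext (e i) x) = e := funext fun i => ext_self _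
  have h1 : ContDiffAt ℝ ∞ (fun t : ℝ => t ^ w) (τ.val x (fun i => ext (e i) x)) :=
    Real.contDiffAt_rpow_const_of_ne (by rw [h0]; exact (hτ x e).ne')
  have h2 := h1.contMDiffAt.comp (f := fun y => τ.val y (fun i => ext (e i) y)) x (τ.smooth x e)
  refine ((σ.smooth x e).div₀ h2 ?_).congr_of_eventuallyEq ?_
  · simp only [Function.comp_apply, h0]
    exact (Real.rpow_pos_of_pos (hτ x e) _).ne'
  · filter_upwards [exists_basis_ext (n := n) x] with y hy
    obtain ⟨E, hE⟩ := hy e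
    refine (Density.div_rpow_eq hτ σ (stdFrame n y) E).trans ?_
    rw [funext hE]
    rfl

/-- A projective scale exists. -/
theorem exists_isScale [T2Space N] [SecondCountableTopology N] :
    ∃ τ : Density n N 1, τ.IsScale := by
  have : LocallyCompactSpace N :=
    ChartedSpace.locallyCompactSpace (EuclideanSpace ℝ (Fin (n + 1))) N
  obtain ⟨ρ, hρ⟩ := SmoothPartitionOfUnity.exists_isSubordinate (𝓡 (n + 1)) isClosed_univ
    (fun x : N => frameDomain n x) (fun x => isOpen_frameDomain x)
    (fun x _ => mem_iUnion.2 ⟨x, mem_frameDomain x⟩)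
  have hn : (0 : ℝ) < (n : ℝ) + 2 := by positivity
  -- With this factor the density `|det| ^ (-1/(n+2)) * lam i` takes the value `1` on the coordinate
  -- frame of the chart at `i`; a partition of unity sums these positive densities.
  let lam : N → N → ℝ := fun i x =>
    |(stdFrame n x).det (fun k => locFrame i k x)| ^ (1 / ((n : ℝ) + 2))
  let h : N → ℝ := fun x => ∑ᶠ i, ρ i x • lam i x
  have hh : ∀ x, 0 < h x := by
    intro x
    simp only [h]
    rw [← ρ.sum_finsupport_smul_eq_finsum (fun i x => lam i x) (x₀ := x)]
    obtain ⟨i, hi⟩ := ρ.exists_pos_of_mem (mem_univ x)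
    refine Finset.sum_pos' (fun j _ => mul_nonneg (ρ.nonneg j x)
      (Real.rpow_nonneg (abs_nonneg _) _)) ⟨i, ?_, ?_⟩
    · rw [SmoothPartitionOfUnity.mem_finsupport]
      exact hi.ne'
    · have hxi : x ∈ frameDomain n i := hρ i (subset_tsupport _ hi.ne')
      refine mul_pos hi (Real.rpow_pos_of_pos (abs_pos.2 ?_) _)
      rw [← funext (locBasis_apply hxi)]
      exact ((stdFrame n x).isUnit_det _).ne_zero
  refine ⟨⟨fun x v => |(stdFrame n x).det v| ^ (-1 / ((n : ℝ) + 2)) * h x, fun x e A => ?_,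
    fun x e => ?_⟩, fun x e => ?_⟩
  · have h1 : (stdFrame n x).det (fun i => A (e i)) =
        LinearMap.det (A : Tan n x →ₗ[ℝ] Tan n x) * (stdFrame n x).det e :=
      (stdFrame n x).det_comp (A : Tan n x →ₗ[ℝ] Tan n x) e
    rw [h1, abs_mul, Real.mul_rpow (abs_nonneg _) (abs_nonneg _), mul_assoc]
  · have hx := mem_frameDomain (n := n) x
    obtain ⟨b, hb, hb'⟩ := exists_det_coeff hx (V := fun i => ext (e i))
      (fun i => (ext_smoothNear _).smoothAt)
    have hb0 : b x ≠ 0 := by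
      rw [hb' x hx]
      simp only [ext_self]
      exact ((locBasis x hx).isUnit_det e).ne_zero
    -- Determinants relative to `stdFrame n y` need not be smooth in `y`; only their ratios, in
    -- which that frame cancels, are used.
    have hG : ContMDiffAt (𝓡 (n + 1)) 𝓘(ℝ, ℝ) ∞ (fun y => ∑ᶠ i, ρ i y •
        (|(stdFrame n y).det (fun k => locFrame i k y)
            / (stdFrame n y).det (fun k => ext (e k) y)| ^ (1 / ((n : ℝ) + 2)))) x := by
      refine ρ.contMDiffAt_finsum fun i hi => ?_
      have hxi : x ∈ frameDomain n i := hρ i hi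
      obtain ⟨a, ha, ha'⟩ := exists_det_coeff hx (V := locFrame i) (fun k => smoothAt_locFrame hxi k)
      have ha0 : a x ≠ 0 := by
        rw [ha' x hx, ← funext (locBasis_apply hxi)]
        exact ((locBasis x hx).isUnit_det _).ne_zero
      have h1 : ContMDiffAt (𝓡 (n + 1)) 𝓘(ℝ, ℝ) ∞ (fun y => a y / b y) x := ha.div₀ hb hb0
      have h2 : ContDiffAt ℝ ∞ (fun t : ℝ => |t| ^ (1 / ((n : ℝ) + 2))) (a x / b x) :=
        (contDiffAt_abs (div_ne_zero ha0 hb0)).rpow_const_of_ne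
          (abs_ne_zero.2 (div_ne_zero ha0 hb0))
      refine (h2.contMDiffAt.comp (f := fun y => a y / b y) x h1).congr_of_eventuallyEq ?_
      filter_upwards [(isOpen_frameDomain x).mem_nhds hx] with y hy
      have hL : ∀ V : Fin (n + 1) → Tan n y, (stdFrame n y).det V =
          (stdFrame n y).det (locBasis x hy) * (locBasis x hy).det V := by
        intro V
        simp only [Basis.det_apply]
        rw [← Matrix.det_mul, Basis.toMatrix_mul_toMatrix]
      rw [hL, hL (fun k => ext (e k) y), mul_div_mul_left _ _
        ((stdFrame n y).isUnit_det _).ne_zero, ← ha' y hy, ← hb' y hy]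
      rfl
    refine hG.congr_of_eventuallyEq ?_
    filter_upwards with y
    simp only [h]
    rw [← ρ.sum_finsupport_smul_eq_finsum (fun i x => lam i x) (x₀ := y), ← ρ.sum_finsupport_smul_eq_finsum
      (fun i y => |(stdFrame n y).det (fun k => locFrame i k y)
            / (stdFrame n y).det (fun k => ext (e k) y)| ^ (1 / ((n : ℝ) + 2))) (x₀ := y),
      Finset.mul_sum]
    refine Finset.sum_congr rfl fun i _ => ?_
    rw [abs_div, Real.div_rpow (abs_nonneg _) (abs_nonneg _), neg_div, Real.rpow_neg (abs_nonneg _)]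
    simp only [lam, smul_eq_mul]
    ring
  · exact mul_pos (Real.rpow_pos_of_pos (abs_pos.2 ((stdFrame n x).isUnit_det e).ne_zero) _) (hh x)

end

/-! ### The representative connection of a scale -/

section
variable {n : ℕ} {N : Type*} [TopologicalSpace N]
  [ChartedSpace (EuclideanSpace ℝ (Fin (n + 1))) N] [IsManifold (𝓡 (n + 1)) ∞ N]

variable {x : N}

/-- A section of the endomorphism bundle is smooth if it maps smooth fields to smooth fields. -/
theorem contMDiffAt_endomorphism {B : ∀ y : N, Tan n y →L[ℝ] Tan n y}
    (h : ∀ U : ∀ y : N, Tan n y, SmoothNear U x → SmoothAt (fun y => B y (U y)) x) :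
    ContMDiffAt (𝓡 (n + 1)) ((𝓡 (n + 1)).prod
      𝓘(ℝ, EuclideanSpace ℝ (Fin (n + 1)) →L[ℝ] EuclideanSpace ℝ (Fin (n + 1)))) ∞
      (fun y => (⟨y, B y⟩ : Bundle.TotalSpace
        (EuclideanSpace ℝ (Fin (n + 1)) →L[ℝ] EuclideanSpace ℝ (Fin (n + 1)))
        fun y : N => TangentSpace (𝓡 (n + 1)) y →L[ℝ] TangentSpace (𝓡 (n + 1)) y)) x := by
  rw [contMDiffAt_hom_bundle]
  refine ⟨contMDiffAt_id, ?_⟩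
  set t := trivializationAt (EuclideanSpace ℝ (Fin (n + 1)))
    (fun z : N => TangentSpace (𝓡 (n + 1)) z) x with ht
  have hx : x ∈ t.baseSet := FiberBundle.mem_baseSet_trivializationAt' x
  let b := EuclideanSpace.basisFun (Fin (n + 1)) ℝ
  have key : ∀ i, ContMDiffAt (𝓡 (n + 1)) 𝓘(ℝ, EuclideanSpace ℝ (Fin (n + 1))) ∞
      (fun y => (t ⟨y, B y (ext (t.symm x (b i)) y)⟩).2) x := by
    intro i
    exact (Bundle.contMDiffAt_section _).1 (h _ (ext_smoothNear (t.symm x (b i))))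
  -- In the trivialization the endomorphism is the sum of the coordinate functionals times the
  -- images of the basis vectors, and the hypothesis gives smoothness of these images.
  have hsum : ContMDiffAt (𝓡 (n + 1))
      𝓘(ℝ, EuclideanSpace ℝ (Fin (n + 1)) →L[ℝ] EuclideanSpace ℝ (Fin (n + 1))) ∞
      (fun y => ∑ i, ContinuousLinearMap.smulRightL ℝ (EuclideanSpace ℝ (Fin (n + 1)))
        (EuclideanSpace ℝ (Fin (n + 1))) (EuclideanSpace.proj i)
          ((t ⟨y, B y (ext (t.symm x (b i)) y)⟩).2)) x := by
    refine ContMDiffAt.sum fun i _ => ?_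
    exact (ContinuousLinearMap.contMDiff _).contMDiffAt.comp x (key i)
  refine hsum.congr_of_eventuallyEq ?_
  filter_upwards [t.open_baseSet.mem_nhds hx] with y hy
  ext1 v
  rw [ContinuousLinearMap.inCoordinates_eq hy hy, sum_apply]
  have e1 : ∀ w, t.symm y w = ext (t.symm x w) y := by
    intro w
    rw [ext_eq]
    change _ = t.symm y (t.continuousLinearMapAt ℝ x (t.symm x w))
    rw [Bundle.Trivialization.continuousLinearMapAt_apply,
      Bundle.Trivialization.linearMapAt_apply, if_pos hx, t.apply_mk_symm hx]
  let L : EuclideanSpace ℝ (Fin (n + 1)) →ₗ[ℝ] EuclideanSpace ℝ (Fin (n + 1)) :=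
    ((t.continuousLinearEquivAt ℝ y hy : Tan n y →L[ℝ] EuclideanSpace ℝ (Fin (n + 1))).comp
      ((B y).comp ((t.continuousLinearEquivAt ℝ y hy).symm :
        EuclideanSpace ℝ (Fin (n + 1)) →L[ℝ] Tan n y))).toLinearMap
  have e2 : ∀ w, L w = (t ⟨y, B y (ext (t.symm x w) y)⟩).2 := by
    intro w
    rw [← e1]
    rfl
  change L v = _
  conv_lhs => rw [← b.sum_repr v]
  rw [map_sum]
  refine Finset.sum_congr rfl fun i _ => ?_
  rw [map_smul, e2]
  rfl

/-- The covariant derivative in direction `u`, as an endomorphism computed on extensions. -/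
noncomputable def AffineConnection.covExt (c : AffineConnection n N) (u : Tan n x) :
    Tan n x →ₗ[ℝ] Tan n x where
  toFun v := c.cov (ext v) x u
  map_add' v w := by
    rw [c.cov_congr (ext_smoothNear _).smoothAt (W := ext v + ext w) (ext_add v w),
      c.cov_add (ext_smoothNear v).smoothAt (ext_smoothNear w).smoothAt, add_apply]
  map_smul' a v := by
    rw [c.cov_congr (ext_smoothNear _).smoothAt (W := (fun _ : N => a) • ext v)
        (by exact ext_smul a v),
      c.cov_smul mdifferentiableAt_const (ext_smoothNear v).smoothAt, diff_const]
    simp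

theorem AffineConnection.sum_repr_cov_ext (c : AffineConnection n N) (e : Frame n x)
    (u : Tan n x) :
    ∑ j, e.repr (c.cov (ext (e j)) x u) j = LinearMap.trace ℝ _ (c.covExt u) := by
  rw [LinearMap.trace_eq_matrix_trace ℝ e, Matrix.trace]
  refine Finset.sum_congr rfl fun j _ => ?_
  rw [Matrix.diag_apply, LinearMap.toMatrix_apply]
  rfl

/-- The extensions of two frames at `x` differ near `x` by a constant matrix, so no derivative of
the transition determinant occurs. -/
theorem Density.covDeriv_frame_change {w : ℝ} (σ : Density n N w) (c : AffineConnection n N)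
    (e e' : Frame n x) (u : Tan n x) :
    σ.covDeriv c x e' u = |e.det e'| ^ (-w / ((n : ℝ) + 2)) * σ.covDeriv c x e u := by
  have hval : ∀ᶠ y in 𝓝 x, σ.val y (fun i => ext (e' i) y) =
      |e.det e'| ^ (-w / ((n : ℝ) + 2)) * σ.val y (fun i => ext (e i) y) := by
    filter_upwards [exists_basis_ext (n := n) x, ext_eq_extL (n := n) x] with y h1 h2
    obtain ⟨E, hE⟩ := h1 e
    obtain ⟨E', hE'⟩ := h1 e'
    have h3 : E.det E' = e.det e' := by
      rw [Basis.det_apply, Basis.det_apply]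
      refine congrArg Matrix.det ?_
      ext i j
      rw [Basis.toMatrix_apply, Basis.toMatrix_apply, hE' j, h2]
      have h5 : extL x y (e' j) = ∑ k, e.repr (e' j) k • E k := by
        conv_lhs => rw [← e.sum_repr (e' j)]
        rw [map_sum]
        exact Finset.sum_congr rfl fun k _ => by rw [map_smul, hE k, h2]
      rw [h5, E.repr_sum_self]
    have h4 := σ.val_eq E E'
    rw [h3, funext hE, funext hE'] at h4
    exact h4
  rw [Density.covDeriv, Density.covDeriv, diff_congr hval,
    diff_mul mdifferentiableAt_const (contMDiffAt_mdiff (σ.smooth x e)), diff_const,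
    c.sum_repr_cov_ext, c.sum_repr_cov_ext, σ.val_eq e e']
  ring

/-- The endomorphism `Y ↦ p u • Y + p Y • u` has trace `(n + 1) p(u) + p(u)`, which explains the
normalisation `w / (n + 2)` of weights. For `w = 1` one can solve for `p`, and this gives
`AffineConnection.scaleForm`. -/
theorem Density.covDeriv_projective_change {w : ℝ} (σ : Density n N w)
    {c c' : AffineConnection n N} {p : Tan n x →L[ℝ] ℝ}
    (hp : ∀ Y : ∀ y : N, Tan n y, SmoothAt Y x → ∀ u : Tan n x,
      c'.cov Y x u = c.cov Y x u + p u • Y x + p (Y x) • u) (e : Frame n x) (u : Tan n x) :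
    σ.covDeriv c' x e u = σ.covDeriv c x e u + w * p u * σ.val x e := by
  have h1 : ∑ j, e.repr (c'.cov (ext (e j)) x u) j =
      ∑ j, e.repr (c.cov (ext (e j)) x u) j + ((n : ℝ) + 2) * p u := by
    have h2 : ∀ j, e.repr (c'.cov (ext (e j)) x u) j =
        e.repr (c.cov (ext (e j)) x u) j + p u + e.repr u j * p (e j) := by
      intro j
      rw [hp _ (ext_smoothNear _).smoothAt]
      simp only [ext_self, map_add, map_smul, Finsupp.add_apply, Finsupp.smul_apply,
        Basis.repr_self, Finsupp.single_eq_same, smul_eq_mul, mul_one]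
      ring
    have h3 : ∑ j, e.repr u j * p (e j) = p u := by
      conv_rhs => rw [← e.sum_repr u]
      simp only [map_sum, map_smul, smul_eq_mul]
    rw [Finset.sum_congr rfl fun j _ => h2 j, Finset.sum_add_distrib, Finset.sum_add_distrib, h3]
    simp only [Finset.sum_const, Finset.card_univ, Fintype.card_fin, nsmul_eq_mul]
    push_cast
    ring
  rw [Density.covDeriv, Density.covDeriv, h1]
  have : (n : ℝ) + 2 ≠ 0 := by positivity
  field_simp
  ring

instance (x : N) : T2Space (TangentSpace (𝓡 (n + 1)) x) :=
  inferInstanceAs (T2Space (EuclideanSpace ℝ (Fin (n + 1))))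

instance (x : N) : FiniteDimensional ℝ (TangentSpace (𝓡 (n + 1)) x) :=
  inferInstanceAs (FiniteDimensional ℝ (EuclideanSpace ℝ (Fin (n + 1))))

variable [T2Space N]

/-- The one-form `-τ⁻¹ ∇τ`. -/
noncomputable def AffineConnection.scaleForm (c : AffineConnection n N) (τ : Density n N 1)
    (x : N) : Tan n x →L[ℝ] ℝ :=
  LinearMap.toContinuousLinearMap
    (-(τ.val x (stdFrame n x))⁻¹ • ((diff (n := n) (fun y => τ.val y fun i =>
      ext (stdFrame n x i) y) x).toLinearMap + (1 / ((n : ℝ) + 2) * τ.val x (stdFrame n x)) •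
      ∑ j, ((stdFrame n x).coord j).comp
        (c.cov (ext (stdFrame n x j)) x).toLinearMap))

theorem AffineConnection.scaleForm_eq (c : AffineConnection n N) {τ : Density n N 1}
    (hτ : τ.IsScale) (e : Frame n x) (u : Tan n x) :
    c.scaleForm τ x u = -(τ.val x e)⁻¹ * τ.covDeriv c x e u := by
  have h1 : c.scaleForm τ x u =
      -(τ.val x (stdFrame n x))⁻¹ * τ.covDeriv c x (stdFrame n x) u := by
    rw [Density.covDeriv, scaleForm]
    simp only [LinearMap.coe_toContinuousLinearMap', LinearMap.smul_apply, LinearMap.add_apply,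
      LinearMap.sum_apply, LinearMap.comp_apply, smul_eq_mul, ContinuousLinearMap.coe_coe,
      Basis.coord_apply]
    ring
  rw [h1, τ.covDeriv_frame_change c e (stdFrame n x), τ.val_eq e (stdFrame n x), mul_inv]
  have h2 : 0 < |e.det (stdFrame n x)| ^ (-1 / ((n : ℝ) + 2)) :=
    Real.rpow_pos_of_pos (abs_pos.2 (e.isUnit_det _).ne_zero) _
  have h3 := (hτ x e).ne'
  generalize |e.det (stdFrame n x)| ^ (-1 / ((n : ℝ) + 2)) = D at h2 ⊢
  have h4 := h2.ne'
  field_simp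

theorem AffineConnection.smoothNear_scaleForm (c : AffineConnection n N) {τ : Density n N 1}
    (hτ : τ.IsScale) {U : ∀ y : N, Tan n y} (hU : SmoothNear U x) :
    SmoothFunNear n (fun y => c.scaleForm τ y (U y)) x := by
  have key : ∀ x : N, SmoothNear U x →
      ContMDiffAt (𝓡 (n + 1)) 𝓘(ℝ, ℝ) ∞ (fun y => c.scaleForm τ y (U y)) x := by
    intro x hU
    set e := stdFrame n x with he
    choose a ha ha' using fun j =>
      exists_coeff_ext e (c.smoothNear_cov hU (ext_smoothNear (e j)))
    have h0 : (fun i => ext (e i) x) = e := funext fun i => ext_self _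
    have h1 : ContMDiffAt (𝓡 (n + 1)) 𝓘(ℝ, ℝ) ∞ (fun y =>
        -(τ.val y fun i => ext (e i) y)⁻¹ * (diff (n := n) (fun y => τ.val y fun i => ext (e i) y) y
          (U y) + 1 / ((n : ℝ) + 2) * (∑ j, a j j y) * τ.val y fun i => ext (e i) y)) x := by
      refine ((τ.smooth x e).inv₀ (by rw [h0]; exact (hτ x e).ne')).neg.mul
        ((contMDiffAt_diff (τ.smooth x e) hU.smoothAt).add
        ((contMDiffAt_const.mul (ContMDiffAt.sum fun j _ => (ha j j).self_of_nhds)).mul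
          (τ.smooth x e)))
    refine h1.congr_of_eventuallyEq ?_
    filter_upwards [exists_basis_ext (n := n) x, Filter.eventually_all.2 ha',
      Filter.eventually_all.2 fun j => (ext_smoothNear (e j)).eventually] with y h2 h3 h4
    obtain ⟨E, hE⟩ := h2 e
    rw [c.scaleForm_eq hτ E, τ.covDeriv_eq c E (V := fun i => ext (e i)) h4 (fun i => (hE i).symm)]
    have h5 : ∀ j, E.repr (c.cov (ext (e j)) y (U y)) j = a j j y := by
      intro j
      rw [h3 j]
      simp only [← hE]
      rw [E.repr_sum_self]
    simp only [h5, funext hE]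
  filter_upwards [hU.eventually] with y hy using key y hy

/-- The endomorphism-valued one-form of a projective change. -/
noncomputable def projectiveChangeForm (p : ∀ x : N, Tan n x →L[ℝ] ℝ) (x : N) :
    Tan n x →L[ℝ] Tan n x →L[ℝ] Tan n x :=
  LinearMap.toContinuousLinearMap
    { toFun := fun Y => (p x).smulRight Y + p x Y • ContinuousLinearMap.id ℝ (Tan n x)
      map_add' := fun Y Z => by
        ext u : 1
        simp
        module
      map_smul' := fun a Y => by
        ext u : 1
        simp
        module }

theorem projectiveChangeForm_apply (p : ∀ x : N, Tan n x →L[ℝ] ℝ) (x : N) (Y u : Tan n x) :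
    projectiveChangeForm p x Y u = p x u • Y + p x Y • u := rfl

theorem cov_addOneForm_apply (c : AffineConnection n N) (p : ∀ x : N, Tan n x →L[ℝ] ℝ)
    (Y : ∀ y : N, Tan n y) (x : N) (u : Tan n x) :
    c.cov.addOneForm (projectiveChangeForm p) Y x u =
      c.cov Y x u + p x u • Y x + p x (Y x) • u := by
  rw [add_assoc, ← projectiveChangeForm_apply]
  rfl

/-- The projective change of a connection which makes a scale parallel. -/
noncomputable def AffineConnection.adapted (c : AffineConnection n N) {τ : Density n N 1}
    (hτ : τ.IsScale) : AffineConnection n N where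
  cov := c.cov.addOneForm (projectiveChangeForm (c.scaleForm τ))
  smooth := ⟨⟨fun {σ} hσ y _ => by
    refine ContMDiffAt.contMDiffWithinAt (contMDiffAt_endomorphism fun U hU => ?_)
    have hσ' : ∀ z, SmoothAt σ z := fun z => hσ.contMDiffAt Filter.univ_mem
    have hσn : SmoothNear σ y := Filter.Eventually.of_forall hσ'
    have h1 := ((c.smoothAt_cov hU.smoothAt hσn).add
      ((hσ' y).smul (c.smoothNear_scaleForm hτ hU).self_of_nhds)).add
      (hU.smoothAt.smul (c.smoothNear_scaleForm hτ hσn).self_of_nhds)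
    exact h1.congr (Filter.Eventually.of_forall fun z => cov_addOneForm_apply c _ σ z (U z))⟩⟩
  torsion_free := by
    rw [CovariantDerivative.torsion_eq_zero_iff]
    intro X Y x hX hY
    rw [← c.cov.torsion_eq_zero_iff.1 c.torsion_free hX hY, cov_addOneForm_apply,
      cov_addOneForm_apply]
    module

theorem AffineConnection.adapted_cov (c : AffineConnection n N) {τ : Density n N 1}
    (hτ : τ.IsScale) (Y : ∀ y : N, Tan n y) (x : N) (u : Tan n x) :
    (c.adapted hτ).cov Y x u =
      c.cov Y x u + c.scaleForm τ x u • Y x + c.scaleForm τ x (Y x) • u :=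
  cov_addOneForm_apply c _ Y x u

theorem AffineConnection.projEquiv_adapted (c : AffineConnection n N) {τ : Density n N 1}
    (hτ : τ.IsScale) : ProjEquiv c (c.adapted hτ) :=
  ⟨c.scaleForm τ, fun Y x _ u => c.adapted_cov hτ Y x u⟩

theorem AffineConnection.isParallel_adapted (c : AffineConnection n N) {τ : Density n N 1}
    (hτ : τ.IsScale) : τ.IsParallel (c.adapted hτ) := by
  intro x e u
  rw [τ.covDeriv_projective_change (c := c) (p := c.scaleForm τ x)
    (fun Y _ u => c.adapted_cov hτ Y x u), c.scaleForm_eq hτ e]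
  have := (hτ x e).ne'
  field_simp
  ring

/-- Two parallel scales of projectively equivalent connections. -/
theorem exactProjChange_of_parallel {c c' : AffineConnection n N} (h : ProjEquiv c c')
    {τ τ' : Density n N 1} (hτ : τ.IsScale) (hτ' : τ'.IsScale) (hc : τ.IsParallel c)
    (hc' : τ'.IsParallel c') : ∃ υ : N → ℝ, Smooth n υ ∧ ExactProjChange c c' υ ∧
      ∀ (x : N) (e : Frame n x), τ'.val x e = Real.exp (υ x) * τ.val x e := by
  obtain ⟨p, hp⟩ := h
  set g : N → ℝ := fun x => τ'.val x (stdFrame n x) / τ.val x (stdFrame n x) with hg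
  have hgp : ∀ x, 0 < g x := fun x => div_pos (hτ' x _) (hτ x _)
  have hgs : Smooth n g := by
    have := Density.smooth_div_rpow hτ τ'
    simpa only [Real.rpow_one] using this
  have hge : ∀ (x : N) (e : Frame n x), τ'.val x e = g x * τ.val x e := by
    intro x e
    have := Density.div_rpow_eq hτ τ' (stdFrame n x) e
    simp only [Real.rpow_one] at this
    rw [hg]
    simp only
    rw [this, div_mul_cancel₀ _ (hτ x e).ne']
  have hlog : ∀ x, ContDiffAt ℝ ∞ Real.log (g x) := fun x => Real.contDiffAt_log.2 (hgp x).ne'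
  refine ⟨fun x => Real.log (g x), fun x => (hlog x).contMDiffAt.comp x (hgs x), ?_, fun x e => ?_⟩
  · intro Y x hY u
    -- Both scales being parallel, `0 = ∇'(g τ) = τ (dg + p g)`; hence the form of the projective
    -- change is exact with potential `-log g`.
    have hdiff : ∀ u : Tan n x, diff (n := n) (fun x => Real.log (g x)) x u = -p x u := by
      intro u
      set e := stdFrame n x
      have h1 := hc' x e u
      rw [τ'.covDeriv_projective_change (c := c) (p := p x) (fun Y hY u => hp Y x hY.mdiff u)] at h1
      have h2 := hc x e u
      have h3 : ∀ᶠ y in 𝓝 x, τ'.val y (fun i => ext (e i) y) =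
          g y * τ.val y (fun i => ext (e i) y) := by
        filter_upwards [exists_basis_ext (n := n) x] with y hy
        obtain ⟨E, hE⟩ := hy e
        rw [← funext hE]
        exact hge y E
      have h0 : (fun i => ext (e i) x) = e := funext fun i => ext_self _
      rw [Density.covDeriv] at h1 h2
      rw [diff_congr h3, diff_mul (contMDiff_mdiff hgs x) (contMDiffAt_mdiff (τ.smooth x e)),
        hge, h0] at h1
      rw [diff_comp (h := Real.log) ((hlog x).differentiableAt (by simp)) (contMDiff_mdiff hgs x),
        Real.deriv_log]
      have h4 := (hτ x e).ne'
      have h5 := (hgp x).ne'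
      have h6 : τ.val x e * (diff (n := n) g x u + p x u * g x) = 0 := by
        linear_combination h1 - g x * h2
      have h7 := (mul_eq_zero.1 h6).resolve_left h4
      field_simp
      linear_combination h7
    rw [hp Y x hY.mdiff u, hdiff, hdiff]
    module
  · rw [Real.exp_log (hgp x)]
    exact hge x e

end

/-! ### Densities and functions in a scale -/

section
variable {n : ℕ} {N : Type*} [TopologicalSpace N]
  [ChartedSpace (EuclideanSpace ℝ (Fin (n + 1))) N] [IsManifold (𝓡 (n + 1)) ∞ N]

variable {x : N} {τ : Density n N 1}

theorem Density.IsScale.val_eq_inScale (hτ : τ.IsScale) (ρ : Density n N 2) (e : Frame n x) :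
    ρ.val x e = τ.val x e ^ 2 * ρ.inScale τ x := by
  have h := Density.div_rpow_eq hτ ρ e (stdFrame n x)
  have h2 : ∀ t : ℝ, t ^ (2 : ℝ) = t ^ 2 := fun t => Real.rpow_natCast t 2
  simp only [h2] at h
  rw [Density.inScale, ← h, mul_div_cancel₀ _ (pow_pos (hτ x e) 2).ne']

theorem Density.IsScale.smooth_inScale (hτ : τ.IsScale) (ρ : Density n N 2) :
    Smooth n (ρ.inScale τ) := by
  have h := Density.smooth_div_rpow hτ ρ
  have h2 : ∀ t : ℝ, t ^ (2 : ℝ) = t ^ 2 := fun t => Real.rpow_natCast t 2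
  simp only [h2] at h
  exact h

theorem Density.IsScale.inScale_toDensity (hτ : τ.IsScale) {f : N → ℝ} (hf : Smooth n f) :
    (hτ.toDensity 2 hf).inScale τ = f := by
  funext x
  rw [Density.inScale, hτ.toDensity_val, show τ.val x (stdFrame n x) ^ (2 : ℝ) =
    τ.val x (stdFrame n x) ^ 2 from Real.rpow_natCast _ 2,
    mul_div_cancel_left₀ _ (pow_pos (hτ x _) 2).ne']

/-- Every point has a unimodular frame. -/
theorem Density.IsScale.exists_frame (hτ : τ.IsScale) (x : N) :
    ∃ e : Frame n x, τ.val x e = 1 := by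
  set b := stdFrame n x
  set a := τ.val x b
  have ha : 0 < a := hτ x b
  have hn : (0 : ℝ) < (n : ℝ) + 1 := by positivity
  have hn2 : (0 : ℝ) < (n : ℝ) + 2 := by positivity
  -- Scaling a frame by `t` multiplies `τ` by `t ^ (-(n+1)/(n+2))`; this value of `t` turns `a` into
  -- `1`.
  have ht : 0 < a ^ (((n : ℝ) + 2) / ((n : ℝ) + 1)) := Real.rpow_pos_of_pos ha _
  refine ⟨b.unitsSMul fun _ => Units.mk0 _ ht.ne', ?_⟩
  rw [τ.val_eq b, b.det_unitsSMul_self]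
  simp only [Units.val_mk0, Finset.prod_const, Finset.card_univ, Fintype.card_fin]
  rw [abs_of_pos (pow_pos ht _), ← Real.rpow_natCast, ← Real.rpow_mul ha.le, ← Real.rpow_mul ha.le]
  change _ * a = 1
  rw [show ((n : ℝ) + 2) / ((n : ℝ) + 1) * ((n + 1 : ℕ) : ℝ) * (-1 / ((n : ℝ) + 2)) = -1 by
    push_cast
    field_simp, Real.rpow_neg_one, inv_mul_cancel₀ ha.ne']

theorem Density.IsScale.eqMod_iff (hτ : τ.IsScale) (ρ ρ' : Density n N 2) (k : ℕ) :
    EqMod ρ ρ' k ↔ ∃ φ : N → ℝ, Smooth n φ ∧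
      ∀ x, ρ'.inScale τ x - ρ.inScale τ x = φ x * ρ.inScale τ x ^ k := by
  have hw : ∀ t : ℝ, 0 < t → t ^ (2 - 2 * (k : ℝ)) * (t ^ 2) ^ k = t ^ 2 := by
    intro t ht
    rw [← pow_mul, ← Real.rpow_natCast, ← Real.rpow_add ht, ← Real.rpow_natCast]
    congr 1
    push_cast
    ring
  constructor
  · rintro ⟨φ, hφ⟩
    refine ⟨_, Density.smooth_div_rpow hτ φ, fun x => ?_⟩
    have h := hφ x (stdFrame n x)
    have hp := hτ x (stdFrame n x)
    have h1 := hw _ hp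
    rw [hτ.val_eq_inScale, hτ.val_eq_inScale, mul_pow] at h
    have hne := (Real.rpow_pos_of_pos hp (2 - 2 * (k : ℝ))).ne'
    have h2 : (ρ'.inScale τ x - ρ.inScale τ x) * τ.val x (stdFrame n x) ^ 2 =
        φ.val x (stdFrame n x) / τ.val x (stdFrame n x) ^ (2 - 2 * (k : ℝ)) *
          ρ.inScale τ x ^ k * τ.val x (stdFrame n x) ^ 2 := by
      rw [div_mul_eq_mul_div, div_mul_eq_mul_div, eq_div_iff hne, ← h1]
      linear_combination τ.val x (stdFrame n x) ^ (2 - 2 * (k : ℝ)) * h +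
        τ.val x (stdFrame n x) ^ (2 - 2 * (k : ℝ)) * (ρ'.inScale τ x - ρ.inScale τ x) * h1
    exact mul_right_cancel₀ (pow_pos hp 2).ne' h2
  · rintro ⟨φ, hφ, h⟩
    refine ⟨hτ.toDensity _ hφ, fun x e => ?_⟩
    rw [hτ.val_eq_inScale, hτ.val_eq_inScale, hτ.toDensity_val, mul_pow]
    linear_combination τ.val x e ^ 2 * h x - φ x * ρ.inScale τ x ^ k * hw _ (hτ x e)

theorem Density.IsScale.isDefiningDensity_iff (hτ : τ.IsScale) (ρ : Density n N 2) (Ω : Set N) :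
    IsDefiningDensity Ω ρ ↔ IsDefiningFunction (n := n) Ω (ρ.inScale τ) := by
  have hneg : ∀ (x : N) (e : Frame n x), ρ.val x e < 0 ↔ ρ.inScale τ x < 0 := by
    intro x e
    have hp := pow_pos (hτ x e) 2
    rw [hτ.val_eq_inScale ρ e]
    exact ⟨fun h => by_contra fun h' => h.not_ge (mul_nonneg hp.le (not_lt.1 h')),
      mul_neg_of_pos_of_neg hp⟩
  have hzero : ∀ (x : N) (e : Frame n x), ρ.val x e = 0 ↔ ρ.inScale τ x = 0 := by
    intro x e
    rw [hτ.val_eq_inScale ρ e, mul_eq_zero, or_iff_right (pow_pos (hτ x e) 2).ne']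
  have hd : ∀ x, ρ.inScale τ x = 0 → ∀ (e : Frame n x) (u : Tan n x),
      diff (n := n) (fun y => ρ.val y (fun i => ext (e i) y)) x u =
        τ.val x e ^ 2 * diff (n := n) (ρ.inScale τ) x u := by
    intro x hx e u
    have h0 : (fun i => ext (e i) x) = e := funext fun i => ext_self _
    have h1 : ∀ᶠ y in 𝓝 x, ρ.val y (fun i => ext (e i) y) =
        τ.val y (fun i => ext (e i) y) ^ 2 * ρ.inScale τ y := by
      filter_upwards [exists_basis_ext (n := n) x] with y hy
      obtain ⟨E, hE⟩ := hy e
      rw [← funext hE, hτ.val_eq_inScale ρ E]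
    rw [diff_congr h1, diff_mul (f := fun y => τ.val y (fun i => ext (e i) y) ^ 2)
      (contMDiffAt_mdiff ((τ.smooth x e).pow 2)) (contMDiff_mdiff (hτ.smooth_inScale ρ) x), hx, h0]
    ring
  constructor
  · intro h
    refine ⟨hτ.smooth_inScale ρ, fun x => (hneg x (stdFrame n x)).symm.trans (h.neg x _),
      fun x => (hzero x (stdFrame n x)).symm.trans (h.zero x _), fun x hx hdx => ?_⟩
    refine h.diff_ne_zero x hx (stdFrame n x) ?_
    ext1 u
    rw [hd x ((hzero x (stdFrame n x)).1 ((h.zero x _).2 hx)), hdx]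
    simp
  · intro h
    refine ⟨fun x e => (hneg x e).trans (h.neg x), fun x e => (hzero x e).trans (h.zero x),
      fun x hx e hdx => h.diff_ne_zero x hx ?_⟩
    ext1 u
    have h1 := hd x ((h.zero x).2 hx) e u
    rw [hdx] at h1
    exact (mul_eq_zero.1 h1.symm).resolve_left (pow_pos (hτ x e) 2).ne'

variable [T2Space N] {c : AffineConnection n N}

theorem Density.IsScale.det_tractorHessian (hτ : τ.IsScale) (c : AffineConnection n N)
    (ρ : Density n N 2) {e : Frame n x} (he : τ.val x e = 1) :
    (tractorHessian c τ ρ x e).det = mongeAmpere c τ (ρ.inScale τ) x := by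
  rw [tractorHessian, tractorDD_eq (hτ.smooth_inScale ρ),
    mongeAmpere_eq τ (hτ.smooth_inScale ρ) e, he, one_pow, mul_one]

theorem mongeAmpere_inScale_eq (hn : n ≠ 0) {c c' : AffineConnection n N} (h : ProjEquiv c c')
    {τ τ' : Density n N 1} (hτ : τ.IsScale) (hτ' : τ'.IsScale) (hc : τ.IsParallel c)
    (hc' : τ'.IsParallel c') (ρ : Density n N 2) (x : N) :
    mongeAmpere c' τ' (ρ.inScale τ') x = mongeAmpere c τ (ρ.inScale τ) x := by
  obtain ⟨υ, hυ, h1, h2⟩ := exactProjChange_of_parallel h hτ hτ' hc hc'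
  rw [← h1.mongeAmpere_eq hn hυ h2 (hτ.smooth_inScale ρ)]
  congr 1
  funext y
  rw [Density.inScale, Density.inScale, h2, mul_pow, ← Real.exp_nat_mul,
    show -2 * υ y = -((2 : ℕ) * υ y) by push_cast; ring, Real.exp_neg]
  field_simp

/-- The equation for all scales follows from one scale by `mongeAmpere_inScale_eq`; the weights
`-2k` and `2k` of the two factors of the error cancel. -/
theorem solvesMongeAmpereMod_iff (hn : n ≠ 0) {P : ProjectiveStructure n N} (hP : IsRep P c)
    (hτ : τ.IsScale) (hc : τ.IsParallel c) (ρ : Density n N 2) (k : ℕ) :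
    SolvesMongeAmpereMod P ρ k ↔ ∃ ψ : N → ℝ, Smooth n ψ ∧
      ∀ x, mongeAmpere c τ (ρ.inScale τ) x = -1 + ψ x * ρ.inScale τ x ^ k := by
  have hw : ∀ t : ℝ, 0 < t → t ^ (-2 * (k : ℝ)) * (t ^ 2) ^ k = 1 := by
    intro t ht
    rw [← pow_mul, ← Real.rpow_natCast, ← Real.rpow_add ht, ← Real.rpow_zero t]
    congr 1
    push_cast
    ring
  constructor
  · rintro ⟨φ, hφ⟩
    refine ⟨_, Density.smooth_div_rpow hτ φ, fun x => ?_⟩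
    obtain ⟨e, he⟩ := hτ.exists_frame x
    rw [Density.div_rpow_eq hτ φ (stdFrame n x) e, ← hτ.det_tractorHessian c ρ he,
      hφ τ c hτ hP hc x e he, hτ.val_eq_inScale ρ e, he, Real.one_rpow]
    ring
  · rintro ⟨ψ, hψ, h⟩
    refine ⟨hτ.toDensity _ hψ, fun τ' c' hτ' hP' hc' x e he => ?_⟩
    have hcc : ProjEquiv c c' := Quotient.exact (hP.trans hP'.symm)
    rw [hτ'.det_tractorHessian c' ρ he, mongeAmpere_inScale_eq hn hcc hτ hτ' hc hc', h,
      hτ.val_eq_inScale ρ e, hτ.toDensity_val, mul_pow]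
    linear_combination -ψ x * ρ.inScale τ x ^ k * hw _ (hτ x e)

/-- Every projective structure has a representative preserving a scale. -/
theorem exists_parallel_scale [SecondCountableTopology N] {P : ProjectiveStructure n N}
    (hP : IsRep P c) : ∃ (τ : Density n N 1) (c' : AffineConnection n N), τ.IsScale ∧
      τ.IsParallel c' ∧ ProjEquiv c c' ∧ IsRep P c' := by
  obtain ⟨τ, hτ⟩ := exists_isScale (n := n) (N := N)
  refine ⟨τ, c.adapted hτ, hτ, c.isParallel_adapted hτ, c.projEquiv_adapted hτ, ?_⟩
  rw [← hP]
  exact Quotient.sound (ProjEquiv.equivalence.symm (c.projEquiv_adapted hτ))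

end

/-! ### The Monge–Ampère operator on defining functions -/

section
variable {n : ℕ} {N : Type*} [TopologicalSpace N]
  [ChartedSpace (EuclideanSpace ℝ (Fin (n + 1))) N] [IsManifold (𝓡 (n + 1)) ∞ N]

variable {x : N} {c c' : AffineConnection n N} {τ : Density n N 1} {Ω : Set N} {f g r u : N → ℝ}

theorem IsDefiningFunction.diff_ne (hf : IsDefiningFunction (n := n) Ω f) (x : N) (hx : f x = 0) :
    diff (n := n) f x ≠ 0 := hf.diff_ne_zero x ((hf.zero x).1 hx)

theorem diff_mul_of_zero (hu : Smooth n u) (hf : Smooth n f) (hx : f x = 0) (v : Tan n x) :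
    diff (n := n) (fun y => u y * f y) x v = u x * diff (n := n) f x v := by
  rw [diff_mul (contMDiff_mdiff hu x) (contMDiff_mdiff hf x), hx]
  ring

theorem IsDefiningFunction.pos_mul (hf : IsDefiningFunction (n := n) Ω f) (hu : Smooth n u)
    (hpos : ∀ x, 0 < u x) : IsDefiningFunction (n := n) Ω fun x => u x * f x := by
  refine ⟨hu.mul hf.smooth, fun x => ?_, fun x => ?_, fun x hx h => ?_⟩
  · rw [← hf.neg x]
    exact ⟨fun h => by_contra fun h' => h.not_ge (mul_nonneg (hpos x).le (not_lt.1 h')),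
      mul_neg_of_pos_of_neg (hpos x)⟩
  · rw [← hf.zero x, mul_eq_zero, or_iff_right (hpos x).ne']
  · refine hf.diff_ne_zero x hx ?_
    ext1 v
    have h1 := diff_mul_of_zero hu hf.smooth ((hf.zero x).2 hx) v
    rw [h] at h1
    exact (mul_eq_zero.1 h1.symm).resolve_left (hpos x).ne'

/-- The complement of a regular zero set is dense. -/
theorem frequently_ne_zero (hd : ∀ x, f x = 0 → diff (n := n) f x ≠ 0) (x : N) :
    ∃ᶠ y in 𝓝 x, f y ≠ 0 := by
  intro h
  have h' : ∀ᶠ y in 𝓝 x, f y = (fun _ => (0 : ℝ)) y := h.mono fun y hy => not_not.1 hy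
  refine hd x h'.self_of_nhds ?_
  ext1 v
  rw [diff_congr h', diff_const]
  rfl

/-- Powers of `f` can be cancelled off the zero set, whose complement is dense; continuity does the
rest. -/
theorem eq_of_mul_eq (hd : ∀ x, f x = 0 → diff (n := n) f x ≠ 0) {a b : N → ℝ} (ha : Smooth n a)
    (hb : Smooth n b) (k : ℕ) (h : ∀ x, a x * f x ^ k = b x * f x ^ k) (x : N) : a x = b x := by
  by_contra hne
  have h0 : ContinuousAt (fun y => a y - b y) x := (ha x).continuousAt.sub (hb x).continuousAt
  have h1 : ∀ᶠ y in 𝓝 x, a y ≠ b y :=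
    (h0.eventually_ne (sub_ne_zero.2 hne)).mono fun y => sub_ne_zero.1
  obtain ⟨y, hy, hy'⟩ := ((frequently_ne_zero hd x).and_eventually h1).exists
  exact hy' (mul_right_cancel₀ (pow_ne_zero k hy) (h y))

variable [T2Space N]

/-- At a zero of `f` the corner vanishes and the Hessian of `u f` is `u` times that of `f` plus
symmetric products of `du / u` and `df`, which a unipotent congruence removes. -/
theorem mongeAmpere_mul_of_zero (c : AffineConnection n N) (τ : Density n N 1) (hu : Smooth n u)
    (hf : Smooth n f) (hx : f x = 0) (hux : u x ≠ 0) :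
    mongeAmpere c τ (fun y => u y * f y) x = u x ^ (n + 2) * mongeAmpere c τ f x := by
  set e := stdFrame n x with he
  have hM : hessMatrix c (fun y => u y * f y) x e = u x • Matrix.fromBlocks
      (Matrix.of fun _ _ : Unit => (0 : ℝ))
      (Matrix.of fun _ j => diff (n := n) f x (e j) + 0 * (diff (n := n) u x (e j) / u x))
      (Matrix.of fun i _ => diff (n := n) f x (e i) + 0 * (diff (n := n) u x (e i) / u x))
      (Matrix.of fun i j => c.hess f x (e i) (e j) +
        (diff (n := n) u x (e i) / u x) * diff (n := n) f x (e j) +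
        diff (n := n) f x (e i) * (diff (n := n) u x (e j) / u x) +
        0 * (diff (n := n) u x (e i) / u x) * (diff (n := n) u x (e j) / u x)) := by
    rw [Matrix.fromBlocks_smul, hessMatrix]
    congr 1
    · ext i j; simp [hx]
    · ext i j; simp [diff_mul_of_zero hu hf hx]
    · ext i j; simp [diff_mul_of_zero hu hf hx]
    · ext i j
      simp only [Matrix.of_apply, Matrix.smul_apply, hess_mul hu hf, hx, smul_eq_mul]
      field_simp
      ring
  have hM' : hessMatrix c f x e = Matrix.fromBlocks (Matrix.of fun _ _ : Unit => (0 : ℝ))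
      (Matrix.of fun _ j => diff (n := n) f x (e j)) (Matrix.of fun i _ => diff (n := n) f x (e i))
      (Matrix.of fun i j => c.hess f x (e i) (e j)) := by
    rw [hessMatrix]
    simp only [hx, mul_zero, zero_mul, add_zero]
  rw [mongeAmpere, mongeAmpere, ← he, hM, Matrix.det_smul, det_bordered_unipotent, ← hM',
    Fintype.card_sum, Fintype.card_unit, Fintype.card_fin, show 1 + (n + 1) = n + 2 by ring]
  ring

/-- Strict convexity makes the Monge–Ampère operator negative along the boundary. -/
theorem mongeAmpere_neg (h : ProjEquiv c c') (hτ : τ.IsScale) (hr : Smooth n r) (hx : r x = 0)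
    (hd : diff (n := n) r x ≠ 0) (hconv : ∀ u : Tan n x, diff (n := n) r x u = 0 → u ≠ 0 →
      0 < c.hess r x u u) : mongeAmpere c' τ r x < 0 := by
  obtain ⟨p, hp⟩ := h
  set e := stdFrame n x with he
  have hM : hessMatrix c' r x e = Matrix.fromBlocks 0
      (Matrix.of fun _ j => diff (n := n) r x (e j)) (Matrix.of fun i _ => diff (n := n) r x (e i))
      (Matrix.of fun i j => c'.hess r x (e i) (e j)) := by
    rw [hessMatrix]
    simp only [hx, mul_zero, zero_mul, add_zero]
    rfl
  rw [mongeAmpere, ← he, hM]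
  refine mul_neg_of_neg_of_pos (det_bordered_neg _ _ (fun hv => hd ?_) fun w hw hw0 => ?_)
    (pow_pos (hτ x e) _)
  · ext1 v
    rw [← e.sum_repr v, map_sum]
    refine Finset.sum_eq_zero fun i _ => ?_
    rw [map_smul, congrFun hv i]
    simp
  · have h1 : diff (n := n) r x (∑ i, w i • e i) = 0 := by
      rw [← hw, map_sum]
      refine Finset.sum_congr rfl fun i _ => ?_
      rw [map_smul, smul_eq_mul, mul_comm]
    have h2 : ∑ i, w i • e i ≠ 0 := fun h0 => hw0 <| by
      funext i
      rw [← e.repr_sum_self w, h0]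
      simp
    have h3 := hconv _ h1 h2
    -- A projective change alters the Hessian only by multiples of `dr`, so its restriction to the
    -- tangent space of the boundary does not depend on the representative.
    have h4 : c'.hess r x (∑ i, w i • e i) (∑ i, w i • e i) =
        c.hess r x (∑ i, w i • e i) (∑ i, w i • e i) := by
      rw [ProjEquiv.hess_eq (c := c) (fun Y y hY u => hp Y y hY.mdiff u), h1]
      ring
    rw [← h4] at h3
    refine h3.trans_eq ?_
    change hessForm c' hr x (∑ i, w i • e i) (∑ i, w i • e i) = _
    simp only [map_sum, map_smul, LinearMap.sum_apply, LinearMap.smul_apply, smul_eq_mul,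
      dotProduct, Matrix.mulVec, Matrix.of_apply, Finset.mul_sum]
    rw [Finset.sum_comm]
    refine Finset.sum_congr rfl fun i _ => Finset.sum_congr rfl fun j _ => ?_
    change w j * (w i * c'.hess r x (e i) (e j)) = w i * (c'.hess r x (e i) (e j) * w j)
    ring

/-- `f` solves the Monge–Ampère equation up to order `k`, in a scale. -/
def SolvesMod (c : AffineConnection n N) (τ : Density n N 1) (f : N → ℝ) (k : ℕ) : Prop :=
  ∃ ψ : N → ℝ, Smooth n ψ ∧ ∀ x, mongeAmpere c τ f x = -1 + ψ x * f x ^ k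

theorem SolvesMod.mono {k l : ℕ} (hf : Smooth n f) (h : SolvesMod c τ f k) (hl : l ≤ k) :
    SolvesMod c τ f l := by
  obtain ⟨ψ, hψ, h⟩ := h
  refine ⟨fun x => ψ x * f x ^ (k - l), hψ.mul (hf.pow _), fun x => ?_⟩
  rw [h, mul_assoc, ← pow_add, Nat.sub_add_cancel hl]

/-- Errors may be measured by powers of any positive multiple of the defining function. -/
theorem SolvesMod.of_eq_pos_mul {k : ℕ} {v q : N → ℝ} (hv : Smooth n v) (hpos : ∀ x, 0 < v x)
    (hq : Smooth n q) (hg : ∀ x, g x = v x * f x)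
    (h : ∀ x, mongeAmpere c τ g x = -1 + q x * f x ^ k) : SolvesMod c τ g k := by
  refine ⟨fun x => q x / v x ^ k, fun x => (hq x).div₀ ((hv x).pow k) (pow_ne_zero k (hpos x).ne'),
    fun x => ?_⟩
  have := (hpos x).ne'
  rw [h, hg, mul_pow]
  field_simp

variable [SecondCountableTopology N]

/-- On the zero set `u ^ (n + 2) * J[r] = -1` forces `u = (-J[r]) ^ (-1 / (n + 2))`. Elsewhere only
positivity is required; both conditions are convex, so `u` can be glued. -/
theorem exists_solvesMod_one (c : AffineConnection n N) (τ : Density n N 1)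
    (hr : IsDefiningFunction (n := n) Ω r) (hneg : ∀ x, r x = 0 → mongeAmpere c τ r x < 0) :
    ∃ u : N → ℝ, Smooth n u ∧ (∀ x, 0 < u x) ∧ SolvesMod c τ (fun x => u x * r x) 1 := by
  set J := mongeAmpere c τ r with hJ
  have hJs : Smooth n J := mongeAmpere_smooth c τ hr.smooth
  obtain ⟨u, hu, hu'⟩ := exists_smooth_of_local (n := n)
    (fun x q => 0 < q ∧ (r x = 0 → q = (-J x) ^ (-1 / ((n : ℝ) + 2)))) (fun x => by
      intro a ha b hb s t hs ht hst
      simp only [mem_ofPred_eq, smul_eq_mul] at *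
      refine ⟨?_, fun hx => ?_⟩
      · rcases hs.eq_or_lt with h | h
        · have : t = 1 := by linarith
          subst h; subst this; simpa using hb.1
        · have := mul_pos h ha.1
          have := mul_nonneg ht hb.1.le
          linarith
      · rw [ha.2 hx, hb.2 hx, ← add_mul, hst, one_mul]) fun x => by
    by_cases hx : r x = 0
    · have h1 : ∀ᶠ y in 𝓝 x, J y < 0 := (hJs x).continuousAt.eventually (gt_mem_nhds (hneg x hx))
      refine ⟨fun y => (-J y) ^ (-1 / ((n : ℝ) + 2)), ?_, ?_⟩
      · filter_upwards [h1] with y hy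
        have : ContDiffAt ℝ ∞ (fun t : ℝ => t ^ (-1 / ((n : ℝ) + 2))) (-J y) :=
          Real.contDiffAt_rpow_const_of_ne (by linarith)
        exact this.contMDiffAt.comp (f := fun y => -J y) y (hJs y).neg
      · filter_upwards [h1] with y hy
        exact ⟨Real.rpow_pos_of_pos (by linarith) _, fun _ => rfl⟩
    · refine ⟨fun _ => 1, Filter.Eventually.of_forall fun y => contMDiffAt_const, ?_⟩
      filter_upwards [(hr.smooth x).continuousAt.eventually_ne hx] with y hy
      exact ⟨one_pos, fun h => absurd h hy⟩
  have hf := hr.pos_mul hu fun x => (hu' x).1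
  obtain ⟨q, hq, hq'⟩ := exists_smooth_quotient_of_vanish (n := n) hf.smooth
    (g := fun x => mongeAmpere c τ (fun y => u y * r y) x + 1)
    ((mongeAmpere_smooth c τ hf.smooth).add contMDiff_const) hf.diff_ne fun x hx => by
      have hx' : r x = 0 := (mul_eq_zero.1 hx).resolve_left (hu' x).1.ne'
      have hJx := hneg x hx'
      rw [mongeAmpere_mul_of_zero c τ hu hr.smooth hx' (hu' x).1.ne', (hu' x).2 hx',
        ← Real.rpow_natCast, ← Real.rpow_mul (by linarith)]
      have hn : (n : ℝ) + 2 ≠ 0 := by positivity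
      rw [show -1 / ((n : ℝ) + 2) * ((n + 2 : ℕ) : ℝ) = -1 by push_cast; field_simp,
        Real.rpow_neg_one]
      change (-J x)⁻¹ * J x + 1 = 0
      have := hJx.ne
      field_simp
      ring
  exact ⟨u, hu, fun x => (hu' x).1, q, hq, fun x => by rw [pow_one, ← hq']; ring⟩

/-- By the first variation the new error is `(ψ - κ φ) f ^ (m + 1)` up to order `m + 2`, with `κ =
(m+2)(n-2m)`, so `φ = ψ / κ` on the zero set. Away from it `φ` is only constrained by positivity of
`1 + φ f ^ (m + 1)`, which keeps the new function defining. -/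
theorem exists_solvesMod_succ (c : AffineConnection n N) (τ : Density n N 1)
    (hf : IsDefiningFunction (n := n) Ω f) (m : ℕ) (hm : n ≠ 2 * m)
    (h : SolvesMod c τ f (m + 1)) :
    ∃ φ : N → ℝ, Smooth n φ ∧ (∀ x, 0 < 1 + φ x * f x ^ (m + 1)) ∧
      SolvesMod c τ (fun x => f x + φ x * f x ^ (m + 2)) (m + 2) := by
  obtain ⟨ψ, hψ, h⟩ := h
  set κ : ℝ := (m + 2) * (n - 2 * m) with hκ
  have hκ0 : κ ≠ 0 := by
    refine mul_ne_zero (by positivity) (sub_ne_zero.2 ?_)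
    exact_mod_cast hm
  obtain ⟨φ, hφ, hφ'⟩ := exists_smooth_of_local (n := n)
    (fun x q => 0 < 1 + q * f x ^ (m + 1) ∧ (f x = 0 → q = ψ x / κ)) (fun x => by
      intro a ha b hb s t hs ht hst
      simp only [mem_ofPred_eq, smul_eq_mul] at *
      refine ⟨?_, fun hx => ?_⟩
      · have e1 : 1 + (s * a + t * b) * f x ^ (m + 1) =
            s * (1 + a * f x ^ (m + 1)) + t * (1 + b * f x ^ (m + 1)) := by
          linear_combination -hst
        rw [e1]
        rcases hs.eq_or_lt with h | h
        · have : t = 1 := by linarith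
          subst h; subst this; simpa using hb.1
        · have := mul_pos h ha.1
          have := mul_nonneg ht hb.1.le
          linarith
      · rw [ha.2 hx, hb.2 hx, ← add_mul, hst, one_mul]) fun x => by
    by_cases hx : f x = 0
    · have hs : Smooth n fun y => 1 + ψ y / κ * f y ^ (m + 1) :=
        contMDiff_const.add ((hψ.div_const κ).mul (hf.smooth.pow _))
      refine ⟨fun y => ψ y / κ, Smooth.near (hψ.div_const κ) x, ?_⟩
      filter_upwards [(hs x).continuousAt.eventually (lt_mem_nhds (a := 0) (by simp [hx]))] with y hy
      exact ⟨hy, fun _ => rfl⟩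
    · refine ⟨fun _ => 0, Filter.Eventually.of_forall fun y => contMDiffAt_const, ?_⟩
      filter_upwards [(hf.smooth x).continuousAt.eventually_ne hx] with y hy
      exact ⟨by simp, fun h => absurd h hy⟩
  obtain ⟨s, hs, hs'⟩ := exists_smooth_quotient_of_vanish (n := n) hf.smooth
    (g := fun x => ψ x - κ * φ x) (hψ.sub (contMDiff_const.mul hφ)) hf.diff_ne fun x hx => by
      rw [(hφ' x).2 hx]
      field_simp
      ring
  obtain ⟨q, hq, hq'⟩ := mongeAmpere_add_mul_pow c τ hf.smooth hφ m
  refine ⟨φ, hφ, fun x => (hφ' x).1, SolvesMod.of_eq_pos_mul (f := f)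
    (v := fun x => 1 + φ x * f x ^ (m + 1))
    (q := fun x => s x + ψ x * (κ * φ x) * f x ^ m + q x)
    (contMDiff_const.add (hφ.mul (hf.smooth.pow _))) (fun x => (hφ' x).1)
    ((hs.add ((hψ.mul (contMDiff_const.mul hφ)).mul (hf.smooth.pow _))).add hq)
    (fun x => by ring) fun x => ?_⟩
  rw [hq', h]
  have := hs' x
  linear_combination f x ^ (m + 1) * this

end

/-! ### Existence and uniqueness of approximate solutions -/

section
variable {n : ℕ} {N : Type*} [TopologicalSpace N]
  [ChartedSpace (EuclideanSpace ℝ (Fin (n + 1))) N] [IsManifold (𝓡 (n + 1)) ∞ N]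
  [T2Space N] [SecondCountableTopology N]

variable {x : N} {c : AffineConnection n N} {τ : Density n N 1} {Ω : Set N} {f f' g r u w : N → ℝ}

/-- The correction is rewritten with powers of the fixed function `r`, as Borel summation requires.
-/
theorem exists_solvesMod_next (c : AffineConnection n N) (τ : Density n N 1)
    (hr : IsDefiningFunction (n := n) Ω r) (hw : Smooth n w) (hpos : ∀ x, 0 < w x) (m : ℕ)
    (hm : n ≠ 2 * m) (h : SolvesMod c τ (fun x => w x * r x) (m + 1)) :
    ∃ w' a : N → ℝ, Smooth n w' ∧ (∀ x, 0 < w' x) ∧ Smooth n a ∧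
      (∀ x, w' x * r x = w x * r x + a x * r x ^ (m + 2)) ∧
      SolvesMod c τ (fun x => w' x * r x) (m + 2) := by
  obtain ⟨φ, hφ, h1, h2⟩ := exists_solvesMod_succ c τ (hr.pos_mul hw hpos) m hm h
  refine ⟨fun x => w x * (1 + φ x * (w x * r x) ^ (m + 1)), fun x => φ x * w x ^ (m + 2),
    hw.mul (contMDiff_const.add (hφ.mul ((hw.mul hr.smooth).pow _))),
    fun x => mul_pos (hpos x) (h1 x), hφ.mul (hw.pow _), fun x => by ring, ?_⟩
  convert h2 using 2 with x
  ring

theorem exists_solvesMod (c : AffineConnection n N) (τ : Density n N 1)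
    (hr : IsDefiningFunction (n := n) Ω r) (hneg : ∀ x, r x = 0 → mongeAmpere c τ r x < 0) (m : ℕ)
    (hm : ∀ j < m, n ≠ 2 * j) : ∃ w : N → ℝ, Smooth n w ∧ (∀ x, 0 < w x) ∧
      SolvesMod c τ (fun x => w x * r x) (m + 1) := by
  induction m with
  | zero => exact exists_solvesMod_one c τ hr hneg
  | succ m ih =>
    obtain ⟨w, hw, hpos, h⟩ := ih fun j hj => hm j (by omega)
    obtain ⟨w', a, hw', hpos', -, -, h'⟩ :=
      exists_solvesMod_next c τ hr hw hpos m (hm m (by omega)) h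
    exact ⟨w', hw', hpos', h'⟩

/-- A smooth function vanishing near the zero set of `f` is divisible by all powers of `f`. -/
theorem exists_smooth_quotient_pow (hf : Smooth n f) (hg : Smooth n g)
    (h : ∀ x, f x = 0 → ∀ᶠ y in 𝓝 x, g y = 0) (k : ℕ) :
    ∃ q : N → ℝ, Smooth n q ∧ ∀ x, g x = q x * f x ^ k := by
  refine exists_smooth_quotient fun x => ?_
  by_cases hx : f x = 0
  · refine ⟨fun _ => 0, Filter.Eventually.of_forall fun y => contMDiffAt_const, ?_⟩
    filter_upwards [h x hx] with y hy
    rw [hy, zero_mul]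
  · refine ⟨fun y => g y / f y ^ k, (hg.near x).div ((hf.near x).pow k) (pow_ne_zero k hx), ?_⟩
    filter_upwards [(hf x).continuousAt.eventually_ne hx] with y hy
    rw [div_mul_cancel₀ _ (pow_ne_zero k hy)]

/-- A smooth function which is positive on the zero set of `r` can be made positive everywhere
without changing it near this zero set. -/
theorem exists_pos_eventuallyEq {v : N → ℝ} (hv : Smooth n v) (hw : Smooth n w)
    (hpos : ∀ x, 0 < w x) (h : ∀ x, r x = 0 → v x = w x) :
    ∃ v' : N → ℝ, Smooth n v' ∧ (∀ x, 0 < v' x) ∧ ∀ x, r x = 0 → ∀ᶠ y in 𝓝 x, v' y = v y := by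
  obtain ⟨v', hv', hv''⟩ := exists_smooth_of_local (n := n)
    -- Near the zero set `v` is close to `w`, hence exceeds `w / 2` and is kept; where `v` is
    -- smaller it may be replaced by any positive value.
    (fun x q => 0 < q ∧ (w x / 2 ≤ v x → q = v x)) (fun x => by
      intro a ha b hb s t hs ht hst
      simp only [mem_ofPred_eq, smul_eq_mul] at *
      refine ⟨?_, fun hx => ?_⟩
      · rcases hs.eq_or_lt with h | h
        · have : t = 1 := by linarith
          subst h; subst this; simpa using hb.1
        · have := mul_pos h ha.1
          have := mul_nonneg ht hb.1.le
          linarith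
      · rw [ha.2 hx, hb.2 hx, ← add_mul, hst, one_mul]) fun x => by
    by_cases hx : w x / 2 ≤ v x
    · have hvx : 0 < v x := (half_pos (hpos x)).trans_le hx
      refine ⟨v, hv.near x, ?_⟩
      filter_upwards [(hv x).continuousAt.eventually (lt_mem_nhds hvx)] with y hy
      exact ⟨hy, fun _ => rfl⟩
    · refine ⟨fun _ => 1, Filter.Eventually.of_forall fun y => contMDiffAt_const, ?_⟩
      have hc : ContinuousAt (fun y => v y - w y / 2) x :=
        (hv x).continuousAt.sub ((hw x).continuousAt.div_const 2)
      filter_upwards [hc.eventually (gt_mem_nhds (sub_neg.2 (not_le.1 hx)))] with y hy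
      exact ⟨one_pos, fun h => absurd h (by linarith)⟩
  refine ⟨v', hv', fun x => (hv'' x).1, fun x hx => ?_⟩
  have hc : ContinuousAt (fun y => v y - w y / 2) x :=
    (hv x).continuousAt.sub ((hw x).continuousAt.div_const 2)
  filter_upwards [hc.eventually (lt_mem_nhds (a := 0) (by
    have := hpos x
    simp only [h x hx]
    linarith))] with y hy
  exact (hv'' y).2 (by linarith)

/-- The successive corrections `A m * r ^ (m + 2)` are summed by Borel's lemma. The result agrees
with the stage `F m` to order `m + 2`, so by the crude estimate it solves the equation to order `m`,
for every `m`. -/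
theorem exists_solvesMod_all (c : AffineConnection n N) (τ : Density n N 1) (hn : Odd n)
    (hr : IsDefiningFunction (n := n) Ω r) (hneg : ∀ x, r x = 0 → mongeAmpere c τ r x < 0) :
    ∃ w : N → ℝ, Smooth n w ∧ (∀ x, 0 < w x) ∧ ∀ k, SolvesMod c τ (fun x => w x * r x) k := by
  have hm : ∀ m, n ≠ 2 * m := fun m h => (Nat.not_even_iff_odd.2 hn) ⟨m, by omega⟩
  let Good : ℕ → (N → ℝ) → Prop := fun m w =>
    Smooth n w ∧ (∀ x, 0 < w x) ∧ SolvesMod c τ (fun x => w x * r x) (m + 1)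
  have hnext : ∀ m w, Good m w → ∃ w' a : N → ℝ, Good (m + 1) w' ∧ Smooth n a ∧
      ∀ x, w' x * r x = w x * r x + a x * r x ^ (m + 2) := by
    rintro m w ⟨h1, h2, h3⟩
    obtain ⟨w', a, h4, h5, h6, h7, h8⟩ := exists_solvesMod_next c τ hr h1 h2 m (hm m) h3
    exact ⟨w', a, ⟨h4, h5, h8⟩, h6, h7⟩
  choose W A hW hA hWA using hnext
  obtain ⟨w₀, hw₀⟩ : ∃ w₀, Good 0 w₀ := exists_solvesMod_one c τ hr hneg
  let F : ∀ m, {w // Good m w} := fun m =>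
    Nat.rec (motive := fun m => {w // Good m w}) ⟨w₀, hw₀⟩
      (fun m p => ⟨W m p.1 p.2, hW m p.1 p.2⟩) m
  -- The coefficients are shifted by two, `b 0 = b 1 = 0` and `b (m + 2) = A m`, so that partial
  -- sums telescope to the difference of the stages `m` and `0`.
  let b : ℕ → N → ℝ := fun k => Nat.rec (fun _ => 0)
    (fun j _ => Nat.rec (fun _ => 0) (fun m _ => A m (F m).1 (F m).2) j) k
  have hb : ∀ k, Smooth n (b k) := by
    rintro (_ | _ | m)
    · exact contMDiff_const
    · exact contMDiff_const
    · exact hA m (F m).1 (F m).2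
  obtain ⟨G, hG, hGq⟩ := exists_smooth_borel_sum (n := n) hr.smooth hr.diff_ne b hb
  have hsum : ∀ m x, ∑ k ∈ Finset.range (m + 2), b k x * r x ^ k =
      (F m).1 x * r x - w₀ x * r x := by
    intro m x
    induction m with
    | zero =>
      rw [Finset.sum_range_succ, Finset.sum_range_one]
      change 0 * _ + 0 * _ = w₀ x * r x - w₀ x * r x
      ring
    | succ m ih =>
      rw [Finset.sum_range_succ, ih]
      change _ + A m (F m).1 (F m).2 x * _ = W m (F m).1 (F m).2 x * r x - _
      rw [hWA]
      ring
  obtain ⟨q, hq, hq'⟩ := hGq 2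
  have hGq2 : ∀ x, G x = q x * r x ^ 2 := by
    intro x
    have h1 := hsum 0 x
    have h2 : (F 0).1 x * r x - w₀ x * r x = 0 := sub_self _
    rw [← hq', h1, h2, sub_zero]
  -- The factor `w₀ + q r` is positive on the zero set but perhaps not elsewhere; the repair is
  -- invisible to all orders in `r`.
  obtain ⟨v, hv, hvpos, hv'⟩ := exists_pos_eventuallyEq (n := n) (r := r)
    (v := fun x => w₀ x + q x * r x) (hw₀.1.add (hq.mul hr.smooth)) hw₀.1 hw₀.2.1
    fun x hx => by simp [hx]
  refine ⟨v, hv, hvpos, fun m => ?_⟩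
  obtain ⟨s, hs, hs'⟩ := exists_smooth_quotient_pow (n := n) (f := r) hr.smooth
    (g := fun x => v x - (w₀ x + q x * r x)) (hv.sub (hw₀.1.add (hq.mul hr.smooth)))
    (fun x hx => (hv' x hx).mono fun y hy => sub_eq_zero.2 hy) (m + 2)
  obtain ⟨t, ht, ht'⟩ := hGq (m + 2)
  have key : ∀ x, v x * r x = (F m).1 x * r x + (s x * r x + t x) * r x ^ (m + 2) := by
    intro x
    have h1 := ht' x
    rw [hsum m x, hGq2] at h1
    have h2 := hs' x
    linear_combination h1 + r x * h2
  obtain ⟨p, hp, hp'⟩ := mongeAmpere_add_mul_pow_crude c τ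
    (f := fun x => (F m).1 x * r x) (φ := fun x => s x * r x + t x) (r := r)
    ((F m).2.1.mul hr.smooth) ((hs.mul hr.smooth).add ht) hr.smooth m
  obtain ⟨ψ, hψ, hψ'⟩ := (F m).2.2.2
  refine SolvesMod.of_eq_pos_mul (f := r) hv hvpos
    (q := fun x => ψ x * (F m).1 x ^ (m + 1) * r x + p x)
    (((hψ.mul ((F m).2.1.pow _)).mul hr.smooth).add hp) (fun x => rfl) fun x => ?_
  rw [funext key, hp', hψ']
  ring

/-- `f' = f + O(f ^ k)`. -/
def FunEqMod (n : ℕ) {N : Type*} [TopologicalSpace N]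
    [ChartedSpace (EuclideanSpace ℝ (Fin (n + 1))) N] (f f' : N → ℝ) (k : ℕ) : Prop :=
  ∃ φ : N → ℝ, Smooth n φ ∧ ∀ x, f' x - f x = φ x * f x ^ k

theorem FunEqMod.mono {k l : ℕ} (hf : Smooth n f) (h : FunEqMod n f f' k) (hl : l ≤ k) :
    FunEqMod n f f' l := by
  obtain ⟨φ, hφ, h⟩ := h
  refine ⟨fun x => φ x * f x ^ (k - l), hφ.mul (hf.pow _), fun x => ?_⟩
  rw [h, mul_assoc, ← pow_add, Nat.sub_add_cancel hl]

/-- Writing `f' = u f`, the equation on the zero set gives `u ^ (n + 2) = 1`, hence `u = 1` there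
and `f' - f = (u - 1) f` is divisible by `f ^ 2`. -/
theorem funEqMod_two (hf : IsDefiningFunction (n := n) Ω f) (hf' : IsDefiningFunction (n := n) Ω f')
    (h : SolvesMod c τ f 1) (h' : SolvesMod c τ f' 1) : FunEqMod n f f' 2 := by
  have hz : ∀ x, f x = 0 → f' x = 0 := fun x hx => (hf'.zero x).2 ((hf.zero x).1 hx)
  obtain ⟨u, hu, hu'⟩ := exists_smooth_quotient_of_vanish hf.smooth hf'.smooth hf.diff_ne hz
  have huf : f' = fun x => u x * f x := funext hu'
  have hne : ∀ x, f x = 0 → u x ≠ 0 := by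
    intro x hx h0
    refine hf'.diff_ne x (hz x hx) ?_
    ext1 v
    rw [huf, diff_mul_of_zero hu hf.smooth hx, h0, zero_mul]
    rfl
  have hpos : ∀ x, f x ≠ 0 → 0 < u x := by
    intro x hx
    rcases lt_or_gt_of_ne hx with hlt | hgt
    · have h1 : f' x < 0 := (hf'.neg x).2 ((hf.neg x).1 hlt)
      rw [hu'] at h1
      exact pos_of_mul_neg_left h1 hlt.le
    · have h1 : 0 < f' x := by
        refine lt_of_le_of_ne (not_lt.1 fun h1 => ?_) fun h1 => ?_
        · exact hgt.not_gt ((hf.neg x).2 ((hf'.neg x).1 h1))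
        · exact hx ((hf.zero x).2 ((hf'.zero x).1 h1.symm))
      rw [hu'] at h1
      exact pos_of_mul_pos_left h1 hgt.le
  -- The sign is needed to exclude `u = -1` when `n + 2` is even; it comes from the common sign of
  -- `f` and `f'` off the zero set, by density.
  have hnonneg : ∀ x, 0 ≤ u x := by
    intro x
    by_contra hx
    have h1 : ∀ᶠ y in 𝓝 x, u y < 0 := (hu x).continuousAt.eventually (gt_mem_nhds (not_le.1 hx))
    obtain ⟨y, hy, hy'⟩ := ((frequently_ne_zero hf.diff_ne x).and_eventually h1).exists
    exact hy'.not_gt (hpos y hy)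
  obtain ⟨ψ, -, hψ⟩ := h
  obtain ⟨ψ', -, hψ'⟩ := h'
  have hone : ∀ x, f x = 0 → u x - 1 = 0 := by
    intro x hx
    have h1 := mongeAmpere_mul_of_zero c τ hu hf.smooth hx (hne x hx)
    rw [← huf, hψ, hψ', hx, hz x hx] at h1
    have h2 : u x ^ (n + 2) = 1 := by linarith
    rw [(pow_eq_one_iff_of_nonneg (hnonneg x) (by omega)).1 h2, sub_self]
  obtain ⟨φ, hφ, hφ'⟩ := exists_smooth_quotient_of_vanish hf.smooth
    (g := fun x => u x - 1) (hu.sub contMDiff_const) hf.diff_ne hone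
  exact ⟨φ, hφ, fun x => by have := hφ' x; rw [hu']; linear_combination f x * this⟩

/-- For `f' = f + φ f ^ (m + 2)` the first variation shows that `κ φ J[f] f ^ (m + 1)` is of order
`m + 2`. Cancelling powers and using `J[f] = -1` on the zero set gives `φ = 0` there, so `φ`
contributes another factor `f`. -/
theorem FunEqMod.succ (hf : IsDefiningFunction (n := n) Ω f) {m : ℕ} (hm : n ≠ 2 * m)
    (h : SolvesMod c τ f (m + 2)) (h' : SolvesMod c τ f' (m + 2)) (heq : FunEqMod n f f' (m + 2)) :
    FunEqMod n f f' (m + 3) := by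
  obtain ⟨φ, hφ, hφ'⟩ := heq
  obtain ⟨ψ, hψ, hψf⟩ := h
  obtain ⟨ψ', hψ', hψf'⟩ := h'
  set κ : ℝ := (m + 2) * (n - 2 * m) with hκ
  have hκ0 : κ ≠ 0 := by
    refine mul_ne_zero (by positivity) (sub_ne_zero.2 ?_)
    exact_mod_cast hm
  have hff' : f' = fun x => f x + φ x * f x ^ (m + 2) := by
    funext x
    linarith [hφ' x]
  obtain ⟨q, hq, hq'⟩ := mongeAmpere_add_mul_pow c τ hf.smooth hφ m
  rw [← hff'] at hq'
  have hMA := mongeAmpere_smooth c τ hf.smooth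
  set v : N → ℝ := fun x => 1 + φ x * f x ^ (m + 1)
  have hv : Smooth n v := contMDiff_const.add (hφ.mul (hf.smooth.pow _))
  have key := eq_of_mul_eq hf.diff_ne (a := fun x => κ * φ x * mongeAmpere c τ f x)
    (b := fun x => (ψ' x * v x ^ (m + 2) - ψ x - q x) * f x)
    ((contMDiff_const.mul hφ).mul hMA)
    ((((hψ'.mul (hv.pow _)).sub hψ).sub hq).mul hf.smooth) (m + 1) fun x => by
      have h1 := hq' x
      have h2 : f' x = v x * f x := by
        rw [hff']
        simp only [v]
        ring
      rw [hψf', h2, mul_pow] at h1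
      have h3 := hψf x
      linear_combination -h1 - h3
  obtain ⟨s, hs, hs'⟩ := exists_smooth_quotient_of_vanish hf.smooth hφ hf.diff_ne fun x hx => by
    have h1 := key x
    simp only [hψf, hx, mul_zero] at h1
    rw [zero_pow (by omega), mul_zero, add_zero] at h1
    have h2 : κ * φ x = 0 := by linarith
    exact (mul_eq_zero.1 h2).resolve_left hκ0
  exact ⟨s, hs, fun x => by rw [hφ', hs']; ring⟩

theorem funEqMod_of_solvesMod (hf : IsDefiningFunction (n := n) Ω f)
    (hf' : IsDefiningFunction (n := n) Ω f') (m : ℕ) (hm : ∀ j < m, n ≠ 2 * j)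
    (h : SolvesMod c τ f (m + 1)) (h' : SolvesMod c τ f' (m + 1)) : FunEqMod n f f' (m + 2) := by
  induction m with
  | zero => exact funEqMod_two hf hf' h h'
  | succ m ih =>
    exact FunEqMod.succ hf (hm m (by omega)) h h' (ih (fun j hj => hm j (by omega))
      (h.mono hf.smooth (by omega)) (h'.mono hf'.smooth (by omega)))

end
end ProjGeom

/-! ### The proposition, assembled in one scale. -/

open ProjGeom in
theorem proposition3p4 (n : ℕ) (hn : 2 ≤ n) (N : Type*) [TopologicalSpace N]
    [T2Space N] [SecondCountableTopology N]
    [ChartedSpace (EuclideanSpace ℝ (Fin (n + 1))) N] [IsManifold (𝓡 (n + 1)) ∞ N]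
    (P : ProjGeom.ProjectiveStructure n N)
    (Ω : Set N) (hΩ_open : IsOpen Ω) (hΩ_conn : IsConnected Ω) (hΩ_compact : IsCompact (closure Ω))
    (hΩ_convex : ProjGeom.HasStrictlyConvexBoundary P Ω) :
    (∃ ρ : ProjGeom.Density n N 2, ProjGeom.IsFeffermanDensity P Ω ρ) ∧
    ∀ ρ ρ' : ProjGeom.Density n N 2,
      ProjGeom.IsFeffermanDensity P Ω ρ → ProjGeom.IsFeffermanDensity P Ω ρ' →
        (Odd n → ∀ k : ℕ, ProjGeom.EqMod ρ ρ' k) ∧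
        (Even n → ProjGeom.EqMod ρ ρ' (n / 2 + 2)) := by
  obtain ⟨c₁, r, hc₁, hr, hconv⟩ := hΩ_convex
  obtain ⟨τ, c, hτ, hc, hcc, hP⟩ := exists_parallel_scale hc₁
  have hn0 : n ≠ 0 := by omega
  have hneg : ∀ x, r x = 0 → mongeAmpere c τ r x < 0 := fun x hx =>
    mongeAmpere_neg hcc hτ hr.smooth hx (hr.diff_ne x hx) (hconv x ((hr.zero x).1 hx))
  have hodd : Odd n → ∀ m, n ≠ 2 * m := fun h m hm => (Nat.not_even_iff_odd.2 h) ⟨m, by omega⟩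
  -- For even `n` the coefficient `n - 2j` first vanishes at `j = n / 2`, exactly where both
  -- inductions end.
  have heven : Even n → ∀ j < n / 2, n ≠ 2 * j := fun _ j hj => by omega
  have hsolves := fun (ρ : Density n N 2) k => solvesMongeAmpereMod_iff hn0 hP hτ hc ρ k
  constructor
  · obtain ⟨w, hw, hpos, hodd', heven'⟩ : ∃ w : N → ℝ, Smooth n w ∧ (∀ x, 0 < w x) ∧
        (Odd n → ∀ k, SolvesMod c τ (fun x => w x * r x) k) ∧
        (Even n → SolvesMod c τ (fun x => w x * r x) (n / 2 + 1)) := by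
      rcases Nat.even_or_odd n with h | h
      · obtain ⟨w, hw, hpos, h'⟩ := exists_solvesMod c τ hr hneg (n / 2) (heven h)
        exact ⟨w, hw, hpos, fun h'' => absurd h (Nat.not_even_iff_odd.2 h''), fun _ => h'⟩
      · obtain ⟨w, hw, hpos, h'⟩ := exists_solvesMod_all c τ h hr hneg
        exact ⟨w, hw, hpos, fun _ => h', fun h'' => absurd h'' (Nat.not_even_iff_odd.2 h)⟩
    have hf := hr.pos_mul hw hpos
    refine ⟨hτ.toDensity 2 hf.smooth, (hτ.isDefiningDensity_iff _ Ω).2 ?_, fun h k => ?_, fun h => ?_⟩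
    · rw [hτ.inScale_toDensity]
      exact hf
    · rw [hsolves, hτ.inScale_toDensity]
      exact hodd' h k
    · rw [hsolves, hτ.inScale_toDensity]
      exact heven' h
  · intro ρ ρ' hρ hρ'
    have hf := (hτ.isDefiningDensity_iff ρ Ω).1 hρ.defining
    have hf' := (hτ.isDefiningDensity_iff ρ' Ω).1 hρ'.defining
    refine ⟨fun h k => (hτ.eqMod_iff ρ ρ' k).2 ?_, fun h => (hτ.eqMod_iff ρ ρ' _).2 ?_⟩
    -- Solutions to order `k + 1` agree to order `k + 2`, which is more than needed.
    · exact FunEqMod.mono hf.smooth (funEqMod_of_solvesMod hf hf' k (fun j _ => hodd h j)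
        ((hsolves ρ _).1 (hρ.odd h _)) ((hsolves ρ' _).1 (hρ'.odd h _))) (by omega)
    · exact funEqMod_of_solvesMod hf hf' (n / 2) (heven h)
        ((hsolves ρ _).1 (hρ.even h)) ((hsolves ρ' _).1 (hρ'.even h))
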